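/- **Definitions.** Let $X$ be a nonempty compact ultrametric space. A *ball* of $X$ is an open metric ball of positive radius. A *similarity* is a map multiplying all distances by a constant $C>0$. A *finite similarity structure* $\mathrm{Sim}_X$ assigns to each ordered pair of balls $B_1,B_2$ a finite set $\mathrm{Sim}_X(B_1,B_2)$ of surjective similarities $B_1\to B_2$, such that $\mathrm{id}_B\in \mathrm{Sim}_X(B,B)$, and the sets are closed under inverses, under compositions, and under restrictions (if $h\in\mathrm{Sim}_X(B_1,B_2)$ and $B_3\subseteq B_1$ is a ball, then $h|_{B_3}\in\mathrm{Sim}_X(B_3,h(B_3))$). It is *small* if $|\mathrm{Sim}_X(B_1,B_2)|\le 1$ for all balls $B_1,B_2$. The *FSS group* $\Gamma(\mathrm{Sim}_X)$ is the group, under composition, of all homeomorphisms $h:X\to X$ such that every point of $X$ lies in a ball $B$ for which $h(B)$ is a ball and $h|_B\in\mathrm{Sim}_X(B,h(B))$. A *ball order* is a choice of a linear order on the set of maximal proper subballs of each ball; it is *compatible* with $\mathrm{Sim}_X$ if each $h\in\mathrm{Sim}_X(B_1,B_2)$ induces an order-preserving bijection from the maximal proper subballs of $B_1$ to those of $B_2$.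 The class of a ball is $[B]=\{B' : \mathrm{Sim}_X(B,B')\neq\emptyset\}$. A *semigroup presentation* $\mathcal P=\langle\Sigma\mid\mathcal R\rangle$ is a set $\Sigma$ with a set $\mathcal R\subseteq\Sigma^+\times\Sigma^+$ of pairs of nonempty words. It is *tree-like* if $|w_1|=1$ and $|w_2|>1$ for all $(w_1,w_2)\in\mathcal R$, and $(a,w_1),(a,w_2)\in\mathcal R$ imply $w_1=w_2$. For a small $\mathrm{Sim}_X$ with compatible ball order, $\mathcal P_{\mathrm{Sim}_X}$ is the presentation with letters $[B]$, $B$ a ball of $X$, and relations $([B],[B_1]\cdots[B_n])$, where $B$ is a ball, $n\ge1$, and $B_1,\dots,B_n$ are the maximal proper subballs of $B$ listed in order. For words $u,v$, a *braided $(u,v)$-diagram* over $\mathcal P$ consists of a frame, a finite set of transistors, and finitely many wires labelled by letters. Each wire runs from a top contact, on the top of the frame or on the bottom of a transistor, to a bottom contact, on the bottom of the frame or on the top of a transistor, and distinct wires have distinct top contacts and distinct bottom contacts. Reading labels from left to right gives $u$ on the top and $v$ on the bottom of the frame; for each transistor, the pair of its top label and its bottom label, in one of the two orders, belongs to $\mathcal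 R$. Write $T_1\preceq T_2$ if a wire runs from the bottom of $T_2$ to the top of $T_1$; the transitive closure of $\preceq$ must be a strict partial order. Diagrams are considered up to bijections of transistors and wires respecting labels and the left-to-right positions of all contacts. A *dipole* is a pair $T_1\preceq T_2$ such that the bottom label of $T_1$ equals the top label of $T_2$ and the wires at the bottom of $T_2$ are, in the same order, the wires at the top of $T_1$; it is *reduced* by deleting $T_1$, $T_2$ and the wires between them and gluing the $j$-th wire at the top of $T_2$ to the $j$-th wire at the bottom of $T_1$. The *braided diagram group* $D_b(\mathcal P,w)$ is the set of braided $(w,w)$-diagrams modulo the equivalence relation generated by reduction of dipoles, with the product induced by stacking diagrams. For a tree-like $\mathcal P$ and $x\in\Sigma$, let $T_{(\mathcal P,x)}$ be the labelled ordered rooted tree whose root is labelled $x$ and in which a vertex labelled $a$ has children labelled, in order, $x_1,\dots,x_k$ if $(a,x_1\cdots x_k)\in\mathcal R$, and no children if $a$ is not the left side of a relation. Let $\mathrm{Ends}(T_{(\mathcal P,x)})$ be the set of paths without backtracking that begin at the root and are infinite or terminate at a vertex without children, with the metric $d(p,p')=e^{-m}$ for $p\ne p'$, where $m$ is the number of edges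 common to $p$ and $p'$. **Theorem.** (1) Let $X$ be a nonempty compact ultrametric space with a small finite similarity structure $\mathrm{Sim}_X$ and a compatible ball order. Then $\mathcal P_{\mathrm{Sim}_X}$ is tree-like, and $$\Gamma(\mathrm{Sim}_X)\cong D_b(\mathcal P_{\mathrm{Sim}_X},[X]).$$ (2) Conversely, let $\mathcal P=\langle\Sigma\mid\mathcal R\rangle$ be a tree-like semigroup presentation and $x\in\Sigma$. Then $\mathrm{Ends}(T_{(\mathcal P,x)})$ is a nonempty compact ultrametric space, and there are a small finite similarity structure $\mathrm{Sim}$ on it and a ball order compatible with $\mathrm{Sim}$ such that $$D_b(\mathcal P,x)\cong\Gamma(\mathrm{Sim}).$$ -/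

import Mathlib

/-- A semigroup presentation over the alphabet `A`: a set of relations, which are ordered pairs of
nonempty words. -/
structure SemigroupPresentation (A : Type*) where
  /-- The relations. -/
  rels : Set (List A × List A)
  left_ne_nil : ∀ r ∈ rels, r.1 ≠ []
  right_ne_nil : ∀ r ∈ rels, r.2 ≠ []

/-- A presentation is tree-like if every relation has a single letter on the left and a word of
length at least two on the right, and each letter is the left side of at most one relation. -/
def SemigroupPresentation.TreeLike {A : Type*} (P : SemigroupPresentation A) : Prop :=
  (∀ r ∈ P.rels, r.1.length = 1 ∧ 1 < r.2.length) ∧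
    ∀ (a : A) (w₁ w₂ : List A), ([a], w₁) ∈ P.rels → ([a], w₂) ∈ P.rels → w₁ = w₂

/-- Positions at which wires can be attached: `Sum.inl i` is the `i`-th position (from the left) on
the frame, `Sum.inr (t, i)` is the `i`-th position on the transistor `t`. The top contacts of wires
lie on the top of the frame or on bottoms of transistors, the bottom contacts lie on the bottom
of the frame or on tops of transistors. -/
abbrev Contact (T : Type) : Type := ℕ ⊕ (T × ℕ)

/-- The letter found at a position, when the frame carries the word `f` and the transistor `t`
carries the word `l t`; it is `none` if there is no such position. -/
def contactLabel {A : Type*} {T : Type} (f : List A) (l : T → List A) : Contact T → Option A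
  | Sum.inl i => f[i]?
  | Sum.inr (t, i) => (l t)[i]?

/-- A braided `(u, v)`-diagram over `P`. Since distinct wires have distinct top contacts, and
distinct bottom contacts, a wire is recorded by its top contact `c`; its bottom contact is `wire c`
and its label is the letter at `c`. Thus `wire` is a label preserving bijection from the
positions on the top of the frame and the bottoms of transistors onto the positions on the bottom
of the frame and the tops of transistors; its values elsewhere are meaningless (and are ignored by
the equivalence of diagrams). -/
structure BraidedDiagram {A : Type*} (P : SemigroupPresentation A) (u v : List A) where
  /-- The transistors. -/
  T : Type
  finite_T : Finite T
  /-- The top label of a transistor. -/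
  top : T → List A
  /-- The bottom label of a transistor. -/
  bot : T → List A
  rel : ∀ t, (top t, bot t) ∈ P.rels ∨ (bot t, top t) ∈ P.rels
  /-- The map taking the top contact of a wire to its bottom contact. -/
  wire : Contact T → Contact T
  bijOn : Set.BijOn wire {c | contactLabel u bot c ≠ none} {c | contactLabel v top c ≠ none}
  label_wire : ∀ c, contactLabel u bot c ≠ none →
    contactLabel v top (wire c) = contactLabel u bot c
  acyclic : ∀ t, ¬ Relation.TransGen (fun t₁ t₂ : T => ∃ i j, i < (bot t₂).length ∧
    wire (Sum.inr (t₂, i)) = Sum.inr (t₁, j)) t t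

/-- The map of contacts induced by a map of transistors; contacts on the frame stay fixed. -/
def Contact.map {T T' : Type} (f : T → T') : Contact T → Contact T' :=
  Sum.map id (Prod.map f id)

namespace BraidedDiagram

variable {A : Type*} {P : SemigroupPresentation A} {u v w z : List A}

/-- The contact `c` is the top contact of a wire. -/
def IsOut (D : BraidedDiagram P u v) (c : Contact D.T) : Prop := contactLabel u D.bot c ≠ none

/-- The contact `c` is the bottom contact of a wire. -/
def IsIn (D : BraidedDiagram P u v) (c : Contact D.T) : Prop := contactLabel v D.top c ≠ none

/-- Some wire runs from the bottom of `t₂` to the top of `t₁`. -/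
def Below (D : BraidedDiagram P u v) (t₁ t₂ : D.T) : Prop :=
  ∃ i j, i < (D.bot t₂).length ∧ D.wire (Sum.inr (t₂, i)) = Sum.inr (t₁, j)

/-- Equivalence of diagrams: a bijection of the transistors that respects top and bottom labels and
all wires. -/
def Iso (D D' : BraidedDiagram P u v) : Prop :=
  ∃ e : D'.T ≃ D.T, (∀ t, D.top (e t) = D'.top t) ∧ (∀ t, D.bot (e t) = D'.bot t) ∧
    ∀ c, D'.IsOut c → D.wire (c.map e) = (D'.wire c).map e

/-- `(t₁, t₂)` is a dipole: the bottom label of `t₁` is the top label of `t₂`, and the wires at the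
bottom of `t₂` are, in the same order, the wires at the top of `t₁`. -/
def IsDipole (D : BraidedDiagram P u v) (t₁ t₂ : D.T) : Prop :=
  D.bot t₁ = D.top t₂ ∧ (D.top t₁).length = (D.bot t₂).length ∧
    ∀ i < (D.bot t₂).length, D.wire (Sum.inr (t₂, i)) = Sum.inr (t₁, i)

/-- `D'` is obtained from `D` by reducing a dipole `(t₁, t₂)`: the transistors of `D'` are those of
`D` other than `t₁` and `t₂`, the wires between `t₂` and `t₁` are removed, the `j`-th wire at the
top of `t₂` is glued to the `j`-th wire at the bottom of `t₁`, and the other wires stay. -/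
def Reduces (D D' : BraidedDiagram P u v) : Prop :=
  ∃ t₁ t₂ : D.T, D.IsDipole t₁ t₂ ∧ ∃ e : D'.T → D.T, Function.Injective e ∧
    (∀ t, t ∈ Set.range e ↔ t ≠ t₁ ∧ t ≠ t₂) ∧
    (∀ t, D.top (e t) = D'.top t) ∧ (∀ t, D.bot (e t) = D'.bot t) ∧
    ∀ c, D'.IsOut c → D.wire (c.map e) = (D'.wire c).map e ∨
      ∃ j, D.wire (c.map e) = Sum.inr (t₂, j) ∧ D.wire (Sum.inr (t₁, j)) = (D'.wire c).map e

/-- One step of the equivalence of diagrams modulo dipoles. -/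
def Step (D D' : BraidedDiagram P u v) : Prop := D.Iso D' ∨ D.Reduces D'

/-! Concatenation of diagrams. -/

/-- Contacts of the second factor inside a concatenation. -/
def emb {T₁ T₂ : Type} : Contact T₂ → Contact (T₁ ⊕ T₂) := Contact.map Sum.inr

/-- A wire of the upper factor that ends at the given contact: if this is the `j`-th position on the
bottom of the frame, it is continued by the `j`-th wire at the top of the lower factor. -/
def cont {T₁ T₂ : Type} (w₂ : Contact T₂ → Contact T₂) : Contact T₁ → Contact (T₁ ⊕ T₂)
  | Sum.inl j => emb (w₂ (Sum.inl j))
  | Sum.inr (t, j) => Sum.inr (Sum.inl t, j)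

/-- The wires of a concatenation, the diagram with wires `w₁` being stacked on top of the diagram
with wires `w₂`. -/
def concatWire {T₁ T₂ : Type} (w₁ : Contact T₁ → Contact T₁) (w₂ : Contact T₂ → Contact T₂) :
    Contact (T₁ ⊕ T₂) → Contact (T₁ ⊕ T₂)
  | Sum.inl i => cont w₂ (w₁ (Sum.inl i))
  | Sum.inr (Sum.inl t, i) => cont w₂ (w₁ (Sum.inr (t, i)))
  | Sum.inr (Sum.inr t, i) => emb (w₂ (Sum.inr (t, i)))

theorem isIn_wire (D : BraidedDiagram P u v) {c : Contact D.T} (h : D.IsOut c) :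
    D.IsIn (D.wire c) := D.bijOn.mapsTo h

theorem wire_inj (D : BraidedDiagram P u v) {c d : Contact D.T} (hc : D.IsOut c) (hd : D.IsOut d)
    (h : D.wire c = D.wire d) : c = d := D.bijOn.injOn hc hd h

theorem wire_surj (D : BraidedDiagram P u v) {d : Contact D.T} (h : D.IsIn d) :
    ∃ c, D.IsOut c ∧ D.wire c = d := D.bijOn.surjOn h

/-- For the bijectivity of `wire`, it suffices to verify the label condition, injectivity and
surjectivity. -/
theorem bijOn_of {T : Type} {top bot : T → List A} {wire : Contact T → Contact T}
    (h : ∀ c, contactLabel u bot c ≠ none → contactLabel v top (wire c) = contactLabel u bot c)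
    (hi : ∀ c d, contactLabel u bot c ≠ none → contactLabel u bot d ≠ none →
      wire c = wire d → c = d)
    (hs : ∀ d, contactLabel v top d ≠ none → ∃ c, contactLabel u bot c ≠ none ∧ wire c = d) :
    Set.BijOn wire {c | contactLabel u bot c ≠ none} {c | contactLabel v top c ≠ none} :=
  ⟨fun c hc => by simpa [h c hc] using hc, fun c hc d hd => hi c d hc hd, fun d hd => hs d hd⟩

theorem emb_injective {T₁ T₂ : Type} : Function.Injective (emb : Contact T₂ → Contact (T₁ ⊕ T₂)) := by
  rintro (i | ⟨t, i⟩) (j | ⟨s, j⟩) h <;> simp_all [emb, Contact.map]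

theorem emb_ne {T₁ T₂ : Type} (c : Contact T₂) (t : T₁) (i : ℕ) :
    (emb c : Contact (T₁ ⊕ T₂)) ≠ Sum.inr (Sum.inl t, i) := by
  rcases c with i | ⟨t, i⟩ <;> simp [emb, Contact.map]

theorem contactLabel_emb {T₁ T₂ : Type} (f : List A) (l₁ : T₁ → List A) (l₂ : T₂ → List A)
    (c : Contact T₂) : contactLabel f (Sum.elim l₁ l₂) (emb c) = contactLabel f l₂ c := by
  rcases c with i | ⟨t, i⟩ <;> rfl

/-- The inclusion of the contacts of the upper factor. -/
def embL {T₁ T₂ : Type} : Contact T₁ → Contact (T₁ ⊕ T₂) := Contact.map Sum.inl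

theorem concatWire_embL {T₁ T₂ : Type} (w₁ : Contact T₁ → Contact T₁)
    (w₂ : Contact T₂ → Contact T₂) (c : Contact T₁) :
    concatWire w₁ w₂ (embL c) = cont w₂ (w₁ c) := by
  rcases c with i | ⟨t, i⟩ <;> rfl

theorem contactLabel_embL {T₁ T₂ : Type} (f : List A) (l₁ : T₁ → List A) (l₂ : T₂ → List A)
    (c : Contact T₁) : contactLabel f (Sum.elim l₁ l₂) (embL c) = contactLabel f l₁ c := by
  rcases c with i | ⟨t, i⟩ <;> rfl

theorem contact_cases {T₁ T₂ : Type} (c : Contact (T₁ ⊕ T₂)) :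
    (∃ d : Contact T₁, c = embL d) ∨ ∃ (t : T₂) (i : ℕ), c = Sum.inr (Sum.inr t, i) := by
  rcases c with i | ⟨t | t, i⟩
  · exact Or.inl ⟨Sum.inl i, rfl⟩
  · exact Or.inl ⟨Sum.inr (t, i), rfl⟩
  · exact Or.inr ⟨t, i, rfl⟩

theorem cont_inj (E : BraidedDiagram P v w) {T₁ : Type} {l : T₁ → List A} {c d : Contact T₁}
    (hc : contactLabel v l c ≠ none) (hd : contactLabel v l d ≠ none)
    (h : cont E.wire c = cont E.wire d) : c = d := by
  rcases c with i | ⟨t, i⟩ <;> rcases d with j | ⟨s, j⟩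
  · have := E.wire_inj (c := Sum.inl i) (d := Sum.inl j) hc hd (emb_injective h)
    simpa using this
  · exact absurd h (emb_ne _ _ _)
  · exact absurd h.symm (emb_ne _ _ _)
  · simpa [cont] using h

theorem cont_ne (E : BraidedDiagram P v w) {T₁ : Type} {l : T₁ → List A} {c : Contact T₁}
    (hc : contactLabel v l c ≠ none) {t : E.T} {i : ℕ} (ht : E.IsOut (Sum.inr (t, i))) :
    cont E.wire c ≠ emb (E.wire (Sum.inr (t, i))) := by
  rcases c with j | ⟨s, j⟩
  · intro h
    have := E.wire_inj (c := Sum.inl j) hc ht (emb_injective h)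
    simp at this
  · exact fun h => emb_ne _ _ _ h.symm

theorem label_cont (E : BraidedDiagram P v w) {T₁ : Type} {l : T₁ → List A} {c : Contact T₁}
    (hc : contactLabel v l c ≠ none) :
    contactLabel w (Sum.elim l E.top) (cont E.wire c) = contactLabel v l c := by
  rcases c with j | ⟨s, j⟩
  · exact (contactLabel_emb _ _ _ _).trans (E.label_wire (Sum.inl j) hc)
  · rfl

/-- The concatenation `D ∘ E`: the diagram `D` is stacked on top of the diagram `E`. -/
def concat (D : BraidedDiagram P u v) (E : BraidedDiagram P v w) : BraidedDiagram P u w where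
  T := D.T ⊕ E.T
  finite_T := by have := D.finite_T; have := E.finite_T; infer_instance
  top := Sum.elim D.top E.top
  bot := Sum.elim D.bot E.bot
  rel := by rintro (t | t); exacts [D.rel t, E.rel t]
  wire := concatWire D.wire E.wire
  bijOn := by
    have hl : ∀ c : Contact (D.T ⊕ E.T), contactLabel u (Sum.elim D.bot E.bot) c ≠ none →
        contactLabel w (Sum.elim D.top E.top) (concatWire D.wire E.wire c) =
          contactLabel u (Sum.elim D.bot E.bot) c := by
      intro c hc
      rcases contact_cases c with ⟨d, rfl⟩ | ⟨t, i, rfl⟩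
      · rw [contactLabel_embL] at hc ⊢
        rw [concatWire_embL, label_cont E (D.isIn_wire hc), D.label_wire d hc]
      · exact (contactLabel_emb _ _ _ _).trans (E.label_wire (Sum.inr (t, i)) hc)
    refine bijOn_of hl ?_ ?_
    · intro c d hc hd h
      rcases contact_cases c with ⟨c, rfl⟩ | ⟨t, i, rfl⟩ <;>
        rcases contact_cases d with ⟨d, rfl⟩ | ⟨s, j, rfl⟩
      · rw [contactLabel_embL] at hc hd
        rw [concatWire_embL, concatWire_embL] at h
        rw [D.wire_inj hc hd (cont_inj E (D.isIn_wire hc) (D.isIn_wire hd) h)]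
      · rw [contactLabel_embL] at hc
        rw [concatWire_embL] at h
        exact absurd h (cont_ne E (D.isIn_wire hc) hd)
      · rw [contactLabel_embL] at hd
        rw [concatWire_embL] at h
        exact absurd h.symm (cont_ne E (D.isIn_wire hd) hc)
      · have := E.wire_inj (c := Sum.inr (t, i)) (d := Sum.inr (s, j)) hc hd (emb_injective h)
        simpa using this
    · intro d hd
      have key : ∀ d' : Contact E.T, E.IsIn d' → d = emb d' → ∃ c,
          contactLabel u (Sum.elim D.bot E.bot) c ≠ none ∧ concatWire D.wire E.wire c = d := by
        rintro d' hd' rfl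
        obtain ⟨c, hc, rfl⟩ := E.wire_surj hd'
        rcases c with j | ⟨t, j⟩
        · obtain ⟨c, hc', h⟩ := D.wire_surj (d := Sum.inl j) hc
          refine ⟨embL c, by rwa [contactLabel_embL], ?_⟩
          rw [concatWire_embL, h]; rfl
        · exact ⟨Sum.inr (Sum.inr t, j), hc, rfl⟩
      rcases d with i | ⟨t | t, i⟩
      · exact key (Sum.inl i) hd rfl
      · obtain ⟨c, hc', h⟩ := D.wire_surj (d := Sum.inr (t, i)) hd
        refine ⟨embL c, by rwa [contactLabel_embL], ?_⟩
        rw [concatWire_embL, h]; rfl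
      · exact key (Sum.inr (t, i)) hd rfl
  label_wire := by
    intro c hc
    rcases contact_cases c with ⟨d, rfl⟩ | ⟨t, i, rfl⟩
    · rw [contactLabel_embL] at hc ⊢
      rw [concatWire_embL, label_cont E (D.isIn_wire hc), D.label_wire d hc]
    · exact (contactLabel_emb _ _ _ _).trans (E.label_wire (Sum.inr (t, i)) hc)
  acyclic := by
    have key : ∀ x y : D.T ⊕ E.T, Relation.TransGen (fun t₁ t₂ : D.T ⊕ E.T => ∃ i j,
        i < (Sum.elim D.bot E.bot t₂).length ∧
        concatWire D.wire E.wire (Sum.inr (t₂, i)) = Sum.inr (t₁, j)) x y →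
        (∃ a b, x = Sum.inl a ∧ y = Sum.inl b ∧ Relation.TransGen D.Below a b) ∨
        (∃ a b, x = Sum.inr a ∧ y = Sum.inr b ∧ Relation.TransGen E.Below a b) ∨
        (∃ a b, x = Sum.inr a ∧ y = Sum.inl b) := by
      have base : ∀ x y : D.T ⊕ E.T, (∃ i j, i < (Sum.elim D.bot E.bot y).length ∧
          concatWire D.wire E.wire (Sum.inr (y, i)) = Sum.inr (x, j)) →
          (∃ a b, x = Sum.inl a ∧ y = Sum.inl b ∧ D.Below a b) ∨
          (∃ a b, x = Sum.inr a ∧ y = Sum.inr b ∧ E.Below a b) ∨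
          (∃ a b, x = Sum.inr a ∧ y = Sum.inl b) := by
        rintro x (y | y) ⟨i, j, hi, h⟩
        · rcases x with x | x
          · left
            refine ⟨x, y, rfl, rfl, i, j, hi, ?_⟩
            change cont E.wire (D.wire (Sum.inr (y, i))) = _ at h
            rcases hD : D.wire (Sum.inr (y, i)) with k | ⟨s, k⟩
            · rw [hD] at h; exact absurd h (emb_ne _ _ _)
            · rw [hD] at h; simpa [cont] using h
          · exact Or.inr (Or.inr ⟨x, y, rfl, rfl⟩)
        · rcases x with x | x
          · exact absurd h (emb_ne _ _ _)
          · right; left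
            refine ⟨x, y, rfl, rfl, i, j, hi, ?_⟩
            exact emb_injective h
      intro x y h
      induction h with
      | single h =>
        rcases base _ _ h with ⟨a, b, h1, h2, h3⟩ | ⟨a, b, h1, h2, h3⟩ | h
        · exact Or.inl ⟨a, b, h1, h2, .single h3⟩
        · exact Or.inr (Or.inl ⟨a, b, h1, h2, .single h3⟩)
        · exact Or.inr (Or.inr h)
      | tail _ h ih =>
        rcases base _ _ h with ⟨a, b, h1, h2, h3⟩ | ⟨a, b, h1, h2, h3⟩ | ⟨a, b, h1, h2⟩ <;>
          rcases ih with ⟨c, d, h4, h5, h6⟩ | ⟨c, d, h4, h5, h6⟩ | ⟨c, d, h4, h5⟩ <;>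
          subst h1 h4 <;> simp at h5 <;> subst h2 h5
        · exact Or.inl ⟨_, _, rfl, rfl, h6.tail h3⟩
        · exact Or.inr (Or.inr ⟨_, _, rfl, rfl⟩)
        · exact Or.inr (Or.inl ⟨_, _, rfl, rfl, h6.tail h3⟩)
        · exact Or.inr (Or.inr ⟨_, _, rfl, rfl⟩)
    intro t ht
    rcases key t t ht with ⟨a, b, h1, h2, h3⟩ | ⟨a, b, h1, h2, h3⟩ | ⟨a, b, h1, h2⟩
    · obtain rfl : a = b := by simpa [h1] using h2
      exact D.acyclic a h3
    · obtain rfl : a = b := by simpa [h1] using h2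
      exact E.acyclic a h3
    · simp [h1] at h2

/-- The identity diagram: no transistors, and the `i`-th position on the top of the frame is joined
to the `i`-th position on the bottom. -/
def one (P : SemigroupPresentation A) (u : List A) : BraidedDiagram P u u where
  T := Empty
  finite_T := inferInstance
  top := Empty.elim
  bot := Empty.elim
  rel := fun t => t.elim
  wire := id
  bijOn := Set.bijOn_id _
  label_wire := fun _ _ => rfl
  acyclic := fun t => t.elim

instance (T : Type) : Nonempty (Contact T) := ⟨Sum.inl 0⟩

/-- The inverse diagram: `D` turned upside down. -/
noncomputable def inv (D : BraidedDiagram P u v) : BraidedDiagram P v u where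
  T := D.T
  finite_T := D.finite_T
  top := D.bot
  bot := D.top
  rel := fun t => (D.rel t).symm
  wire := Function.invFunOn D.wire {c | D.IsOut c}
  bijOn := Set.BijOn.symm D.bijOn.invOn_invFunOn.symm D.bijOn
  label_wire := by
    intro c hc
    obtain ⟨d, hd, rfl⟩ := D.wire_surj hc
    have : Function.invFunOn D.wire {c | D.IsOut c} (D.wire d) = d :=
      D.bijOn.invOn_invFunOn.1 hd
    rw [this, D.label_wire d hd]
  acyclic := by
    intro t ht
    rw [← Relation.transGen_swap] at ht
    refine D.acyclic t (Relation.TransGen.mono ?_ _ _ ht)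
    rintro x y ⟨i, j, hi, h⟩
    have hin : D.IsIn (Sum.inr (x, i)) := by
      simpa [IsIn, contactLabel] using hi
    obtain ⟨d, hd, hd'⟩ := D.wire_surj hin
    have h2 : Function.invFunOn D.wire {c | D.IsOut c} (D.wire d) = d :=
      D.bijOn.invOn_invFunOn.1 hd
    rw [hd', h] at h2
    subst h2
    refine ⟨j, i, ?_, hd'⟩
    simpa [IsOut, contactLabel] using hd

theorem inv_wire (D : BraidedDiagram P u v) {d : Contact D.T} (hd : D.IsOut d) :
    D.inv.wire (D.wire d) = d := D.bijOn.invOn_invFunOn.1 hd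

/-! Concatenation respects equivalence modulo dipoles. -/

theorem map_emb {T₁ T₁' T₂ T₂' : Type} (f : T₁ → T₁') (g : T₂ → T₂') (c : Contact T₂) :
    (emb c : Contact (T₁ ⊕ T₂)).map (Sum.map f g) = emb (c.map g) := by
  rcases c with i | ⟨t, i⟩ <;> rfl

theorem map_embL {T₁ T₁' T₂ T₂' : Type} (f : T₁ → T₁') (g : T₂ → T₂') (c : Contact T₁) :
    (embL c : Contact (T₁ ⊕ T₂)).map (Sum.map f g) = embL (c.map f) := by
  rcases c with i | ⟨t, i⟩ <;> rfl

theorem map_id {T : Type} (c : Contact T) : c.map id = c := by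
  rcases c with i | ⟨t, i⟩ <;> rfl

/-- The wires of a concatenation are compatible with maps of the two factors. -/
theorem cont_map {T₁ T₁' T₂ T₂' : Type} {l : T₁ → List A} (f : T₁ → T₁') (g : T₂ → T₂')
    (w₂ : Contact T₂ → Contact T₂) (w₂' : Contact T₂' → Contact T₂') (c : Contact T₁)
    (hc : contactLabel v l c ≠ none)
    (h : ∀ j, v[j]? ≠ none → w₂' (Sum.inl j) = (w₂ (Sum.inl j)).map g) :
    cont w₂' (c.map f) = (cont w₂ c).map (Sum.map f g) := by
  rcases c with j | ⟨t, j⟩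
  · change emb (w₂' (Sum.inl j)) = (emb (w₂ (Sum.inl j))).map _
    rw [h j hc, map_emb]
  · rfl

theorem concat_iso_left {D D' : BraidedDiagram P u v} (E : BraidedDiagram P v w) (h : D.Iso D') :
    (D.concat E).Iso (D'.concat E) := by
  obtain ⟨e, h1, h2, h3⟩ := h
  refine ⟨Equiv.sumCongr e (Equiv.refl _), ?_, ?_, ?_⟩
  · rintro (t | t); exacts [h1 t, rfl]
  · rintro (t | t); exacts [h2 t, rfl]
  · intro c hc
    change concatWire D.wire E.wire (c.map (Sum.map e id)) =
      (concatWire D'.wire E.wire c).map (Sum.map e id)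
    rcases contact_cases c with ⟨d, rfl⟩ | ⟨t, i, rfl⟩
    · have hd : D'.IsOut d := by
        exact fun h => hc ((contactLabel_embL _ _ _ _).trans h)
      rw [map_embL, concatWire_embL, concatWire_embL, h3 d hd]
      exact cont_map _ _ _ _ _ (D'.isIn_wire hd) fun j _ => (map_id _).symm
    · change emb (E.wire (Sum.inr (t, i))) = (emb (E.wire (Sum.inr (t, i)))).map _
      rw [map_emb, map_id]

theorem concat_iso_right (D : BraidedDiagram P u v) {E E' : BraidedDiagram P v w} (h : E.Iso E') :
    (D.concat E).Iso (D.concat E') := by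
  obtain ⟨e, h1, h2, h3⟩ := h
  refine ⟨Equiv.sumCongr (Equiv.refl _) e, ?_, ?_, ?_⟩
  · rintro (t | t); exacts [rfl, h1 t]
  · rintro (t | t); exacts [rfl, h2 t]
  · intro c hc
    change concatWire D.wire E.wire (c.map (Sum.map id e)) =
      (concatWire D.wire E'.wire c).map (Sum.map id e)
    rcases contact_cases c with ⟨d, rfl⟩ | ⟨t, i, rfl⟩
    · have hd : D.IsOut d := by
        exact fun h => hc ((contactLabel_embL _ _ _ _).trans h)
      rw [map_embL, concatWire_embL, concatWire_embL, map_id]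
      have := cont_map (l := D.top) id e E'.wire E.wire (D.wire d) (D.isIn_wire hd)
        fun j hj => h3 (Sum.inl j) hj
      rwa [map_id] at this
    · change emb (E.wire (Sum.inr (e t, i))) = (emb (E'.wire (Sum.inr (t, i)))).map _
      rw [map_emb, ← h3 (Sum.inr (t, i)) hc]
      rfl

theorem range_sumMap_left {T T' U : Type} {e : T' → T} {t₁ t₂ : T}
    (h : ∀ t, t ∈ Set.range e ↔ t ≠ t₁ ∧ t ≠ t₂) (t : T ⊕ U) :
    t ∈ Set.range (Sum.map e (id : U → U)) ↔ t ≠ Sum.inl t₁ ∧ t ≠ Sum.inl t₂ := by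
  rcases t with t | t
  · have := h t
    simp only [Set.mem_range] at this
    simp [this]
  · simp

theorem range_sumMap_right {T T' U : Type} {e : T' → T} {t₁ t₂ : T}
    (h : ∀ t, t ∈ Set.range e ↔ t ≠ t₁ ∧ t ≠ t₂) (t : U ⊕ T) :
    t ∈ Set.range (Sum.map (id : U → U) e) ↔ t ≠ Sum.inr t₁ ∧ t ≠ Sum.inr t₂ := by
  rcases t with t | t
  · simp
  · have := h t
    simp only [Set.mem_range] at this
    simp [this]

theorem concat_reduces_left {D D' : BraidedDiagram P u v} (E : BraidedDiagram P v w)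
    (h : D.Reduces D') : (D.concat E).Reduces (D'.concat E) := by
  obtain ⟨t₁, t₂, ⟨d1, d2, d3⟩, e, he, hr, h1, h2, h3⟩ := h
  refine ⟨Sum.inl t₁, Sum.inl t₂, ⟨d1, d2, ?_⟩, Sum.map e id, he.sumMap Function.injective_id,
    ?_, ?_, ?_, ?_⟩
  · intro i hi
    change cont E.wire (D.wire (Sum.inr (t₂, i))) = _
    rw [d3 i hi]; rfl
  · exact range_sumMap_left hr
  · rintro (t | t); exacts [h1 t, rfl]
  · rintro (t | t); exacts [h2 t, rfl]
  · intro c hc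
    change concatWire D.wire E.wire (c.map (Sum.map e id)) =
      (concatWire D'.wire E.wire c).map (Sum.map e id) ∨ ∃ j,
      concatWire D.wire E.wire (c.map (Sum.map e id)) = Sum.inr (Sum.inl t₂, j) ∧
      cont E.wire (D.wire (Sum.inr (t₁, j))) = (concatWire D'.wire E.wire c).map (Sum.map e id)
    rcases contact_cases c with ⟨d, rfl⟩ | ⟨t, i, rfl⟩
    · have hd : D'.IsOut d := by
        exact fun h => hc ((contactLabel_embL _ _ _ _).trans h)
      rw [map_embL, concatWire_embL, concatWire_embL]
      have key := cont_map (l := D'.top) e id E.wire E.wire (D'.wire d) (D'.isIn_wire hd)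
        fun j _ => (map_id _).symm
      rcases h3 d hd with h | ⟨j, h, h'⟩
      · left; rw [h, key]
      · right; exact ⟨j, by rw [h]; rfl, by rw [h', key]⟩
    · left
      change emb (E.wire (Sum.inr (t, i))) = (emb (E.wire (Sum.inr (t, i)))).map _
      rw [map_emb, map_id]

theorem concat_reduces_right (D : BraidedDiagram P u v) {E E' : BraidedDiagram P v w}
    (h : E.Reduces E') : (D.concat E).Reduces (D.concat E') := by
  obtain ⟨t₁, t₂, ⟨d1, d2, d3⟩, e, he, hr, h1, h2, h3⟩ := h
  refine ⟨Sum.inr t₁, Sum.inr t₂, ⟨d1, d2, ?_⟩, Sum.map id e, Function.injective_id.sumMap he,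
    ?_, ?_, ?_, ?_⟩
  · intro i hi
    change emb (E.wire (Sum.inr (t₂, i))) = _
    rw [d3 i hi]; rfl
  · exact range_sumMap_right hr
  · rintro (t | t); exacts [rfl, h1 t]
  · rintro (t | t); exacts [rfl, h2 t]
  · have key : ∀ c, E'.IsOut c → emb (E.wire (c.map e)) =
        (emb (E'.wire c)).map (Sum.map (id : D.T → D.T) e) ∨ ∃ j,
        (emb (E.wire (c.map e)) : Contact (D.T ⊕ E.T)) = Sum.inr (Sum.inr t₂, j) ∧
        emb (E.wire (Sum.inr (t₁, j))) = (emb (E'.wire c)).map (Sum.map (id : D.T → D.T) e) := by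
      intro c hc
      rw [map_emb]
      rcases h3 c hc with h | ⟨j, h, h'⟩
      · left; rw [h]
      · right; exact ⟨j, by rw [h]; rfl, by rw [h']⟩
    intro c hc
    change concatWire D.wire E.wire (c.map (Sum.map id e)) =
      (concatWire D.wire E'.wire c).map (Sum.map id e) ∨ ∃ j,
      concatWire D.wire E.wire (c.map (Sum.map id e)) = Sum.inr (Sum.inr t₂, j) ∧
      emb (E.wire (Sum.inr (t₁, j))) = (concatWire D.wire E'.wire c).map (Sum.map id e)
    rcases contact_cases c with ⟨d, rfl⟩ | ⟨t, i, rfl⟩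
    · have hd : D.IsOut d := by
        exact fun h => hc ((contactLabel_embL _ _ _ _).trans h)
      rw [map_embL, concatWire_embL, concatWire_embL, map_id]
      have hin := D.isIn_wire hd
      rcases hw : D.wire d with j | ⟨s, j⟩
      · rw [hw] at hin
        exact key (Sum.inl j) hin
      · left; rfl
    · exact key (Sum.inr (t, i)) hc

theorem concat_step_left {D D' : BraidedDiagram P u v} (E : BraidedDiagram P v w)
    (h : D.Step D') : (D.concat E).Step (D'.concat E) :=
  h.imp (concat_iso_left E) (concat_reduces_left E)

theorem concat_step_right (D : BraidedDiagram P u v) {E E' : BraidedDiagram P v w}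
    (h : E.Step E') : (D.concat E).Step (D.concat E') :=
  h.imp (concat_iso_right D) (concat_reduces_right D)

theorem concat_assoc (D : BraidedDiagram P u v) (E : BraidedDiagram P v w)
    (F : BraidedDiagram P w z) : ((D.concat E).concat F).Iso (D.concat (E.concat F)) := by
  refine ⟨(Equiv.sumAssoc _ _ _).symm, ?_, ?_, ?_⟩
  · rintro (t | t | t) <;> rfl
  · rintro (t | t | t) <;> rfl
  · intro c _
    have h3 : ∀ c : Contact F.T, (emb c : Contact ((D.T ⊕ E.T) ⊕ F.T)) =
        (emb (emb c)).map (Equiv.sumAssoc D.T E.T F.T).symm := by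
      rintro (i | ⟨t, i⟩) <;> rfl
    have h2 : ∀ c : Contact E.T, (cont F.wire (emb c) : Contact ((D.T ⊕ E.T) ⊕ F.T)) =
        (emb (cont F.wire c)).map (Equiv.sumAssoc D.T E.T F.T).symm := by
      rintro (i | ⟨t, i⟩)
      · exact h3 _
      · rfl
    have h1 : ∀ c : Contact D.T, (cont F.wire (cont E.wire c) : Contact ((D.T ⊕ E.T) ⊕ F.T)) =
        (cont (concatWire E.wire F.wire) c).map (Equiv.sumAssoc D.T E.T F.T).symm := by
      rintro (i | ⟨t, i⟩)
      · exact h2 _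
      · rfl
    rcases c with i | ⟨t | t | t, i⟩
    · exact h1 _
    · exact h1 _
    · exact h2 _
    · exact h3 _

theorem concat_one (D : BraidedDiagram P u v) : (D.concat (one P v)).Iso D := by
  refine ⟨(Equiv.sumEmpty D.T Empty).symm, fun _ => rfl, fun _ => rfl, ?_⟩
  intro c _
  have h1 : ∀ c : Contact D.T, (cont id c : Contact (D.T ⊕ Empty)) = c.map Sum.inl := by
    rintro (i | ⟨t, i⟩) <;> rfl
  rcases c with i | ⟨t, i⟩ <;> exact h1 _

/-! The inverse law. For a set `S` of transistors of `D` that is closed upwards, the diagram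
`D.double S` consists of the part `S` of `D` on top of its own mirror image. Removing a lowest
transistor of `S` amounts to reducing a dipole. -/

/-- Inclusion of contacts of `S`. -/
def val {T : Type} {S : Set T} : Contact S → Contact T := Contact.map Subtype.val

/-- Mirror image of a contact. -/
def mir {T : Type} : Contact T → Contact (T ⊕ T) := Contact.map Sum.inr

open Classical in
/-- The wires of the double that start in the upper half. -/
noncomputable def doubleWireL {T : Type} (S : Set T) (wr : Contact T → Contact T)
    (c : Contact S) : Contact (S ⊕ S) :=
  match wr (val c) with
  | Sum.inl _ => mir c
  | Sum.inr (s, j) => if h : s ∈ S then Sum.inr (Sum.inl ⟨s, h⟩, j) else mir c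

open Classical in
/-- The wires of the double. -/
noncomputable def doubleWire {T : Type} (S : Set T) (wr : Contact T → Contact T)
    (out : Contact T → Prop) : Contact (S ⊕ S) → Contact (S ⊕ S)
  | Sum.inl i => doubleWireL S wr (Sum.inl i)
  | Sum.inr (Sum.inl s, i) => doubleWireL S wr (Sum.inr (s, i))
  | Sum.inr (Sum.inr s, i) =>
    if h : ∃ c : Contact S, out (val c) ∧ wr (val c) = Sum.inr (s.1, i) then mir h.choose
    else Sum.inl 0

theorem doubleWire_embL {T : Type} (S : Set T) (wr : Contact T → Contact T)
    (out : Contact T → Prop) (c : Contact S) :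
    doubleWire S wr out (embL c) = doubleWireL S wr c := by
  rcases c with i | ⟨t, i⟩ <;> rfl

theorem val_injective {T : Type} {S : Set T} : Function.Injective (val : Contact S → Contact T) := by
  rintro (i | ⟨t, i⟩) (j | ⟨s, j⟩) h <;> simp_all [val, Contact.map, Subtype.ext_iff]

theorem mir_eq_emb {T : Type} : (mir : Contact T → Contact (T ⊕ T)) = emb := rfl

/-- Upward closed sets of transistors. -/
def UpClosed (D : BraidedDiagram P u v) (S : Set D.T) : Prop :=
  ∀ s t, s ∈ S → D.Below s t → t ∈ S

section double

variable (D : BraidedDiagram P u v) {S : Set D.T}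

theorem doubleWireL_of_mem {c : Contact S} {s : S} {j : ℕ}
    (h : D.wire (val c) = Sum.inr (s.1, j)) :
    doubleWireL S D.wire c = Sum.inr (Sum.inl s, j) := by
  simp [doubleWireL, h]

theorem doubleWireL_of_not {c : Contact S}
    (h : ∀ (s : S) (j : ℕ), D.wire (val c) ≠ Sum.inr (s.1, j)) :
    doubleWireL S D.wire c = mir c := by
  unfold doubleWireL
  split
  · rfl
  · rename_i s j hs
    split
    · rename_i hS
      exact absurd hs (h ⟨s, hS⟩ j)
    · rfl

theorem doubleWire_mir {c : Contact S} (hc : D.IsOut (val c)) {s : S} {i : ℕ}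
    (h : D.wire (val c) = Sum.inr (s.1, i)) :
    doubleWire S D.wire D.IsOut (Sum.inr (Sum.inr s, i)) = mir c := by
  have hex : ∃ c : Contact S, D.IsOut (val c) ∧ D.wire (val c) = Sum.inr (s.1, i) := ⟨c, hc, h⟩
  have heq : hex.choose = c := val_injective (D.wire_inj hex.choose_spec.1 hc
    (hex.choose_spec.2.trans h.symm))
  exact (dif_pos hex).trans (congrArg mir heq)

theorem exists_source (hS : D.UpClosed S) {s : S} {i : ℕ} (h : D.IsIn (Sum.inr (s.1, i))) :
    ∃ c : Contact S, D.IsOut (val c) ∧ D.wire (val c) = Sum.inr (s.1, i) := by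
  obtain ⟨c, hc, hw⟩ := D.wire_surj h
  rcases c with k | ⟨t, k⟩
  · exact ⟨Sum.inl k, hc, hw⟩
  · have ht : t ∈ S := hS s.1 t s.2 ⟨k, i, by simpa [IsOut, contactLabel] using hc, hw⟩
    exact ⟨Sum.inr (⟨t, ht⟩, k), hc, hw⟩

theorem isOut_val (c : Contact S) :
    D.IsOut (val c) ↔ contactLabel u (fun s : S => D.bot s.1) c ≠ none := by
  rcases c with i | ⟨t, i⟩ <;> exact Iff.rfl

theorem label_val (c : Contact S) :
    contactLabel u (fun s : S => D.bot s.1) c = contactLabel u D.bot (val c) := by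
  rcases c with i | ⟨t, i⟩ <;> rfl

/-- Three kinds of wires of the double. -/
theorem doubleWire_cases (hS : D.UpClosed S) (c : Contact (S ⊕ S))
    (hc : contactLabel u (Sum.elim (fun s : S => D.bot s.1) fun s : S => D.top s.1) c ≠ none) :
    (∃ (a : Contact S) (s : S) (j : ℕ), D.IsOut (val a) ∧ c = embL a ∧
      D.wire (val a) = Sum.inr (s.1, j) ∧
      doubleWire S D.wire D.IsOut c = Sum.inr (Sum.inl s, j)) ∨
    (∃ a : Contact S, D.IsOut (val a) ∧ c = embL a ∧
      (∀ (s : S) (j : ℕ), D.wire (val a) ≠ Sum.inr (s.1, j)) ∧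
      doubleWire S D.wire D.IsOut c = mir a) ∨
    (∃ (a : Contact S) (s : S) (j : ℕ), D.IsOut (val a) ∧ c = Sum.inr (Sum.inr s, j) ∧
      D.wire (val a) = Sum.inr (s.1, j) ∧ doubleWire S D.wire D.IsOut c = mir a) := by
  rcases contact_cases c with ⟨a, rfl⟩ | ⟨s, j, rfl⟩
  · rw [contactLabel_embL, ← isOut_val] at hc
    by_cases h : ∃ (s : S) (j : ℕ), D.wire (val a) = Sum.inr (s.1, j)
    · obtain ⟨s, j, h⟩ := h
      exact Or.inl ⟨a, s, j, hc, rfl, h, by rw [doubleWire_embL, doubleWireL_of_mem D h]⟩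
    · push Not at h
      exact Or.inr (Or.inl ⟨a, hc, rfl, h, by rw [doubleWire_embL, doubleWireL_of_not D h]⟩)
  · obtain ⟨a, ha, h⟩ := exists_source D hS (s := s) (i := j) hc
    exact Or.inr (Or.inr ⟨a, s, j, ha, rfl, h, doubleWire_mir D ha h⟩)

theorem double_label (hS : D.UpClosed S) (c : Contact (S ⊕ S))
    (hc : contactLabel u (Sum.elim (fun s : S => D.bot s.1) fun s : S => D.top s.1) c ≠ none) :
    contactLabel u (Sum.elim (fun s : S => D.top s.1) fun s : S => D.bot s.1)
      (doubleWire S D.wire D.IsOut c) =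
    contactLabel u (Sum.elim (fun s : S => D.bot s.1) fun s : S => D.top s.1) c := by
  rcases doubleWire_cases D hS c hc with ⟨a, s, j, ha, rfl, h, h'⟩ | ⟨a, ha, rfl, h, h'⟩ |
    ⟨a, s, j, ha, rfl, h, h'⟩
  · rw [h', contactLabel_embL, label_val, ← D.label_wire _ ha, h]; rfl
  · rw [h', contactLabel_embL, mir_eq_emb, contactLabel_emb]
  · rw [h', mir_eq_emb, contactLabel_emb, label_val, ← D.label_wire _ ha, h]; rfl

/-- The part `S` of `D` on top of its own mirror image. -/
noncomputable def double (S : Set D.T) (hS : D.UpClosed S) : BraidedDiagram P u u where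
  T := S ⊕ S
  finite_T := by have := D.finite_T; infer_instance
  top := Sum.elim (fun s => D.top s.1) fun s => D.bot s.1
  bot := Sum.elim (fun s => D.bot s.1) fun s => D.top s.1
  rel := by rintro (t | t); exacts [D.rel t.1, (D.rel t.1).symm]
  wire := doubleWire S D.wire D.IsOut
  bijOn := by
    refine bijOn_of (double_label D hS) ?_ ?_
    · intro c d hc hd h
      have hm : ∀ (a : Contact S) (s : S) (j : ℕ), mir a ≠ Sum.inr (Sum.inl s, j) :=
        fun a s j => emb_ne a s j
      rcases doubleWire_cases D hS c hc with ⟨a, s, j, ha, rfl, h1, h2⟩ | ⟨a, ha, rfl, h1, h2⟩ |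
        ⟨a, s, j, ha, rfl, h1, h2⟩ <;>
      rcases doubleWire_cases D hS d hd with ⟨b, t, k, hb, rfl, h3, h4⟩ | ⟨b, hb, rfl, h3, h4⟩ |
        ⟨b, t, k, hb, rfl, h3, h4⟩ <;>
      rw [h2, h4] at h
      · have : s = t ∧ j = k := by simpa using h
        rw [this.1, this.2] at h1
        rw [val_injective (D.wire_inj ha hb (h1.trans h3.symm))]
      · exact absurd h.symm (hm _ _ _)
      · exact absurd h.symm (hm _ _ _)
      · exact absurd h (hm _ _ _)
      · rw [emb_injective h]
      · rw [emb_injective h] at h1; exact absurd h3 (h1 _ _)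
      · exact absurd h (hm _ _ _)
      · rw [emb_injective h] at h1; exact absurd h1 (h3 _ _)
      · rw [emb_injective h, h3] at h1
        have : t = s ∧ k = j := by simpa [Subtype.ext_iff] using h1
        rw [this.1, this.2]
    · intro d hd
      have key : ∀ a : Contact S, D.IsOut (val a) → ∃ c,
          contactLabel u (Sum.elim (fun s : S => D.bot s.1) fun s : S => D.top s.1) c ≠ none ∧
          doubleWire S D.wire D.IsOut c = mir a := by
        intro a ha
        by_cases h : ∃ (s : S) (j : ℕ), D.wire (val a) = Sum.inr (s.1, j)
        · obtain ⟨s, j, h⟩ := h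
          refine ⟨Sum.inr (Sum.inr s, j), ?_, doubleWire_mir D ha h⟩
          have := D.isIn_wire ha
          rwa [h] at this
        · push Not at h
          refine ⟨embL a, ?_, by rw [doubleWire_embL, doubleWireL_of_not D h]⟩
          rwa [contactLabel_embL, ← isOut_val]
      rcases d with i | ⟨s | s, i⟩
      · exact key (Sum.inl i) hd
      · obtain ⟨a, ha, h⟩ := exists_source D hS (s := s) (i := i) hd
        refine ⟨embL a, ?_, by rw [doubleWire_embL, doubleWireL_of_mem D h]⟩
        rwa [contactLabel_embL, ← isOut_val]
      · exact key (Sum.inr (s, i)) hd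
  label_wire := double_label D hS
  acyclic := by
    have base : ∀ x y : S ⊕ S, (∃ i j, i < (Sum.elim (fun s : S => D.bot s.1)
        (fun s : S => D.top s.1) y).length ∧
        doubleWire S D.wire D.IsOut (Sum.inr (y, i)) = Sum.inr (x, j)) →
        (∃ a b : S, x = Sum.inl a ∧ y = Sum.inl b ∧ D.Below a b) ∨
        (∃ a b : S, x = Sum.inr a ∧ y = Sum.inr b ∧ D.Below b a) ∨
        (∃ a b : S, x = Sum.inr a ∧ y = Sum.inl b) := by
      rintro x y ⟨i, j, hi, h⟩
      have hc : contactLabel u (Sum.elim (fun s : S => D.bot s.1) fun s : S => D.top s.1)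
          (Sum.inr (y, i)) ≠ none := by simpa [contactLabel] using hi
      rcases doubleWire_cases D hS _ hc with ⟨a, s, k, ha, h0, h1, h2⟩ | ⟨a, ha, h0, h1, h2⟩ |
        ⟨a, s, k, ha, h0, h1, h2⟩
      · rw [h] at h2
        obtain ⟨rfl, rfl⟩ : x = Sum.inl s ∧ j = k := by simpa using h2
        rcases a with m | ⟨t, m⟩
        · simp [embL, Contact.map] at h0
        · obtain ⟨rfl, rfl⟩ : y = Sum.inl t ∧ i = m := by simpa [embL, Contact.map] using h0
          exact Or.inl ⟨s, t, rfl, rfl, i, j, hi, h1⟩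
      · rw [h] at h2
        rcases a with m | ⟨t, m⟩
        · simp [embL, Contact.map] at h0
        · obtain ⟨rfl, rfl⟩ : y = Sum.inl t ∧ i = m := by simpa [embL, Contact.map] using h0
          obtain ⟨rfl, rfl⟩ : x = Sum.inr t ∧ j = i := by simpa [mir, Contact.map] using h2
          exact Or.inr (Or.inr ⟨t, t, rfl, rfl⟩)
      · rw [h] at h2
        obtain ⟨rfl, rfl⟩ : y = Sum.inr s ∧ i = k := by simpa using h0
        rcases a with m | ⟨t, m⟩
        · simp [mir, Contact.map] at h2
        · obtain ⟨rfl, rfl⟩ : x = Sum.inr t ∧ j = m := by simpa [mir, Contact.map] using h2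
          refine Or.inr (Or.inl ⟨t, s, rfl, rfl, j, i, ?_, h1⟩)
          simpa [IsOut, val, Contact.map, contactLabel] using ha
    have key : ∀ x y : S ⊕ S, Relation.TransGen (fun x y : S ⊕ S => ∃ i j,
        i < (Sum.elim (fun s : S => D.bot s.1) (fun s : S => D.top s.1) y).length ∧
        doubleWire S D.wire D.IsOut (Sum.inr (y, i)) = Sum.inr (x, j)) x y →
        (∃ a b : S, x = Sum.inl a ∧ y = Sum.inl b ∧ Relation.TransGen D.Below a b) ∨
        (∃ a b : S, x = Sum.inr a ∧ y = Sum.inr b ∧ Relation.TransGen D.Below b a) ∨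
        (∃ a b : S, x = Sum.inr a ∧ y = Sum.inl b) := by
      intro x y h
      induction h with
      | single h =>
        rcases base _ _ h with ⟨a, b, h1, h2, h3⟩ | ⟨a, b, h1, h2, h3⟩ | h
        · exact Or.inl ⟨a, b, h1, h2, .single h3⟩
        · exact Or.inr (Or.inl ⟨a, b, h1, h2, .single h3⟩)
        · exact Or.inr (Or.inr h)
      | tail _ h ih =>
        rcases base _ _ h with ⟨a, b, h1, h2, h3⟩ | ⟨a, b, h1, h2, h3⟩ | ⟨a, b, h1, h2⟩ <;>
          rcases ih with ⟨c, d, h4, h5, h6⟩ | ⟨c, d, h4, h5, h6⟩ | ⟨c, d, h4, h5⟩ <;>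
          subst h1 h4 <;> simp at h5 <;> subst h2 h5
        · exact Or.inl ⟨_, _, rfl, rfl, h6.tail h3⟩
        · exact Or.inr (Or.inr ⟨_, _, rfl, rfl⟩)
        · exact Or.inr (Or.inl ⟨_, _, rfl, rfl, .head h3 h6⟩)
        · exact Or.inr (Or.inr ⟨_, _, rfl, rfl⟩)
    intro t ht
    rcases key t t ht with ⟨a, b, h1, h2, h3⟩ | ⟨a, b, h1, h2, h3⟩ | ⟨a, b, h1, h2⟩
    · obtain rfl : a = b := by simpa [h1] using h2
      exact D.acyclic a h3
    · obtain rfl : a = b := by simpa [h1] using h2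
      exact D.acyclic a h3
    · simp [h1] at h2

theorem val_map_inclusion {T : Type} {S S' : Set T} (h : S' ⊆ S) (c : Contact S') :
    val (c.map (Set.inclusion h)) = val c := by
  rcases c with i | ⟨t, i⟩ <;> rfl

theorem range_inclusion {T : Type} {S : Set T} {t : T} (ht : t ∈ S) (hsub : S \ {t} ⊆ S)
    (x : S ⊕ S) : x ∈ Set.range (Sum.map (Set.inclusion hsub) (Set.inclusion hsub)) ↔
      x ≠ Sum.inr ⟨t, ht⟩ ∧ x ≠ Sum.inl ⟨t, ht⟩ := by
  rcases x with ⟨s, hs⟩ | ⟨s, hs⟩ <;> simp [Subtype.ext_iff, Set.inclusion, hs]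

theorem double_reduces {S : Set D.T} (hS : D.UpClosed S) {t : D.T} (ht : t ∈ S)
    (hS' : D.UpClosed (S \ {t})) : (D.double S hS).Reduces (D.double (S \ {t}) hS') := by
  have hmin : ∀ s ∈ S, ¬ D.Below s t := by
    intro s hs hst
    by_cases h : s = t
    · subst h; exact D.acyclic s (.single hst)
    · exact (hS' s t ⟨hs, h⟩ hst).2 rfl
  have hsub : S \ {t} ⊆ S := Set.sdiff_subset
  refine ⟨Sum.inr ⟨t, ht⟩, Sum.inl ⟨t, ht⟩, ⟨rfl, rfl, ?_⟩,
    Sum.map (Set.inclusion hsub) (Set.inclusion hsub),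
    (Set.inclusion_injective hsub).sumMap (Set.inclusion_injective hsub), ?_, ?_, ?_, ?_⟩
  · intro i hi
    change doubleWireL S D.wire (Sum.inr (⟨t, ht⟩, i)) = mir (Sum.inr (⟨t, ht⟩, i))
    exact doubleWireL_of_not D fun s j h => hmin s.1 s.2 ⟨i, j, hi, h⟩
  · exact range_inclusion ht hsub
  · rintro (s | s) <;> rfl
  · rintro (s | s) <;> rfl
  · intro c hc
    change doubleWire S D.wire D.IsOut (c.map (Sum.map (Set.inclusion hsub) (Set.inclusion hsub))) =
      (doubleWire (S \ {t}) D.wire D.IsOut c).map _ ∨ ∃ j,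
      doubleWire S D.wire D.IsOut (c.map (Sum.map (Set.inclusion hsub) (Set.inclusion hsub))) =
        Sum.inr (Sum.inl ⟨t, ht⟩, j) ∧ doubleWire S D.wire D.IsOut (Sum.inr (Sum.inr ⟨t, ht⟩, j)) =
      (doubleWire (S \ {t}) D.wire D.IsOut c).map _
    rcases doubleWire_cases D hS' c hc with ⟨a, s, k, ha, rfl, h1, h2⟩ | ⟨a, ha, rfl, h1, h2⟩ |
        ⟨a, s, k, ha, rfl, h1, h2⟩
    · left
      rw [h2, map_embL, doubleWire_embL]
      exact doubleWireL_of_mem D (s := Set.inclusion hsub s) (by rw [val_map_inclusion, h1]; rfl)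
    · rw [h2, map_embL, doubleWire_embL, mir_eq_emb, map_emb, ← mir_eq_emb]
      by_cases h : ∃ j, D.wire (val a) = Sum.inr (t, j)
      · obtain ⟨j, h⟩ := h
        right
        refine ⟨j, doubleWireL_of_mem D (s := ⟨t, ht⟩) (by rw [val_map_inclusion, h]), ?_⟩
        exact doubleWire_mir D (by rwa [val_map_inclusion]) (by rw [val_map_inclusion, h])
      · left
        refine doubleWireL_of_not D fun s j hs => ?_
        rw [val_map_inclusion] at hs
        by_cases hst : s.1 = t
        · exact h ⟨j, by rw [hs, hst]⟩
        · exact h1 ⟨s.1, s.2, hst⟩ j hs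
    · left
      rw [h2, mir_eq_emb, map_emb, ← mir_eq_emb]
      exact doubleWire_mir D (s := Set.inclusion hsub s) (by rwa [val_map_inclusion])
        (by rw [val_map_inclusion, h1]; rfl)

theorem double_empty (hS : D.UpClosed ∅) : (D.double ∅ hS).Iso (one P u) := by
  have : IsEmpty ((∅ : Set D.T) ⊕ (∅ : Set D.T) : Type) := by
    rw [isEmpty_sum]; exact ⟨inferInstance, inferInstance⟩
  refine ⟨⟨Empty.elim, fun x => this.elim x, fun x => x.elim, fun x => this.elim x⟩,
    fun x => x.elim, fun x => x.elim, ?_⟩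
  rintro (i | ⟨t, i⟩) _
  · exact doubleWireL_of_not D fun s => s.2.elim
  · exact t.elim

theorem concat_double (hS : D.UpClosed Set.univ) (wi : Contact D.T → Contact D.T)
    (hi : ∀ c, D.IsOut c → wi (D.wire c) = c)
    (c : Contact (↥(Set.univ : Set D.T) ⊕ ↥(Set.univ : Set D.T)))
    (hc : (D.double Set.univ hS).IsOut c) :
    concatWire D.wire wi (c.map (Sum.map Subtype.val Subtype.val)) =
      (doubleWire Set.univ D.wire D.IsOut c).map (Sum.map Subtype.val Subtype.val) := by
  rcases doubleWire_cases D hS c hc with ⟨a, s, k, ha, rfl, h1, h2⟩ | ⟨a, ha, rfl, h1, h2⟩ |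
      ⟨a, s, k, ha, rfl, h1, h2⟩
  · rw [h2, map_embL, concatWire_embL]
    change cont wi (D.wire (val a)) = _
    rw [h1]; rfl
  · rw [h2, map_embL, concatWire_embL, mir_eq_emb, map_emb]
    change cont wi (D.wire (val a)) = emb (val a)
    rcases hw : D.wire (val a) with i | ⟨s, i⟩
    · change emb (wi (Sum.inl i)) = _
      rw [← hw, hi _ ha]
    · exact absurd hw (h1 ⟨s, trivial⟩ i)
  · rw [h2, mir_eq_emb, map_emb]
    change emb (wi (Sum.inr (s.1, k))) = emb (val a)
    rw [← h1, hi _ ha]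

theorem concat_inv_iso_double (hS : D.UpClosed Set.univ) :
    (D.concat D.inv).Iso (D.double Set.univ hS) := by
  refine ⟨Equiv.sumCongr (Equiv.Set.univ D.T) (Equiv.Set.univ D.T), ?_, ?_, ?_⟩
  · rintro (s | s) <;> rfl
  · rintro (s | s) <;> rfl
  · exact fun c hc => concat_double D hS D.inv.wire (fun _ h => D.inv_wire h) c hc

theorem upClosed_univ : D.UpClosed Set.univ := fun _ _ _ _ => trivial

theorem sound {D D' : BraidedDiagram P u v} (h : D.Step D') :
    Quot.mk Step D = Quot.mk Step D' := Quot.sound h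

theorem double_equiv (n : ℕ) : ∀ (S : Set D.T) (hS : D.UpClosed S), S.ncard = n →
    Quot.mk Step (D.double S hS) = Quot.mk Step (one P u) := by
  have := D.finite_T
  induction n with
  | zero =>
    intro S hS h
    obtain rfl : S = ∅ := (Set.ncard_eq_zero (Set.toFinite S)).1 h
    exact Quot.sound (Or.inl (double_empty D hS))
  | succ n ih =>
    intro S hS h
    have hne : S.Nonempty := by
      rw [Set.nonempty_iff_ne_empty]; rintro rfl; simp at h
    have : IsTrans D.T (Relation.TransGen D.Below) := ⟨fun _ _ _ => Relation.TransGen.trans⟩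
    have : Std.Irrefl (Relation.TransGen D.Below) := ⟨D.acyclic⟩
    obtain ⟨t, ht, hmin⟩ := (Finite.wellFounded_of_trans_of_irrefl
      (Relation.TransGen D.Below)).has_min S hne
    have hS' : D.UpClosed (S \ {t}) := by
      intro s r hs hsr
      refine ⟨hS s r hs.1 hsr, ?_⟩
      rintro rfl
      exact hmin s hs.1 (.single hsr)
    refine (sound (Or.inr (double_reduces D hS ht hS'))).trans (ih _ hS' ?_)
    rw [Set.ncard_sdiff_singleton_of_mem ht, h]; rfl

theorem concat_inv : Quot.mk Step (D.concat D.inv) = Quot.mk Step (one P u) := 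
  (sound (Or.inl (concat_inv_iso_double D (upClosed_univ D)))).trans
    (double_equiv D _ _ _ rfl)

end double

end BraidedDiagram

open BraidedDiagram in
/-- The braided diagram group over `P` based at the word `w`: braided `(w, w)`-diagrams up to
the equivalence relation generated by equivalence and by reduction of dipoles. -/
def BraidedDiagramGroup {A : Type*} (P : SemigroupPresentation A) (w : List A) : Type _ :=
  Quot (Step : BraidedDiagram P w w → BraidedDiagram P w w → Prop)

namespace BraidedDiagramGroup

open BraidedDiagram

variable {A : Type*} {P : SemigroupPresentation A} {w : List A}

/-- The class of a diagram. -/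
def mk (D : BraidedDiagram P w w) : BraidedDiagramGroup P w := Quot.mk Step D

/-- The product is induced by concatenation. -/
instance : Mul (BraidedDiagramGroup P w) :=
  ⟨Quot.map₂ concat (fun D _ _ h => concat_step_right D h) (fun _ _ E h => concat_step_left E h)⟩

/-- The neutral element is the class of the diagram without transistors and crossings. -/
instance : One (BraidedDiagramGroup P w) := ⟨mk (one P w)⟩

theorem exists_inv (a : BraidedDiagramGroup P w) : ∃ b, a * b = 1 := by
  obtain ⟨D, rfl⟩ := Quot.exists_rep a
  exact ⟨mk D.inv, concat_inv D⟩

/-- The inverse of a class of diagrams; it is induced by turning diagrams upside down. -/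
noncomputable instance : Inv (BraidedDiagramGroup P w) := ⟨fun a => (exists_inv a).choose⟩

noncomputable instance : Group (BraidedDiagramGroup P w) :=
  Group.ofRightAxioms
    (by
      rintro ⟨D⟩ ⟨E⟩ ⟨F⟩
      exact Quot.sound (Or.inl (concat_assoc D E F)))
    (by
      rintro ⟨D⟩
      exact Quot.sound (Or.inl (concat_one D)))
    (fun a => (exists_inv a).choose_spec)

end BraidedDiagramGroup

/-- The balls of a metric space, ordered by inclusion. (In a compact ultrametric space, open balls
and closed balls of positive radius are the same sets.) `C ⋖ B` says that `C` is a maximal proper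
subball of `B`. -/
abbrev MetricBall (X : Type*) [MetricSpace X] : Type _ :=
  {B : Set X // ∃ (x : X) (r : ℝ), 0 < r ∧ B = Metric.ball x r}

/-- The whole of a nonempty compact space, as a ball. -/
def MetricBall.whole (X : Type*) [MetricSpace X] [CompactSpace X] [Nonempty X] : MetricBall X :=
  ⟨Set.univ, by
    obtain ⟨x⟩ := ‹Nonempty X›
    obtain ⟨r, hr, h⟩ := (isCompact_univ (X := X)).isBounded.subset_ball_lt 0 x
    exact ⟨x, r, hr, (Set.univ_subset_iff.1 h).symm⟩⟩

/-- A finite similarity structure. The type `B₁.1 ≃ᵈ B₂.1` consists of the surjective similarities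
from `B₁` to `B₂`. In the restriction axiom, the ball `B₄` is necessarily `h(B₃)`, and `g` is
necessarily the restriction of `h` to `B₃`. -/
structure FiniteSimilarityStructure (X : Type*) [MetricSpace X] where
  /-- The chosen similarities from one ball to another. -/
  sim : (B₁ B₂ : MetricBall X) → Set (B₁.1 ≃ᵈ B₂.1)
  finite : ∀ B₁ B₂, (sim B₁ B₂).Finite
  refl_mem : ∀ B, DilationEquiv.refl B.1 ∈ sim B B
  symm_mem : ∀ B₁ B₂, ∀ h ∈ sim B₁ B₂, h.symm ∈ sim B₂ B₁
  trans_mem : ∀ B₁ B₂ B₃, ∀ h₁ ∈ sim B₁ B₂, ∀ h₂ ∈ sim B₂ B₃, h₁.trans h₂ ∈ sim B₁ B₃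
  restrict_mem : ∀ B₁ B₂, ∀ h ∈ sim B₁ B₂, ∀ (B₃ : MetricBall X) (hB : B₃.1 ⊆ B₁.1),
    ∃ B₄, ∃ g ∈ sim B₃ B₄, ∀ x : B₃.1, (g x : X) = h ⟨x, hB x.2⟩

namespace FiniteSimilarityStructure

variable {X : Type*} [MetricSpace X] (S : FiniteSimilarityStructure X)

/-- There is at most one chosen similarity between any two balls. -/
def Small : Prop := ∀ B₁ B₂, (S.sim B₁ B₂).Subsingleton

/-- Each point has a ball neighbourhood `B` on which `h` agrees with a chosen similarity from `B`
to a ball `B'` (which is then `h(B)`). -/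
def LocallyDetermined (h : X ≃ₜ X) : Prop :=
  ∀ x, ∃ B B' : MetricBall X, x ∈ B.1 ∧ ∃ g ∈ S.sim B B', ∀ y : B.1, (g y : X) = h y

/-- The FSS group: all homeomorphisms that are locally determined by the similarity structure. -/
def Γ [IsUltrametricDist X] : Subgroup (X ≃ₜ X) where
  carrier := {h | S.LocallyDetermined h}
  one_mem' := fun x =>
    let B : MetricBall X := ⟨Metric.ball x 1, x, 1, one_pos, rfl⟩
    ⟨B, B, Metric.mem_ball_self one_pos, DilationEquiv.refl B.1, S.refl_mem B, fun _ => rfl⟩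
  mul_mem' := by
    intro a b ha hb x
    obtain ⟨B, B', hx, g, hg, hgb⟩ := hb x
    obtain ⟨C, C', hy, k, hk, hka⟩ := ha (b x)
    have hy' : b x ∈ B'.1 := by rw [← hgb ⟨x, hx⟩]; exact (g ⟨x, hx⟩).2
    have hnest : B'.1 ⊆ C.1 ∨ C.1 ⊆ B'.1 := by
      obtain ⟨y, r, _, hB⟩ := B'.2
      obtain ⟨z, s, _, hC⟩ := C.2
      rw [hB] at hy'
      rw [hC] at hy
      rw [hB, hC, IsUltrametricDist.ball_eq_of_mem hy', IsUltrametricDist.ball_eq_of_mem hy]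
      exact (le_total r s).imp Metric.ball_subset_ball Metric.ball_subset_ball
    rcases hnest with h | h
    · obtain ⟨D, f, hf, hfk⟩ := S.restrict_mem C C' k hk B' h
      refine ⟨B, D, hx, g.trans f, S.trans_mem _ _ _ g hg f hf, fun y => ?_⟩
      change (f (g y) : X) = a (b y)
      rw [hfk, hka, hgb]
    · obtain ⟨D, f, hf, hfk⟩ := S.restrict_mem B' B g.symm (S.symm_mem _ _ _ hg) C h
      have hbf : ∀ y : C.1, b (f y) = y := by
        intro y
        rw [hfk, ← hgb, DilationEquiv.apply_symm_apply]
      refine ⟨D, C', ?_, f.symm.trans k, S.trans_mem _ _ _ _ (S.symm_mem _ _ _ hf) k hk, ?_⟩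
      · have : (f ⟨b x, hy⟩ : X) = x := b.injective (hbf _)
        rw [← this]; exact (f ⟨b x, hy⟩).2
      · intro y
        change (k (f.symm y) : X) = a (b y)
        have h1 := hbf (f.symm y)
        rw [DilationEquiv.apply_symm_apply] at h1
        rw [hka, h1]
  inv_mem' := by
    intro a ha x
    obtain ⟨B, B', hx, g, hg, hga⟩ := ha (a⁻¹ x)
    have hax : a (a⁻¹ x) = x := a.apply_symm_apply x
    refine ⟨B', B, ?_, g.symm, S.symm_mem _ _ _ hg, fun y => ?_⟩
    · have := (g ⟨a⁻¹ x, hx⟩).2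
      rwa [hga, hax] at this
    · apply a.injective
      change a _ = a (a.symm y)
      rw [← hga, DilationEquiv.apply_symm_apply, a.apply_symm_apply]

/-- Two balls are equivalent if there is a chosen similarity between them. -/
def setoid : Setoid (MetricBall X) where
  r B₁ B₂ := (S.sim B₁ B₂).Nonempty
  iseqv :=
    ⟨fun B => ⟨_, S.refl_mem B⟩, fun ⟨h, hh⟩ => ⟨_, S.symm_mem _ _ h hh⟩,
      fun ⟨h, hh⟩ ⟨k, hk⟩ => ⟨_, S.trans_mem _ _ _ h hh k hk⟩⟩

/-- The set of classes `[B]` of balls. -/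
def BallClass : Type _ := Quotient S.setoid

/-- The class `[B]` of a ball. -/
def ballClass (B : MetricBall X) : S.BallClass := Quotient.mk S.setoid B

end FiniteSimilarityStructure

/-- A ball order: a strict linear order on the set of maximal proper subballs of each ball. (This
set is empty if the ball is a singleton.) -/
structure BallOrder (X : Type*) [MetricSpace X] where
  /-- The order of the maximal proper subballs of `B`. -/
  lt : (B : MetricBall X) → {C : MetricBall X // C ⋖ B} → {C : MetricBall X // C ⋖ B} → Prop
  isStrictTotalOrder : ∀ B, IsStrictTotalOrder _ (lt B)

/-- The ball order is compatible with the similarity structure: each chosen similarity induces, by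
taking images, an order preserving bijection of maximal proper subballs. -/
def BallOrder.Compatible {X : Type*} [MetricSpace X] (O : BallOrder X)
    (S : FiniteSimilarityStructure X) : Prop :=
  ∀ B₁ B₂, ∀ h ∈ S.sim B₁ B₂, ∃ e : O.lt B₁ ≃r O.lt B₂, ∀ C : {C : MetricBall X // C ⋖ B₁},
    ((e C).1.1 : Set X) = {y | ∃ x : B₁.1, (x : X) ∈ C.1.1 ∧ (h x : X) = y}

/-- The semigroup presentation of a similarity structure and a ball order. The letters are the
classes of balls, and the relations are `([B], [B₁] ⋯ [Bₙ])`, where `B₁, …, Bₙ` are the maximal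
proper subballs of the ball `B`, listed in order, and `n ≥ 1`. -/
def FiniteSimilarityStructure.presentation {X : Type*} [MetricSpace X]
    (S : FiniteSimilarityStructure X) (O : BallOrder X) : SemigroupPresentation S.BallClass where
  rels := {r | ∃ (B : MetricBall X) (l : List {C : MetricBall X // C ⋖ B}),
    l.Pairwise (O.lt B) ∧ (∀ C, C ∈ l) ∧ l ≠ [] ∧
      r = ([S.ballClass B], l.map fun C => S.ballClass C.1)}
  left_ne_nil := by
    rintro _ ⟨B, l, _, _, _, rfl⟩
    simp
  right_ne_nil := by
    rintro _ ⟨B, l, _, _, hl, rfl⟩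
    exact fun h => hl (List.map_eq_nil_iff.1 h)

/-! The tree of a tree-like presentation and its space of ends. -/

namespace SemigroupPresentation

variable {A : Type*} (P : SemigroupPresentation A) (x : A)

/-- `P.IsVertex x v a`: the list `v` is a vertex of the labelled ordered tree built from `P` and
`x`, and its label is `a`. A vertex is given by the directions of the path from the root to it. The
root has label `x`; if a vertex has label `a` and `([a], w)` is a relation, then it has one child
for each letter of `w`, in order, labelled by that letter. -/
inductive IsVertex : List ℕ → A → Prop
  | root : IsVertex [] x
  | child {v : List ℕ} {a b : A} {w : List A} {i : ℕ} :
      IsVertex v a → ([a], w) ∈ P.rels → w[i]? = some b → IsVertex (v ++ [i]) b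

/-- The vertex reached after at most `n` steps in the directions `p 0, p 1, …`, where `none` means
that no step is taken. -/
def pathVertex (p : ℕ → Option ℕ) (n : ℕ) : List ℕ := (List.range n).filterMap p

/-- The ends of the tree: the paths without backtracking that begin at the root and are either
infinite or terminate at a vertex without children. Here `p n` is the direction of the edge number
`n` of the path, or `none` if there is no such edge. -/
def Ends : Type :=
  {p : ℕ → Option ℕ // ∀ n, (p n = none → p (n + 1) = none) ∧
    ∃ a, P.IsVertex x (pathVertex p n) a ∧ (p n = none → ∀ w, ([a], w) ∉ P.rels)}

variable {P x}

/-- The number of edges that two different ends have in common. -/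
noncomputable def Ends.common (p q : P.Ends x) : ℕ :=
  PiNat.firstDiff (E := fun _ => Option ℕ) p.1 q.1

open Classical in
/-- The distance of two different ends is `e ^ (-m)`, where `m` is the number of common edges. -/
noncomputable instance : Dist (P.Ends x) :=
  ⟨fun p q => if p = q then 0 else Real.exp (-(Ends.common p q : ℝ))⟩

theorem Ends.dist_self (p : P.Ends x) : dist p p = 0 := if_pos rfl

theorem Ends.dist_of_ne {p q : P.Ends x} (h : p ≠ q) :
    dist p q = Real.exp (-(Ends.common p q : ℝ)) := if_neg h

theorem Ends.dist_nonneg (p q : P.Ends x) : 0 ≤ dist p q := by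
  by_cases h : p = q
  · rw [h, Ends.dist_self]
  · rw [Ends.dist_of_ne h]; positivity

theorem Ends.dist_max (p q r : P.Ends x) : dist p r ≤ max (dist p q) (dist q r) := by
  by_cases hpr : p = r
  · rw [hpr, Ends.dist_self]; exact le_max_of_le_left (Ends.dist_nonneg _ _)
  by_cases hpq : p = q
  · rw [hpq]; exact le_max_right _ _
  by_cases hqr : q = r
  · rw [hqr]; exact le_max_left _ _
  rw [Ends.dist_of_ne hpr, Ends.dist_of_ne hpq, Ends.dist_of_ne hqr]
  have h := PiNat.min_firstDiff_le (E := fun _ => Option ℕ) p.1 q.1 r.1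
    fun h => hpr (Subtype.ext h)
  rcases min_le_iff.1 h with h | h
  · refine le_max_of_le_left (Real.exp_le_exp.2 (neg_le_neg ?_))
    exact_mod_cast h
  · refine le_max_of_le_right (Real.exp_le_exp.2 (neg_le_neg ?_))
    exact_mod_cast h

noncomputable instance : MetricSpace (P.Ends x) where
  dist_self := Ends.dist_self
  dist_comm p q := by
    by_cases h : p = q
    · rw [h]
    · rw [Ends.dist_of_ne h, Ends.dist_of_ne (Ne.symm h), Ends.common, Ends.common,
        PiNat.firstDiff_comm]
  dist_triangle p q r := (Ends.dist_max p q r).trans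
    (max_le_add_of_nonneg (Ends.dist_nonneg _ _) (Ends.dist_nonneg _ _))
  eq_of_dist_eq_zero := by
    intro p q h
    by_contra hne
    rw [Ends.dist_of_ne hne] at h
    exact (Real.exp_pos _).ne' h

instance : IsUltrametricDist (P.Ends x) := ⟨Ends.dist_max⟩

end SemigroupPresentation

/-! A braided diagram over a tree-like presentation is a pushdown machine. Each transistor either
splits a wire into the children of its label or merges such children into one wire. Let a tree
address travel down from the top wire as a stack: a split pops a direction and follows that wire, a
merge pushes the position of entry (`Flow`). The label of the vertex addressed never changes, and an
address that is deep enough or ends at a leaf gets through (`exists_flow_bound`). So a diagram gives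
a partial map of tree vertices that preserves labels and respects descendants, and reducing dipoles
can only enlarge its domain (`Flow.of_reduces`).

This map is a complete invariant. If it is trivial, the diagram reduces to the identity diagram,
because the lowest splits and the merges that undo them yield dipoles (`exists_isDipole`).
Conversely, every label-preserving bijection between cofinite sets of vertices that respects
children and covers the leaves (`Matching`) is realized by a diagram: the unmatched vertices become
splits on one side and merges on the other (`exists_diagram`).

Geometry enters through `BallCoding`: vertices correspond to balls, children to maximal proper
subballs, and equal labels to the existence of a chosen similarity, unique by smallness. If the flow
takes `v` to `w`, the diagram moves the ball of `v` to the ball of `w` by that similarity; this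
defines an action by elements of `Γ`. Compactness turns an element of `Γ` into a matching, so the
action is an isomorphism (`nonempty_mulEquiv`). Both halves of the theorem then only require a
coding: by cones in the space of ends, and by descending from the whole space through ordered
subballs in a given `X`. -/

open SemigroupPresentation BraidedDiagram

/-! ### Vertices of the labelled tree -/

namespace SemigroupPresentation

variable {A : Type*} {P : SemigroupPresentation A} {x a b : A} {v s : List ℕ} {i : ℕ}

theorem isVertex_nil_iff : P.IsVertex x [] a ↔ a = x := by
  constructor
  · intro h
    generalize hv : ([] : List ℕ) = v at h
    cases h with
    | root => rfl
    | child => simp at hv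
  · rintro rfl; exact .root

theorem isVertex_concat_iff : P.IsVertex x (v ++ [i]) b ↔
    ∃ a w, P.IsVertex x v a ∧ ([a], w) ∈ P.rels ∧ w[i]? = some b := by
  constructor
  · intro h
    generalize hv : v ++ [i] = v' at h
    cases h with
    | root => simp at hv
    | child h1 h2 h3 =>
      obtain ⟨rfl, h⟩ := List.append_inj' hv rfl
      obtain rfl : i = _ := by simpa using h
      exact ⟨_, _, h1, h2, h3⟩
  · rintro ⟨a, w, h1, h2, h3⟩
    exact .child h1 h2 h3

/-- Self-similarity of the tree: what lies below a vertex depends only on its label, so the tail of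
an address can be moved to any vertex with the same label. -/
theorem isVertex_append_iff : P.IsVertex x (v ++ s) b ↔
    ∃ a, P.IsVertex x v a ∧ P.IsVertex a s b := by
  induction s using List.reverseRecOn generalizing b with
  | nil => simp [isVertex_nil_iff]
  | append_singleton s i ih =>
    rw [← List.append_assoc, isVertex_concat_iff]
    simp only [isVertex_concat_iff, ih]
    constructor
    · rintro ⟨a, w, ⟨c, h1, h2⟩, h3, h4⟩
      exact ⟨c, h1, a, w, h2, h3, h4⟩
    · rintro ⟨c, h1, a, w, h2, h3, h4⟩
      exact ⟨a, w, ⟨c, h1, h2⟩, h3, h4⟩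

theorem isVertex_cons_iff : P.IsVertex x (i :: s) b ↔
    ∃ w a, ([x], w) ∈ P.rels ∧ w[i]? = some a ∧ P.IsVertex a s b := by
  rw [show i :: s = ([] ++ [i]) ++ s from rfl, isVertex_append_iff]
  simp only [isVertex_concat_iff, isVertex_nil_iff]
  constructor
  · rintro ⟨a, ⟨_, w, rfl, h1, h2⟩, h3⟩
    exact ⟨w, a, h1, h2, h3⟩
  · rintro ⟨w, a, h1, h2, h3⟩
    exact ⟨a, ⟨_, w, rfl, h1, h2⟩, h3⟩

/-- A letter is the left side of at most one relation, so directions determine labels. -/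
theorem IsVertex.label_unique (hP : P.TreeLike) (ha : P.IsVertex x v a) (hb : P.IsVertex x v b) :
    a = b := by
  induction v using List.reverseRecOn generalizing a b with
  | nil => rw [isVertex_nil_iff] at ha hb; rw [ha, hb]
  | append_singleton s i ih =>
    obtain ⟨c, w, h1, h2, h3⟩ := isVertex_concat_iff.1 ha
    obtain ⟨d, w', h4, h5, h6⟩ := isVertex_concat_iff.1 hb
    obtain rfl := ih h1 h4
    obtain rfl := hP.2 _ _ _ h2 h5
    simpa [h3] using h6

/-- Every vertex has an extension of length at least `n` or without children. -/
theorem exists_extension (hP : P.TreeLike) (n : ℕ) (x : A) :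
    ∃ s b, P.IsVertex x s b ∧ (n ≤ s.length ∨ ∀ w, ([b], w) ∉ P.rels) := by
  induction n generalizing x with
  | zero => exact ⟨[], x, .root, Or.inl (Nat.zero_le _)⟩
  | succ n ih =>
    by_cases h : ∀ w, ([x], w) ∉ P.rels
    · exact ⟨[], x, .root, Or.inr h⟩
    · push Not at h
      obtain ⟨w, hw⟩ := h
      have h1 : 1 < w.length := (hP.1 _ hw).2
      obtain ⟨s, b, h2, h3⟩ := ih w[0]
      refine ⟨0 :: s, b, isVertex_cons_iff.2 ⟨w, w[0], hw, by simp, h2⟩, ?_⟩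
      exact h3.imp_left fun h => by simpa using h

end SemigroupPresentation

/-! ### Transistors, and the flow of addresses through a diagram -/

namespace BraidedDiagram

variable {A : Type*} {P : SemigroupPresentation A} {x : A}

section transistors

variable {u v : List A} (D : BraidedDiagram P u v)

/-- The transistor splits a single wire. -/
def IsSplit (t : D.T) : Prop := ∃ a, D.top t = [a] ∧ ([a], D.bot t) ∈ P.rels

/-- The transistor merges several wires into one. -/
def IsMerge (t : D.T) : Prop := ∃ a, D.bot t = [a] ∧ ([a], D.top t) ∈ P.rels

variable {D}

theorem isSplit_or_isMerge (hP : P.TreeLike) (t : D.T) : D.IsSplit t ∨ D.IsMerge t := by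
  rcases D.rel t with h | h
  · obtain ⟨a, ha⟩ := List.length_eq_one_iff.1 (hP.1 _ h).1
    exact Or.inl ⟨a, ha, ha ▸ h⟩
  · obtain ⟨a, ha⟩ := List.length_eq_one_iff.1 (hP.1 _ h).1
    exact Or.inr ⟨a, ha, ha ▸ h⟩

theorem IsSplit.not_isMerge (hP : P.TreeLike) {t : D.T} (h : D.IsSplit t) : ¬ D.IsMerge t := by
  rintro ⟨b, h1, h2⟩
  obtain ⟨a, h3, h4⟩ := h
  have := (hP.1 _ h4).2
  simp [h1] at this

theorem IsSplit.wire_eq {t : D.T} (h : D.IsSplit t) {c : Contact D.T} (hc : D.IsOut c) {j : ℕ}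
    (hw : D.wire c = Sum.inr (t, j)) : j = 0 := by
  obtain ⟨a, h1, h2⟩ := h
  have := D.isIn_wire hc
  rw [hw] at this
  simpa [IsIn, contactLabel, h1] using this

theorem IsMerge.isOut_zero {t : D.T} (h : D.IsMerge t) : D.IsOut (Sum.inr (t, 0)) := by
  obtain ⟨a, h1, h2⟩ := h
  simp [IsOut, contactLabel, h1]

theorem IsMerge.eq_zero {t : D.T} (h : D.IsMerge t) {j : ℕ} (hj : D.IsOut (Sum.inr (t, j))) :
    j = 0 := by
  obtain ⟨a, h1, h2⟩ := h
  simpa [IsOut, contactLabel, h1] using hj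

/-- A finite acyclic relation is well-founded both ways. This one gives induction from the bottom of
the diagram, `wellFounded_above` from the top. -/
theorem wellFounded_below (D : BraidedDiagram P u v) : WellFounded D.Below := by
  have := D.finite_T
  have : IsTrans D.T (Relation.TransGen D.Below) := ⟨fun _ _ _ => Relation.TransGen.trans⟩
  have : Std.Irrefl (Relation.TransGen D.Below) := ⟨D.acyclic⟩
  exact Subrelation.wf (fun h => Relation.TransGen.single h)
    (Finite.wellFounded_of_trans_of_irrefl (Relation.TransGen D.Below))

theorem wellFounded_above (D : BraidedDiagram P u v) :
    WellFounded (fun s t => D.Below t s) := by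
  have := D.finite_T
  have : IsTrans D.T (Function.swap (Relation.TransGen D.Below)) :=
    ⟨fun _ _ _ h h' => Relation.TransGen.trans h' h⟩
  have : Std.Irrefl (Function.swap (Relation.TransGen D.Below)) := ⟨D.acyclic⟩
  exact Subrelation.wf (fun h => Relation.TransGen.single h)
    (Finite.wellFounded_of_trans_of_irrefl (Function.swap (Relation.TransGen D.Below)))

theorem isOut_inr {t : D.T} {i : ℕ} : D.IsOut (Sum.inr (t, i)) ↔ i < (D.bot t).length := by
  simp [IsOut, contactLabel]

theorem below_of_wire {t t' : D.T} {i j : ℕ} (h : D.IsOut (Sum.inr (t, i)))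
    (hw : D.wire (Sum.inr (t, i)) = Sum.inr (t', j)) : D.Below t' t :=
  ⟨i, j, isOut_inr.1 h, hw⟩

end transistors

/-- `D.Flow c u r`: following the diagram downwards from the wire with top contact `c`, with a
stack `u` of directions, one arrives at the bottom of the frame with the stack `r`. On passing a
transistor that splits, the top of the stack tells which wire to take; on passing a transistor that
merges, the position of entry is put on the stack. -/
inductive Flow (D : BraidedDiagram P [x] [x]) : Contact D.T → List ℕ → List ℕ → Prop
  | exit {c : Contact D.T} {u : List ℕ} (hw : D.wire c = Sum.inl 0) : Flow D c u u
  | split {c : Contact D.T} {t : D.T} {i : ℕ} {u r : List ℕ} (ht : D.IsSplit t)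
      (hw : D.wire c = Sum.inr (t, 0)) (ho : D.IsOut (Sum.inr (t, i)))
      (hf : Flow D (Sum.inr (t, i)) u r) : Flow D c (i :: u) r
  | merge {c : Contact D.T} {t : D.T} {j : ℕ} {u r : List ℕ} (ht : D.IsMerge t)
      (hw : D.wire c = Sum.inr (t, j)) (hf : Flow D (Sum.inr (t, 0)) (j :: u) r) : Flow D c u r

namespace Flow

variable {D : BraidedDiagram P [x] [x]} {c : Contact D.T} {u r r' : List ℕ}

/-- Whatever lies at the bottom of the stack is carried along unread. This is why the flow respects
descendants. -/
theorem append (h : D.Flow c u r) (s : List ℕ) : D.Flow c (u ++ s) (r ++ s) := by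
  induction h with
  | exit hw => exact .exit hw
  | split ht hw ho _ ih => exact .split ht hw ho ih
  | merge ht hw _ ih => exact .merge ht hw ih

/-- The machine is deterministic: a wire has one end, and no transistor both splits and merges. -/
theorem unique (hP : P.TreeLike) (h : D.Flow c u r) (h' : D.Flow c u r') : r = r' := by
  induction h with
  | exit hw =>
    cases h' with
    | exit => rfl
    | split _ hw' => simp [hw] at hw'
    | merge _ hw' => simp [hw] at hw'
  | split ht hw ho hf ih =>
    cases h' with
    | exit hw' => simp [hw] at hw'
    | split ht' hw' ho' hf' =>
      rw [hw] at hw'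
      simp only [Sum.inr.injEq, Prod.mk.injEq, and_true] at hw'
      subst hw'
      exact ih hf'
    | merge ht' hw' =>
      rw [hw] at hw'
      simp only [Sum.inr.injEq, Prod.mk.injEq] at hw'
      obtain ⟨rfl, rfl⟩ := hw'
      exact absurd ht' (ht.not_isMerge hP)
  | merge ht hw hf ih =>
    cases h' with
    | exit hw' => simp [hw] at hw'
    | split ht' hw' ho' hf' =>
      rw [hw] at hw'
      simp only [Sum.inr.injEq, Prod.mk.injEq] at hw'
      obtain ⟨rfl, rfl⟩ := hw'
      exact absurd ht (ht'.not_isMerge hP)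
    | merge ht' hw' hf' =>
      rw [hw] at hw'
      simp only [Sum.inr.injEq, Prod.mk.injEq] at hw'
      obtain ⟨rfl, rfl⟩ := hw'
      exact ih hf'

end Flow

/-- The vertex `u` of the tree of the label of the wire with top contact `c` has label `a`. -/
def StackLabel (D : BraidedDiagram P [x] [x]) (c : Contact D.T) (u : List ℕ) (a : A) : Prop :=
  ∃ b, contactLabel [x] D.bot c = some b ∧ P.IsVertex b u a

section stack

variable {D : BraidedDiagram P [x] [x]} {c : Contact D.T} {u r : List ℕ} {a : A}

theorem StackLabel.isOut (h : D.StackLabel c u a) : D.IsOut c := by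
  obtain ⟨b, hb, _⟩ := h
  simp [IsOut, hb]

theorem stackLabel_inl : D.StackLabel (Sum.inl 0) u a ↔ P.IsVertex x u a := by
  simp [StackLabel, contactLabel]

theorem StackLabel.exit (h : D.StackLabel c u a) (hw : D.wire c = Sum.inl 0) :
    P.IsVertex x u a := by
  obtain ⟨b, hb, h'⟩ := h
  have := D.label_wire c (by simp [hb])
  rw [hw, hb] at this
  simp only [contactLabel, List.length_cons, List.length_nil, zero_add, Nat.lt_one_iff,
    getElem?_pos, List.getElem_cons_zero, Option.some.injEq] at this
  rwa [this]

theorem StackLabel.split (hP : P.TreeLike) {i : ℕ} {t : D.T} (h : D.StackLabel c (i :: u) a)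
    (ht : D.IsSplit t) (hw : D.wire c = Sum.inr (t, 0)) : D.StackLabel (Sum.inr (t, i)) u a := by
  obtain ⟨b, hb, h'⟩ := h
  obtain ⟨d, h1, h2⟩ := ht
  have := D.label_wire c (by simp [hb])
  rw [hw, hb] at this
  simp only [contactLabel, h1, List.length_cons, List.length_nil, zero_add, Nat.lt_one_iff,
    getElem?_pos, List.getElem_cons_zero, Option.some.injEq] at this
  subst this
  obtain ⟨w, e, h3, h4, h5⟩ := SemigroupPresentation.isVertex_cons_iff.1 h'
  obtain rfl := hP.2 _ _ _ h2 h3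
  exact ⟨e, h4, h5⟩

theorem StackLabel.merge {j : ℕ} {t : D.T} (h : D.StackLabel c u a)
    (ht : D.IsMerge t) (hw : D.wire c = Sum.inr (t, j)) :
    D.StackLabel (Sum.inr (t, 0)) (j :: u) a := by
  obtain ⟨b, hb, h'⟩ := h
  obtain ⟨d, h1, h2⟩ := ht
  have := D.label_wire c (by simp [hb])
  rw [hw, hb] at this
  exact ⟨d, by simp [contactLabel, h1],
    SemigroupPresentation.isVertex_cons_iff.2 ⟨_, b, h2, this, h'⟩⟩

/-- The label of the addressed vertex, in the tree of the label of the current wire, is invariant: a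
split moves to a child and shortens the address, a merge moves to a parent and lengthens it. -/
theorem Flow.isVertex (hP : P.TreeLike) (h : D.Flow c u r) (hl : D.StackLabel c u a) :
    P.IsVertex x r a := by
  induction h with
  | exit hw => exact hl.exit hw
  | split ht hw _ _ ih => exact ih (hl.split hP ht hw)
  | merge ht hw _ ih => exact ih (hl.merge ht hw)

/-- The wire with top contact `c` ends at a transistor or at the unique position on the bottom of
the frame. -/
theorem wire_cases (hc : D.IsOut c) : D.wire c = Sum.inl 0 ∨ ∃ t j, D.wire c = Sum.inr (t, j) := by
  have := D.isIn_wire hc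
  rcases h : D.wire c with j | ⟨t, j⟩
  · rw [h] at this
    left
    simpa [IsIn, contactLabel] using this
  · exact Or.inr ⟨t, j, rfl⟩

/-- For stacks that are long enough, or that cannot be extended, the flow reaches the bottom. -/
theorem exists_flow_bound (hP : P.TreeLike) (D : BraidedDiagram P [x] [x]) : ∃ N, ∀ u a,
    P.IsVertex x u a → (N ≤ u.length ∨ ∀ w, ([a], w) ∉ P.rels) →
      ∃ r, D.Flow (Sum.inl 0) u r := by
  -- The bound for a wire is one more than that of the transistor where it ends, because a split
  -- uses up one direction.
  have key : ∀ c : Contact D.T, D.IsOut c → (∀ t, (∃ j, D.wire c = Sum.inr (t, j)) →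
      ∃ N, ∀ i, D.IsOut (Sum.inr (t, i)) → ∀ u a, D.StackLabel (Sum.inr (t, i)) u a →
        (N ≤ u.length ∨ ∀ w, ([a], w) ∉ P.rels) → ∃ r, D.Flow (Sum.inr (t, i)) u r) →
      ∃ N, ∀ u a, D.StackLabel c u a →
        (N ≤ u.length ∨ ∀ w, ([a], w) ∉ P.rels) → ∃ r, D.Flow c u r := by
    intro c hc h
    rcases wire_cases hc with hw | ⟨t, j, hw⟩
    · exact ⟨0, fun u a _ _ => ⟨u, .exit hw⟩⟩
    · obtain ⟨N, hN⟩ := h t ⟨j, hw⟩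
      refine ⟨N + 1, fun u a hl hu => ?_⟩
      rcases isSplit_or_isMerge hP t with ht | ht
      · obtain rfl := ht.wire_eq hc hw
        rcases u with _ | ⟨i, u⟩
        -- An empty stack cannot meet a split here: it is shorter than `N + 1`, and its label begins
        -- the relation of `t`, so it is not the label of a leaf.
        · exfalso
          rcases hu with hu | hu
          · simp at hu
          · obtain ⟨b, h1, h2⟩ := hl
            obtain ⟨d, h3, h4⟩ := ht
            have := D.label_wire c hc
            rw [hw, h1] at this
            simp only [contactLabel, h3, List.length_cons, List.length_nil, zero_add,
              Nat.lt_one_iff, getElem?_pos, List.getElem_cons_zero, Option.some.injEq] at this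
            rw [SemigroupPresentation.isVertex_nil_iff] at h2
            subst this h2
            exact hu _ h4
        · have hl' := hl.split hP ht hw
          obtain ⟨r, hr⟩ := hN i hl'.isOut u a hl' (hu.imp_left fun h => by simpa using h)
          exact ⟨r, .split ht hw hl'.isOut hr⟩
      · have hl' := hl.merge ht hw
        obtain ⟨r, hr⟩ := hN 0 hl'.isOut (j :: u) a hl'
          (hu.imp_left fun h => by simp only [List.length_cons]; omega)
        exact ⟨r, .merge ht hw hr⟩
  have main : ∀ t : D.T, ∃ N, ∀ i, D.IsOut (Sum.inr (t, i)) → ∀ u a,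
      D.StackLabel (Sum.inr (t, i)) u a →
        (N ≤ u.length ∨ ∀ w, ([a], w) ∉ P.rels) → ∃ r, D.Flow (Sum.inr (t, i)) u r := by
    intro t
    induction t using D.wellFounded_below.induction with
    | _ t ih =>
      have : ∀ i, D.IsOut (Sum.inr (t, i)) → ∃ N, ∀ u a, D.StackLabel (Sum.inr (t, i)) u a →
          (N ≤ u.length ∨ ∀ w, ([a], w) ∉ P.rels) → ∃ r, D.Flow (Sum.inr (t, i)) u r :=
        fun i hi => key _ hi fun s ⟨j, hj⟩ => ih s (below_of_wire hi hj)
      choose! N hN using this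
      -- A transistor has finitely many wires at its bottom, so their largest bound serves for all.
      refine ⟨(Finset.range (D.bot t).length).sup N, fun i hi u a hl hu => hN i hi u a hl ?_⟩
      refine hu.imp_left (le_trans ?_)
      exact Finset.le_sup (f := N) (Finset.mem_range.2 (isOut_inr.1 hi))
  obtain ⟨N, hN⟩ := key (Sum.inl 0) (by simp [IsOut, contactLabel]) fun t _ => main t
  exact ⟨N, fun u a hu => hN u a (stackLabel_inl.2 hu)⟩

end stack

/-! Flow in concatenations and under equivalence of diagrams. -/

/-- Stacking composes flows: the run through `D` leaves `r` on the bottom wire, which is glued to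
the top wire of `E`. -/
theorem Flow.concat {D E : BraidedDiagram P [x] [x]} {c : Contact D.T} {u r s : List ℕ}
    (h : D.Flow c u r) (hE : E.Flow (Sum.inl 0) r s) :
    (D.concat E).Flow (embL c) u s := by
  -- The contact `c'` is left free because the first wire of a run through `E` now begins at a
  -- contact of the upper factor.
  have hemb : ∀ (d : Contact E.T) (u s), E.Flow d u s →
      ∀ c' : Contact (D.T ⊕ E.T), concatWire D.wire E.wire c' = emb (E.wire d) →
        (D.concat E).Flow c' u s := by
    intro d u s h
    induction h with
    | exit hw =>
      intro c' hc'
      exact .exit (by rw [hw] at hc'; exact hc')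
    | @split d t i u r ht hw ho hf ih =>
      intro c' hc'
      rw [hw] at hc'
      exact .split (D := D.concat E) (t := (Sum.inr t : D.T ⊕ E.T)) ht hc' ho (ih _ rfl)
    | @merge d t i u r ht hw hf ih =>
      intro c' hc'
      rw [hw] at hc'
      exact .merge (D := D.concat E) (t := (Sum.inr t : D.T ⊕ E.T)) ht hc' (ih _ rfl)
  induction h with
  | exit hw =>
    refine hemb _ _ _ hE _ ?_
    rw [concatWire_embL, hw]; rfl
  | @split c t i u r ht hw ho hf ih =>
    refine .split (D := D.concat E) (t := (Sum.inl t : D.T ⊕ E.T)) ht ?_ ho (ih hE)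
    change concatWire D.wire E.wire _ = _
    rw [concatWire_embL, hw]; rfl
  | @merge c t i u r ht hw hf ih =>
    refine .merge (D := D.concat E) (t := (Sum.inl t : D.T ⊕ E.T)) ht ?_ (ih hE)
    change concatWire D.wire E.wire _ = _
    rw [concatWire_embL, hw]; rfl

theorem contactLabel_map {T T' : Type} (f : List A) (l : T → List A) (l' : T' → List A)
    (e : T' → T) (h : ∀ t, l (e t) = l' t) (c : Contact T') :
    contactLabel f l (c.map e) = contactLabel f l' c := by
  rcases c with i | ⟨t, i⟩
  · rfl
  · simp [contactLabel, Contact.map, h]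

theorem Contact.map_injective {T T' : Type} {e : T' → T} (he : Function.Injective e) :
    Function.Injective (Contact.map e) :=
  Function.injective_id.sumMap (he.prodMap Function.injective_id)

theorem Flow.iff_of_iso {D D' : BraidedDiagram P [x] [x]} (h : D.Iso D') {c : Contact D'.T}
    (hc : D'.IsOut c) {u r : List ℕ} : D.Flow (c.map h.choose) u r ↔ D'.Flow c u r := by
  have := h.choose_spec
  generalize h.choose = e at this
  obtain ⟨h1, h2, h3⟩ := this
  have hs : ∀ t, D.IsSplit (e t) ↔ D'.IsSplit t := fun t => by simp only [IsSplit, h1, h2]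
  have hm : ∀ t, D.IsMerge (e t) ↔ D'.IsMerge t := fun t => by simp only [IsMerge, h1, h2]
  have ho : ∀ c, D.IsOut (c.map e) ↔ D'.IsOut c := fun c => by
    simp only [IsOut, contactLabel_map _ _ _ _ h2]
  constructor
  · intro h
    generalize hd : c.map e = d at h
    induction h generalizing c with
    | exit hw =>
      subst hd
      rw [h3 c hc] at hw
      refine .exit ?_
      exact Contact.map_injective e.injective hw
    | @split d t i u r ht hw ho' hf ih =>
      subst hd
      obtain ⟨t, rfl⟩ := e.surjective t
      rw [h3 c hc] at hw
      have hw' : D'.wire c = Sum.inr (t, 0) := Contact.map_injective e.injective hw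
      have ho'' := (ho (Sum.inr (t, i))).1 ho'
      exact .split ((hs t).1 ht) hw' ho'' (ih ho'' rfl)
    | @merge d t j u r ht hw hf ih =>
      subst hd
      obtain ⟨t, rfl⟩ := e.surjective t
      rw [h3 c hc] at hw
      have hw' : D'.wire c = Sum.inr (t, j) := Contact.map_injective e.injective hw
      have ht' := (hm t).1 ht
      exact .merge ht' hw' (ih ht'.isOut_zero rfl)
  · intro h
    induction h with
    | exit hw => exact .exit (by rw [h3 _ hc, hw]; rfl)
    | @split c t i u r ht hw ho' hf ih =>
      exact .split ((hs t).2 ht) (by rw [h3 c hc, hw]; rfl) ((ho (Sum.inr (t, i))).2 ho') (ih ho')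
    | @merge c t j u r ht hw hf ih =>
      exact .merge ((hm t).2 ht) (by rw [h3 c hc, hw]; rfl) (ih ht.isOut_zero)

/-- Reducing a dipole does not affect the flow, although the flow of the reduced diagram may be
defined for more stacks. -/
theorem Flow.of_reduces (hP : P.TreeLike) {D D' : BraidedDiagram P [x] [x]} (h : D.Reduces D')
    {u r : List ℕ} (hf : D.Flow (Sum.inl 0) u r) : D'.Flow (Sum.inl 0) u r := by
  obtain ⟨t₁, t₂, ⟨d1, d2, d3⟩, e, he, hr, h1, h2, h3⟩ := h
  have hs : ∀ t, D.IsSplit (e t) ↔ D'.IsSplit t := fun t => by simp only [IsSplit, h1, h2]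
  have hm : ∀ t, D.IsMerge (e t) ↔ D'.IsMerge t := fun t => by simp only [IsMerge, h1, h2]
  have ho : ∀ c, D.IsOut (c.map e) ↔ D'.IsOut c := fun c => by
    simp only [IsOut, contactLabel_map _ _ _ _ h2]
  -- Simulation invariant. Either both runs are at the same wire with the same stack, or `D'` waits
  -- at `c` while `D` passes the dipole: it has left `t₁` with the original stack, or it is between
  -- `t₂` and `t₁`, having popped `i` if `t₂` splits, or pushed `j` if `t₂` merges.
  have main : ∀ d u r, D.Flow d u r → ∀ c u', D'.IsOut c → ((c.map e = d ∧ u' = u) ∨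
      ∃ j, D.wire (c.map e) = Sum.inr (t₂, j) ∧
        D.wire (Sum.inr (t₁, j)) = (D'.wire c).map e ∧
        ((d = Sum.inr (t₁, j) ∧ u' = u) ∨
          (D.IsSplit t₂ ∧ ∃ i, d = Sum.inr (t₂, i) ∧ D.IsOut d ∧ u' = i :: u) ∨
          (D.IsMerge t₂ ∧ d = Sum.inr (t₂, 0) ∧ u = j :: u'))) → D'.Flow c u' r := by
    -- The bottom label of `t₁` is the top label of `t₂`, so one of the two splits and the other
    -- merges.
    have split₁ : D.IsMerge t₂ → ¬ D.IsMerge t₁ := by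
      rintro ⟨a, h4, h5⟩ ⟨b, h6, h7⟩
      have := (hP.1 _ h5).2
      rw [← d1, h6] at this
      simp at this
    have merge₁ : D.IsSplit t₂ → ¬ D.IsSplit t₁ := by
      rintro ⟨a, h4, h5⟩ ⟨b, h6, h7⟩
      have := (hP.1 _ h7).2
      rw [d1, h4] at this
      simp at this
    intro d u r hf
    induction hf with
    | @exit d u hw =>
      intro c u' hc h
      have : D.wire d = (D'.wire c).map e ∧ u' = u := by
        rcases h with ⟨rfl, hu⟩ | ⟨j, hj, hj', ⟨rfl, hu⟩ | ⟨_, i, rfl, hd, _⟩ | ⟨hm₂, rfl, _⟩⟩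
        · rcases h3 c hc with h | ⟨j, h, _⟩
          · exact ⟨h, hu⟩
          · simp [hw] at h
        · exact ⟨hj', hu⟩
        · simp [d3 _ (isOut_inr.1 hd)] at hw
        · simp [d3 _ (isOut_inr.1 hm₂.isOut_zero)] at hw
      obtain ⟨h', rfl⟩ := this
      exact .exit (Contact.map_injective he (h'.symm.trans hw))
    | @split d t i u r ht hw hd' hf ih =>
      intro c u' hc h
      have : (D.wire d = (D'.wire c).map e ∧ u' = i :: u) ∨ D'.Flow c u' r := by
        rcases h with ⟨rfl, hu⟩ | ⟨j, hj, hj', ⟨rfl, hu⟩ | ⟨hs₂, k, rfl, hd, _⟩ | ⟨hm₂, rfl, hu⟩⟩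
        · rcases h3 c hc with h | ⟨j, h, h'⟩
          · exact Or.inl ⟨h, hu⟩
          · rw [hw] at h
            simp only [Sum.inr.injEq, Prod.mk.injEq] at h
            obtain ⟨rfl, rfl⟩ := h
            exact Or.inr (ih _ _ hc (Or.inr ⟨0, hw, h', Or.inr (Or.inl ⟨ht, i, rfl, hd', hu⟩)⟩))
        · exact Or.inl ⟨hj', hu⟩
        · rw [d3 _ (isOut_inr.1 hd)] at hw
          simp only [Sum.inr.injEq, Prod.mk.injEq] at hw
          obtain ⟨rfl, rfl⟩ := hw
          exact absurd ht (merge₁ hs₂)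
        · rw [d3 _ (isOut_inr.1 hm₂.isOut_zero)] at hw
          simp only [Sum.inr.injEq, Prod.mk.injEq] at hw
          obtain ⟨rfl, -⟩ := hw
          -- A merge followed by a split: the direction popped is the one just pushed, so the run
          -- leaves at the position where it entered.
          obtain ⟨rfl, rfl⟩ := List.cons_eq_cons.1 hu
          exact Or.inr (ih _ _ hc (Or.inr ⟨i, hj, hj', Or.inl ⟨rfl, rfl⟩⟩))
      clear h
      rcases this with ⟨h, rfl⟩ | h
      · rw [hw] at h
        rcases hD : D'.wire c with k | ⟨t', k⟩
        · simp [hD, Contact.map] at h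
        · rw [hD] at h
          simp only [Contact.map, Sum.map_inr, Prod.map_apply, id_eq, Sum.inr.injEq,
            Prod.mk.injEq] at h
          obtain ⟨rfl, rfl⟩ := h
          have ho' := (ho (Sum.inr (t', i))).1 hd'
          exact .split ((hs t').1 ht) hD ho' (ih _ _ ho' (Or.inl ⟨rfl, rfl⟩))
      · exact h
    | @merge d t i u r ht hw hf ih =>
      intro c u' hc h
      have : (D.wire d = (D'.wire c).map e ∧ u' = u) ∨ D'.Flow c u' r := by
        rcases h with ⟨rfl, hu⟩ | ⟨j, hj, hj', ⟨rfl, hu⟩ | ⟨hs₂, k, rfl, hd, hu⟩ | ⟨hm₂, rfl, hu⟩⟩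
        · rcases h3 c hc with h | ⟨j, h, h'⟩
          · exact Or.inl ⟨h, hu⟩
          · rw [hw] at h
            simp only [Sum.inr.injEq, Prod.mk.injEq] at h
            obtain ⟨rfl, rfl⟩ := h
            exact Or.inr (ih _ _ hc (Or.inr ⟨i, hw, h', Or.inr (Or.inr ⟨ht, rfl, by rw [hu]⟩)⟩))
        · exact Or.inl ⟨hj', hu⟩
        · rw [d3 _ (isOut_inr.1 hd)] at hw
          simp only [Sum.inr.injEq, Prod.mk.injEq] at hw
          obtain ⟨rfl, rfl⟩ := hw
          -- A split followed by a merge: the direction just popped is pushed back.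
          obtain rfl := hs₂.wire_eq ((ho c).2 hc) hj
          exact Or.inr (ih _ _ hc (Or.inr ⟨0, hj, hj', Or.inl ⟨rfl, hu⟩⟩))
        · rw [d3 _ (isOut_inr.1 hm₂.isOut_zero)] at hw
          simp only [Sum.inr.injEq, Prod.mk.injEq] at hw
          obtain ⟨rfl, -⟩ := hw
          exact absurd ht (split₁ hm₂)
      clear h
      rcases this with ⟨h, rfl⟩ | h
      · rw [hw] at h
        rcases hD : D'.wire c with k | ⟨t', k⟩
        · simp [hD, Contact.map] at h
        · rw [hD] at h
          simp only [Contact.map, Sum.map_inr, Prod.map_apply, id_eq, Sum.inr.injEq,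
            Prod.mk.injEq] at h
          obtain ⟨rfl, rfl⟩ := h
          have ht' := (hm t').1 ht
          exact .merge ht' hD (ih _ _ ht'.isOut_zero (Or.inl ⟨rfl, rfl⟩))
      · exact h
  exact main _ _ _ hf (Sum.inl 0) _ (by simp [IsOut, contactLabel]) (Or.inl ⟨rfl, rfl⟩)

theorem Flow.of_step (hP : P.TreeLike) {D D' : BraidedDiagram P [x] [x]} (h : D.Step D')
    {u r : List ℕ} (hf : D.Flow (Sum.inl 0) u r) : D'.Flow (Sum.inl 0) u r := by
  rcases h with h | h
  · exact (Flow.iff_of_iso h (c := Sum.inl 0) (by simp [IsOut, contactLabel])).1 hf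
  · exact hf.of_reduces hP h

end BraidedDiagram

/-! ### Reducing diagrams with trivial flow -/

namespace BraidedDiagram

variable {A : Type*} {P : SemigroupPresentation A}

theorem bot_ne_nil {u v : List A} (D : BraidedDiagram P u v) (t : D.T) : D.bot t ≠ [] := by
  rcases D.rel t with h | h
  · exact P.right_ne_nil _ h
  · exact P.left_ne_nil _ h

theorem IsDipole.below {u v : List A} {D : BraidedDiagram P u v} {t₁ t₂ : D.T}
    (h : D.IsDipole t₁ t₂) : D.Below t₁ t₂ :=
  have h0 := List.length_pos_iff.2 (D.bot_ne_nil t₂)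
  ⟨0, 0, h0, h.2.2 0 h0⟩

/-- Every dipole can be reduced. -/
theorem IsDipole.exists_reduces {u v : List A} {D : BraidedDiagram P u v} {t₁ t₂ : D.T}
    (h : D.IsDipole t₁ t₂) : ∃ D', D.Reduces D' ∧ Nat.card D'.T < Nat.card D.T := by
  have hbelow := h.below
  have d1 := h.1
  have d2 := h.2.1
  have d3 := h.2.2
  have hfin := D.finite_T
  have hne : t₁ ≠ t₂ := by
    rintro rfl
    exact D.acyclic _ (.single hbelow)
  have h21 : ¬ D.Below t₂ t₁ := fun h => D.acyclic t₁ (.tail (.single hbelow) h)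
  have h11 : ¬ D.Below t₁ t₁ := fun h => D.acyclic t₁ (.single h)
  let S : Set D.T := {t | t ≠ t₁ ∧ t ≠ t₂}
  have hcases : ∀ c : Contact D.T, (∃ c' : Contact S, c = val c') ∨ (∃ j, c = Sum.inr (t₁, j)) ∨
      ∃ j, c = Sum.inr (t₂, j) := by
    rintro (i | ⟨t, i⟩)
    · exact Or.inl ⟨Sum.inl i, rfl⟩
    · by_cases e1 : t = t₁
      · exact Or.inr (Or.inl ⟨i, by rw [e1]⟩)
      by_cases e2 : t = t₂
      · exact Or.inr (Or.inr ⟨i, by rw [e2]⟩)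
      exact Or.inl ⟨Sum.inr (⟨t, e1, e2⟩, i), rfl⟩
  have hval₁ : ∀ (c : Contact S) j, val c ≠ Sum.inr (t₁, j) := by
    rintro (i | ⟨t, i⟩) j hc
    · simp [val, Contact.map] at hc
    · simp only [val, Contact.map, Sum.map_inr, Prod.map_apply, id_eq, Sum.inr.injEq,
        Prod.mk.injEq] at hc
      exact t.2.1 hc.1
  have hval₂ : ∀ (c : Contact S) j, val c ≠ Sum.inr (t₂, j) := by
    rintro (i | ⟨t, i⟩) j hc
    · simp [val, Contact.map] at hc
    · simp only [val, Contact.map, Sum.map_inr, Prod.map_apply, id_eq, Sum.inr.injEq,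
        Prod.mk.injEq] at hc
      exact t.2.2 hc.1
  -- All positions on the top of `t₁` are taken by wires from `t₂`.
  have hin : ∀ c, D.IsOut c → ∀ j, D.wire c = Sum.inr (t₁, j) → c = Sum.inr (t₂, j) := by
    intro c hc j hw
    have := D.isIn_wire hc
    rw [hw] at this
    have hj : j < (D.bot t₂).length := by
      rw [← d2]
      simpa [IsIn, contactLabel] using this
    exact D.wire_inj hc (isOut_inr.2 hj) (hw.trans (d3 j hj).symm)
  have hlab : ∀ c : Contact S, contactLabel u D.bot (val c) =
      contactLabel u (fun s : S => D.bot s) c := contactLabel_map _ _ _ _ fun _ => rfl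
  have hlab' : ∀ c : Contact S, contactLabel v D.top (val c) =
      contactLabel v (fun s : S => D.top s) c := contactLabel_map _ _ _ _ fun _ => rfl
  have hout₁ : ∀ c, D.IsOut c → ∀ j, D.wire c = Sum.inr (t₂, j) → D.IsOut (Sum.inr (t₁, j)) := by
    intro c hc j hw
    have := D.isIn_wire hc
    rw [hw] at this
    simpa [IsIn, IsOut, contactLabel, d1] using this
  -- The wires after the reduction: either an old wire, or the wire into position `j` of `t₂` glued
  -- to the wire out of position `j` of `t₁`.
  let R : Contact S → Contact S → Prop := fun c d => D.wire (val c) = val d ∨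
    ∃ j, D.wire (val c) = Sum.inr (t₂, j) ∧ D.wire (Sum.inr (t₁, j)) = val d
  have hex : ∀ c, contactLabel u (fun s : S => D.bot s) c ≠ none → ∃ d, R c d := by
    intro c hc
    rw [← hlab] at hc
    rcases hcases (D.wire (val c)) with ⟨d, hd⟩ | ⟨j, hj⟩ | ⟨j, hj⟩
    · exact ⟨d, Or.inl hd⟩
    · exact absurd (hin _ hc j hj) (hval₂ _ _)
    · have ho := hout₁ _ hc j hj
      -- By acyclicity, a wire leaving `t₁` does not return to the dipole.
      rcases hcases (D.wire (Sum.inr (t₁, j))) with ⟨d, hd⟩ | ⟨k, hk⟩ | ⟨k, hk⟩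
      · exact ⟨d, Or.inr ⟨j, hj, hd⟩⟩
      · exact absurd (below_of_wire ho hk) h11
      · exact absurd (below_of_wire ho hk) h21
  choose! wr hwr using hex
  have hl : ∀ c, contactLabel u (fun s : S => D.bot s) c ≠ none →
      contactLabel v (fun s : S => D.top s) (wr c) = contactLabel u (fun s : S => D.bot s) c := by
    intro c hc
    have hR := hwr c hc
    rw [← hlab] at hc ⊢
    rw [← hlab', ← D.label_wire _ hc]
    rcases hR with h | ⟨j, h, h'⟩
    · rw [h]
    · rw [h, ← h', D.label_wire _ (hout₁ _ hc j h)]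
      simp [contactLabel, d1]
  -- A glued wire from `t` to `s` stands for the chain `t`, `t₂`, `t₁`, `s`, so a cycle of the
  -- reduced diagram would be a cycle of `D`.
  have hTg : ∀ s t : S, (∃ i j, i < (D.bot t).length ∧ wr (Sum.inr (t, i)) = Sum.inr (s, j)) →
      Relation.TransGen D.Below s t := by
    rintro s t ⟨i, j, hi, hw⟩
    have ho : D.IsOut (Sum.inr (t.1, i)) := isOut_inr.2 hi
    have hR := hwr (Sum.inr (t, i)) (by rw [← hlab]; exact ho)
    rw [hw] at hR
    rcases hR with h | ⟨k, h, h'⟩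
    · exact .single (below_of_wire ho h)
    · exact ((Relation.TransGen.single (below_of_wire (hout₁ _ ho k h) h')).tail hbelow).tail
        (below_of_wire ho h)
  let D' : BraidedDiagram P u v :=
    { T := S
      finite_T := inferInstance
      top := fun s => D.top s
      bot := fun s => D.bot s
      rel := fun s => D.rel s
      wire := wr
      label_wire := hl
      bijOn := by
        refine bijOn_of hl ?_ ?_
        · intro c d hc hd hcd
          have h1 := hwr c hc
          have h2 := hwr d hd
          rw [← hcd] at h2
          rw [← hlab] at hc hd
          apply val_injective
          rcases h1 with h1 | ⟨j, h1, h1'⟩ <;> rcases h2 with h2 | ⟨k, h2, h2'⟩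
          · exact D.wire_inj hc hd (h1.trans h2.symm)
          · exact absurd (D.wire_inj hc (hout₁ _ hd k h2) (h1.trans h2'.symm)) (hval₁ _ _)
          · exact absurd (D.wire_inj hd (hout₁ _ hc j h1) (h2.trans h1'.symm)) (hval₁ _ _)
          · have := D.wire_inj (hout₁ _ hc j h1) (hout₁ _ hd k h2) (h1'.trans h2'.symm)
            obtain rfl : j = k := by simpa using this
            exact D.wire_inj hc hd (h1.trans h2.symm)
        · intro d hd
          have huniq : ∀ c, contactLabel u (fun s : S => D.bot s) c ≠ none → R c d → wr c = d := by
            intro c hc hR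
            apply val_injective
            rcases hR with h1 | ⟨j, h1, h1'⟩ <;> rcases hwr c hc with h2 | ⟨k, h2, h2'⟩
            · exact h2.symm.trans h1
            · exact absurd (h1.symm.trans h2) (hval₂ _ _)
            · exact absurd (h2.symm.trans h1) (hval₂ _ _)
            · obtain rfl : j = k := by simpa using h1.symm.trans h2
              exact h2'.symm.trans h1'
          suffices ∃ c, contactLabel u (fun s : S => D.bot s) c ≠ none ∧ R c d by
            obtain ⟨c, hc, hR⟩ := this
            exact ⟨c, hc, huniq c hc hR⟩
          rw [← hlab'] at hd
          obtain ⟨c, hc, hw⟩ := D.wire_surj hd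
          rcases hcases c with ⟨c, rfl⟩ | ⟨j, rfl⟩ | ⟨j, rfl⟩
          · exact ⟨c, by rwa [← hlab], Or.inl hw⟩
          · have : D.IsIn (Sum.inr (t₂, j)) := by
              simpa [IsIn, IsOut, contactLabel, d1] using hc
            obtain ⟨c, hc', hw'⟩ := D.wire_surj this
            rcases hcases c with ⟨c, rfl⟩ | ⟨k, rfl⟩ | ⟨k, rfl⟩
            · exact ⟨c, by rwa [← hlab], Or.inr ⟨j, hw', hw⟩⟩
            · exact absurd (below_of_wire hc' hw') h21
            · exact absurd (below_of_wire hc' hw') fun h => D.acyclic _ (.single h)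
          · exact absurd (hw.symm.trans (d3 j (isOut_inr.1 hc))) (hval₁ _ _)
      acyclic := by
        intro t ht
        refine D.acyclic t.1 ?_
        exact Relation.TransGen.lift' (fun s : S => s.1) hTg _ _ ht }
  refine ⟨D', ⟨t₁, t₂, h, Subtype.val, Subtype.val_injective, ?_, fun _ => rfl, fun _ => rfl, ?_⟩, ?_⟩
  · intro t
    rw [Subtype.range_coe]
    rfl
  · intro c hc
    exact hwr c hc
  · exact Finite.card_subtype_lt (x := t₁) fun h => h.1 rfl

/-- Suppose there is no dipole. A merge never feeds a split, since the two would carry the same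
letter, hence the same relation, and form a dipole. So above a split there are only splits, and
below a merge only merges. Let `t₂` be a lowest split, reached by the address `α`. The address `α ++
[i]` arrives at output `i` of `t₂` with empty stack, after which directions are only pushed, and by
triviality the result is `α ++ [i]`. The direction pushed first comes last, so output `i` enters
position `i` of a merge below which `α` is pushed. That address determines the merge; hence all
outputs of `t₂` enter one merge in order, and there is a dipole after all. -/
theorem exists_isDipole (hP : P.TreeLike) {x : A} (D : BraidedDiagram P [x] [x]) [hne : Nonempty D.T]
    (htriv : ∀ v a w, P.IsVertex x v a → D.Flow (Sum.inl 0) v w → v = w) :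
    ∃ t₁ t₂, D.IsDipole t₁ t₂ := by
  by_contra! hno
  have hlabel : ∀ {t : D.T} {a : A} {c : Contact D.T}, D.top t = [a] → D.IsOut c →
      D.wire c = Sum.inr (t, 0) → contactLabel [x] D.bot c = some a := by
    intro t a c h1 hc hw
    rw [← D.label_wire c hc, hw]
    simp [contactLabel, h1]
  have hMS : ∀ m s i j, D.IsMerge m → D.IsOut (Sum.inr (m, i)) →
      D.wire (Sum.inr (m, i)) = Sum.inr (s, j) → ¬ D.IsSplit s := by
    intro m s i j hm ho hw hs
    obtain rfl := hm.eq_zero ho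
    obtain rfl := hs.wire_eq ho hw
    obtain ⟨a, h1, h2⟩ := hm
    obtain ⟨b, h3, h4⟩ := hs
    have := hlabel h3 ho hw
    obtain rfl : a = b := by simpa [contactLabel, h1] using this
    refine hno s m ⟨hP.2 _ _ _ h4 h2, by rw [h1, h3], fun i hi => ?_⟩
    obtain rfl : i = 0 := by simpa [h1] using hi
    exact hw
  have hinl : ∀ k, D.IsOut (Sum.inl k) → k = 0 := by
    intro k hk
    simpa [IsOut, contactLabel] using hk
  -- A topmost transistor is a split: the several positions on top of a merge would all be filled by
  -- the only wire from the frame.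
  have hsplit : ∃ t, D.IsSplit t := by
    obtain ⟨m, -, hm⟩ := D.wellFounded_above.has_min Set.univ Set.univ_nonempty
    refine ⟨m, (isSplit_or_isMerge hP m).resolve_right ?_⟩
    rintro ⟨a, h1, h2⟩
    have hlen : 1 < (D.top m).length := (hP.1 _ h2).2
    have hsrc : ∀ j < (D.top m).length, D.wire (Sum.inl 0) = Sum.inr (m, j) := by
      intro j hj
      obtain ⟨c, hc, hw⟩ := D.wire_surj (d := Sum.inr (m, j)) (by simpa [IsIn, contactLabel] using hj)
      rcases c with k | ⟨t, k⟩
      · rw [← hinl k hc, hw]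
      · exact absurd (below_of_wire hc hw) (hm t trivial)
    have := (hsrc 0 (by omega)).symm.trans (hsrc 1 hlen)
    simp at this
  obtain ⟨t₂, ht₂, hmin⟩ := D.wellFounded_below.has_min {t | D.IsSplit t} hsplit
  -- Here `α` records the directions taken at the splits above `t`.
  have hup : ∀ t, D.IsSplit t → ∃ α a, P.IsVertex x α a ∧ D.top t = [a] ∧ ∀ i u r,
      D.IsOut (Sum.inr (t, i)) → D.Flow (Sum.inr (t, i)) u r →
        D.Flow (Sum.inl 0) (α ++ i :: u) r := by
    intro t
    induction t using D.wellFounded_above.induction with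
    | _ t ih =>
      intro ht
      have ht' := ht
      obtain ⟨a, h1, h2⟩ := ht
      obtain ⟨c, hc, hw⟩ := D.wire_surj (d := Sum.inr (t, 0)) (by simp [IsIn, contactLabel, h1])
      have hl := hlabel h1 hc hw
      rcases c with k | ⟨s, k⟩
      · obtain rfl := hinl k hc
        obtain rfl : x = a := by simpa [contactLabel] using hl
        exact ⟨[], x, .root, h1, fun i u r ho hf => .split ht' hw ho hf⟩
      · have hs := (isSplit_or_isMerge hP s).resolve_right fun hm => hMS s t k 0 hm hc hw ht'
        obtain ⟨α, b, h3, h4, h5⟩ := ih s (below_of_wire hc hw) hs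
        obtain ⟨b', h6, h7⟩ := hs
        obtain rfl : b = b' := by simpa [h4] using h6
        refine ⟨α ++ [k], a, .child h3 h7 hl, h1, fun i u r ho hf => ?_⟩
        rw [List.append_assoc]
        exact h5 k _ r hc (.split ht' hw ho hf)
  -- Wires after which only merges follow, by `hMS`. The flow along them needs no stack, and its
  -- result lists the positions of entry from the bottom up.
  let good : Contact D.T → Prop := fun c => D.IsOut c ∧
    ∀ t j, D.wire c = Sum.inr (t, j) → D.IsMerge t
  have hgm : ∀ m, D.IsMerge m → good (Sum.inr (m, 0)) := fun m hm =>
    ⟨hm.isOut_zero, fun t j hw =>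
      (isSplit_or_isMerge hP t).resolve_left (hMS m t 0 j hm hm.isOut_zero hw)⟩
  have hdown' : ∀ c, good c → (∀ t j, D.wire c = Sum.inr (t, j) →
      ∃ β, D.Flow (Sum.inr (t, 0)) [] β) → ∃ β, D.Flow c [] β := by
    intro c hc h
    rcases wire_cases hc.1 with hw | ⟨t, j, hw⟩
    · exact ⟨[], .exit hw⟩
    · obtain ⟨β, hβ⟩ := h t j hw
      exact ⟨β ++ [j], .merge (hc.2 t j hw) hw (hβ.append [j])⟩
  have hmerge : ∀ m, D.IsMerge m → ∃ β, D.Flow (Sum.inr (m, 0)) [] β := by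
    intro m
    induction m using D.wellFounded_below.induction with
    | _ m ih =>
      intro hm
      refine hdown' _ (hgm m hm) fun t j hw => ?_
      exact ih t (below_of_wire hm.isOut_zero hw) ((hgm m hm).2 t j hw)
  have hdown : ∀ c, good c → ∃ β, D.Flow c [] β := fun c hc =>
    hdown' c hc fun t j hw => hmerge t (hc.2 t j hw)
  have hinv : ∀ c β, good c → D.Flow c [] β → (β = [] ∧ D.wire c = Sum.inl 0) ∨
      ∃ m j β', D.IsMerge m ∧ D.wire c = Sum.inr (m, j) ∧ D.Flow (Sum.inr (m, 0)) [] β' ∧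
        β = β' ++ [j] := by
    intro c β hc hf
    -- Naming the empty stack lets `cases` unify the indices of `Flow`.
    obtain ⟨u, hu⟩ : ∃ u : List ℕ, [] = u := ⟨_, rfl⟩
    rw [hu] at hf
    cases hf with
    | exit hw => exact Or.inl ⟨hu.symm, hw⟩
    | split => simp at hu
    | @merge _ t j _ _ ht hw hf =>
      subst hu
      obtain ⟨β', hβ'⟩ := hmerge t ht
      exact Or.inr ⟨t, j, β', ht, hw, hβ', hf.unique hP (hβ'.append [j])⟩
  -- The address `β` describes the way back up from the bottom of the frame, so it determines the
  -- wire.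
  have hinj : ∀ β c c', good c → good c' → D.Flow c [] β → D.Flow c' [] β → c = c' := by
    intro β
    induction β using List.reverseRecOn with
    | nil =>
      intro c c' hc hc' hf hf'
      rcases hinv c _ hc hf with ⟨-, hw⟩ | ⟨_, _, _, _, _, _, h⟩
      · rcases hinv c' _ hc' hf' with ⟨-, hw'⟩ | ⟨_, _, _, _, _, _, h⟩
        · exact D.wire_inj hc.1 hc'.1 (hw.trans hw'.symm)
        · simp at h
      · simp at h
    | append_singleton β i ih =>
      intro c c' hc hc' hf hf'
      rcases hinv c _ hc hf with ⟨h, -⟩ | ⟨m, j, β', hm, hw, hβ, h⟩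
      · simp at h
      rcases hinv c' _ hc' hf' with ⟨h', -⟩ | ⟨m', j', β'', hm', hw', hβ', h'⟩
      · simp at h'
      obtain ⟨rfl, h2⟩ := List.append_inj' h rfl
      obtain ⟨rfl, h3⟩ := List.append_inj' h' rfl
      obtain rfl : i = j := by simpa using h2
      obtain rfl : i = j' := by simpa using h3
      have := ih _ _ (hgm m hm) (hgm m' hm') hβ hβ'
      obtain rfl : m = m' := by simpa using this
      exact D.wire_inj hc.1 hc'.1 (hw.trans hw'.symm)
  obtain ⟨α, a, hα, htop, hflow⟩ := hup t₂ ht₂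
  obtain ⟨a', h1, h2⟩ := ht₂
  obtain rfl : a = a' := by simpa [htop] using h1
  have hgt : ∀ i < (D.bot t₂).length, good (Sum.inr (t₂, i)) := fun i hi =>
    ⟨isOut_inr.2 hi, fun t j hw => (isSplit_or_isMerge hP t).resolve_left fun hs =>
      hmin t hs (below_of_wire (isOut_inr.2 hi) hw)⟩
  have htarget : ∀ i < (D.bot t₂).length, ∃ m, D.IsMerge m ∧
      D.wire (Sum.inr (t₂, i)) = Sum.inr (m, i) ∧ D.Flow (Sum.inr (m, 0)) [] α := by
    intro i hi
    obtain ⟨β, hβ⟩ := hdown _ (hgt i hi)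
    have hv : P.IsVertex x (α ++ [i]) (D.bot t₂)[i] := .child hα h2 (by simp [hi])
    have := htriv _ _ _ hv (hflow i [] β (isOut_inr.2 hi) hβ)
    subst this
    rcases hinv _ _ (hgt i hi) hβ with ⟨h, -⟩ | ⟨m, j, β', hm, hw, hβ', h⟩
    · simp at h
    · obtain ⟨rfl, h2⟩ := List.append_inj' h rfl
      obtain rfl : i = j := by simpa using h2
      exact ⟨m, hm, hw, hβ'⟩
  have h0 := List.length_pos_iff.2 (D.bot_ne_nil t₂)
  obtain ⟨t₁, hm, -, hf⟩ := htarget 0 h0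
  have hw : ∀ i < (D.bot t₂).length, D.wire (Sum.inr (t₂, i)) = Sum.inr (t₁, i) := by
    intro i hi
    obtain ⟨m, hm', hw, hf'⟩ := htarget i hi
    have := hinj α _ _ (hgm t₁ hm) (hgm m hm') hf hf'
    obtain rfl : t₁ = m := by simpa using this
    exact hw
  -- The vertex `α` carries both the bottom label of `t₁` and the top label of `t₂`, so the two
  -- relations agree.
  obtain ⟨b, h3, h4⟩ := hm
  have hb := hf.isVertex hP (a := b) ⟨b, by simp [contactLabel, h3], .root⟩
  obtain rfl := hb.label_unique hP hα
  have h5 := hP.2 _ _ _ h2 h4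
  exact hno t₁ t₂ ⟨by rw [h3, htop], by rw [h5], hw⟩

theorem iso_one_of_isEmpty {x : A} (D : BraidedDiagram P [x] [x]) [IsEmpty D.T] :
    D.Iso (one P [x]) := by
  refine ⟨Equiv.equivOfIsEmpty Empty D.T, fun t => t.elim, fun t => t.elim, ?_⟩
  rintro (k | ⟨t, k⟩) hc
  · obtain rfl : k = 0 := by simpa [IsOut, contactLabel] using hc
    rcases wire_cases (D := D) (c := Sum.inl 0) (by simp [IsOut, contactLabel]) with h | ⟨t, -⟩
    · exact h
    · exact isEmptyElim t
  · exact t.elim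

/-- A diagram whose flow is trivial is equivalent to the identity diagram. -/
theorem mk_eq_one_of_flow_trivial (hP : P.TreeLike) {x : A} (D : BraidedDiagram P [x] [x])
    (htriv : ∀ v a w, P.IsVertex x v a → D.Flow (Sum.inl 0) v w → v = w) :
    BraidedDiagramGroup.mk D = 1 := by
  generalize hn : Nat.card D.T = n
  induction n using Nat.strong_induction_on generalizing D with
  | _ n ih =>
    subst hn
    rcases isEmpty_or_nonempty D.T with hE | hne
    · exact Quot.sound (Or.inl (iso_one_of_isEmpty D))
    · obtain ⟨t₁, t₂, hd⟩ := exists_isDipole hP D htriv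
      obtain ⟨D', hr, hcard⟩ := hd.exists_reduces
      refine (Quot.sound (Or.inr hr) : BraidedDiagramGroup.mk D = BraidedDiagramGroup.mk D').trans
        (ih _ hcard D' ?_ rfl)
      intro v a w hv hf
      -- The flow of `D'` may be defined where that of `D` is not. A tail `s` makes `v` long enough
      -- for both, and is cancelled at the end.
      obtain ⟨N, hN⟩ := exists_flow_bound hP D
      obtain ⟨s, b, hs, hb⟩ := SemigroupPresentation.exists_extension hP N a
      have hvs := SemigroupPresentation.isVertex_append_iff.2 ⟨a, hv, hs⟩
      obtain ⟨r, hr'⟩ := hN (v ++ s) b hvs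
        (hb.imp_left fun h => by rw [List.length_append]; omega)
      have e1 := htriv _ _ _ hvs hr'
      have e2 := (hr'.of_reduces hP hr).unique hP (hf.append s)
      exact List.append_cancel_right (e1.trans e2)

end BraidedDiagram

/-! ### Diagrams from matchings of vertices -/

/-- A relation that matches almost all vertices of the tree bijectively, in such a way that
matched vertices have the same label and their corresponding children are matched. -/
structure SemigroupPresentation.Matching {A : Type*} (P : SemigroupPresentation A) (x : A)
    (R : List ℕ → List ℕ → Prop) : Prop where
  label : ∀ {v w}, R v w → ∃ a, P.IsVertex x v a ∧ P.IsVertex x w a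
  left_unique : ∀ {v v' w}, R v w → R v' w → v = v'
  right_unique : ∀ {v w w'}, R v w → R v w' → w = w'
  child : ∀ {v w i b}, R v w → P.IsVertex x (v ++ [i]) b → R (v ++ [i]) (w ++ [i])
  finite_left : {v | (∃ a, P.IsVertex x v a) ∧ ∀ w, ¬ R v w}.Finite
  finite_right : {w | (∃ a, P.IsVertex x w a) ∧ ∀ v, ¬ R v w}.Finite
  leaf_left : ∀ {v a}, P.IsVertex x v a → (∀ w, ([a], w) ∉ P.rels) → ∃ w, R v w
  leaf_right : ∀ {w a}, P.IsVertex x w a → (∀ w, ([a], w) ∉ P.rels) → ∃ v, R v w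

namespace SemigroupPresentation.Matching

variable {A : Type*} {P : SemigroupPresentation A} {x : A} {R : List ℕ → List ℕ → Prop}

theorem append (hR : P.Matching x R) {v w s : List ℕ} {b : A} (h : R v w)
    (hs : P.IsVertex x (v ++ s) b) : R (v ++ s) (w ++ s) := by
  induction s using List.reverseRecOn generalizing b with
  | nil => simpa using h
  | append_singleton s i ih =>
    rw [← List.append_assoc] at hs ⊢
    rw [← List.append_assoc]
    obtain ⟨a, _, h1, _⟩ := isVertex_concat_iff.1 hs
    exact hR.child (ih h1) hs

theorem swap (hP : P.TreeLike) (hR : P.Matching x R) : P.Matching x (fun v w => R w v) where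
  label h := by
    obtain ⟨a, h1, h2⟩ := hR.label h
    exact ⟨a, h2, h1⟩
  left_unique := hR.right_unique
  right_unique := hR.left_unique
  child := by
    intro v w i b h hb
    obtain ⟨a, h1, h2⟩ := hR.label h
    obtain ⟨a', w', h3, h4, h5⟩ := isVertex_concat_iff.1 hb
    obtain rfl := h2.label_unique hP h3
    exact hR.child h (.child h1 h4 h5)
  finite_left := hR.finite_right
  finite_right := hR.finite_left
  leaf_left := hR.leaf_right
  leaf_right := hR.leaf_left

/-- The unmatched vertices. -/
abbrev Bad (P : SemigroupPresentation A) (x : A) (R : List ℕ → List ℕ → Prop) : Set (List ℕ) :=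
  {v | (∃ a, P.IsVertex x v a) ∧ ∀ w, ¬ R v w}

/-- The vertices whose parent is unmatched, and the root. -/
def Near (P : SemigroupPresentation A) (x : A) (R : List ℕ → List ℕ → Prop) (v : List ℕ) : Prop :=
  (∃ a, P.IsVertex x v a) ∧ (v = [] ∨ ∃ u i, v = u ++ [i] ∧ u ∈ Bad P x R)

/-- Children of matched vertices are matched, so the unmatched vertices form a subtree containing
the root unless it is empty. The near vertices are this subtree together with its children and the
root; the matched ones among them are the maximal matched vertices. -/
theorem near_of_bad (hR : P.Matching x R) {v : List ℕ} (hv : v ∈ Bad P x R) : Near P x R v := by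
  refine ⟨hv.1, ?_⟩
  rcases List.eq_nil_or_concat' v with rfl | ⟨u, i, rfl⟩
  · exact Or.inl rfl
  · refine Or.inr ⟨u, i, rfl, ?_⟩
    obtain ⟨⟨a, ha⟩, h⟩ := hv
    obtain ⟨b, _, hb, _⟩ := isVertex_concat_iff.1 ha
    exact ⟨⟨b, hb⟩, fun w hw => h _ (hR.child hw ha)⟩

/-- Maximal matched vertices have maximal partners: if the parent of `w` were matched, its partner
would have `v` as a child, although the parent of `v` is unmatched. -/
theorem near_right (hP : P.TreeLike) (hR : P.Matching x R) {v w : List ℕ} (hv : Near P x R v)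
    (h : R v w) : Near P x (fun v w => R w v) w := by
  obtain ⟨a, h1, h2⟩ := hR.label h
  refine ⟨⟨a, h2⟩, ?_⟩
  rcases List.eq_nil_or_concat' w with rfl | ⟨u, i, rfl⟩
  · exact Or.inl rfl
  · refine Or.inr ⟨u, i, rfl, ?_⟩
    obtain ⟨b, _, hb, _⟩ := isVertex_concat_iff.1 h2
    refine ⟨⟨b, hb⟩, fun v' hv' => ?_⟩
    have h3 := (hR.swap hP).child hv' h2
    obtain rfl := hR.left_unique h h3
    rcases hv.2 with h4 | ⟨u', i', h4, h5⟩
    · simp at h4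
    · obtain ⟨rfl, -⟩ := List.append_inj' h4 rfl
      exact h5.2 _ hv'

/-- Leaves are matched, so an unmatched vertex has a relation, which will label its transistor. -/
theorem exists_rel_of_bad (hR : P.Matching x R) {v : List ℕ} (hv : v ∈ Bad P x R) :
    ∃ r : A × List A, P.IsVertex x v r.1 ∧ ([r.1], r.2) ∈ P.rels := by
  obtain ⟨⟨a, ha⟩, h⟩ := hv
  by_contra! hne
  obtain ⟨w, hw⟩ := hR.leaf_left ha fun w hw => hne (a, w) ha hw
  exact h w hw

/-- The relation between keys that describes the wires of the diagram of a matching. The keys on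
the left are the places where wires begin, the keys on the right are the places where they end. -/
def Link (R : List ℕ → List ℕ → Prop) : List ℕ ⊕ List ℕ → List ℕ ⊕ List ℕ → Prop
  | Sum.inl u, Sum.inl u' => u = u'
  | Sum.inl u, Sum.inr w => R u w
  | Sum.inr _, Sum.inl _ => False
  | Sum.inr w, Sum.inr w' => w = w'

/-- The place of a top contact. -/
def outKey {S S' : Set (List ℕ)} : Contact (S ⊕ S') → List ℕ ⊕ List ℕ
  | Sum.inl _ => Sum.inl []
  | Sum.inr (Sum.inl v, i) => Sum.inl (v.1 ++ [i])
  | Sum.inr (Sum.inr w, _) => Sum.inr w.1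

/-- The place of a bottom contact. -/
def inKey {S S' : Set (List ℕ)} : Contact (S ⊕ S') → List ℕ ⊕ List ℕ
  | Sum.inl _ => Sum.inr []
  | Sum.inr (Sum.inl v, _) => Sum.inl v.1
  | Sum.inr (Sum.inr w, j) => Sum.inr (w.1 ++ [j])

/-- A matching of vertices is realized by the flow of a diagram. -/
theorem exists_diagram (hP : P.TreeLike) (hR : P.Matching x R) :
    ∃ D : BraidedDiagram P [x] [x], ∀ v w, R v w → D.Flow (Sum.inl 0) v w := by
  -- Unmatched vertices on the left become splits, which open the tree down to the maximal matched
  -- vertices; those on the right become merges, which close it again. In between, `R` is the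
  -- braiding.
  let S := Bad P x R
  let S' := Bad P x (fun v w => R w v)
  have hR' := hR.swap hP
  have hS : Finite S := hR.finite_left
  have hS' : Finite S' := hR.finite_right
  choose f hf hfr using fun v : S => hR.exists_rel_of_bad v.2
  choose g hg hgr using fun v : S' => hR'.exists_rel_of_bad v.2
  let top : S ⊕ S' → List A := Sum.elim (fun v => [(f v).1]) (fun w => (g w).2)
  let bot : S ⊕ S' → List A := Sum.elim (fun v => (f v).2) (fun w => [(g w).1])
  let IsV : List ℕ ⊕ List ℕ → A → Prop := fun k a => P.IsVertex x (k.elim id id) a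
  have isV_unique : ∀ {k a b}, IsV k a → IsV k b → a = b := fun ha hb => ha.label_unique hP hb
  have link_label : ∀ {k l a}, Link R k l → IsV k a → IsV l a := by
    rintro (u | u) (w | w) a h ha
    · obtain rfl : u = w := h; exact ha
    · obtain ⟨b, h1, h2⟩ := hR.label h
      obtain rfl := h1.label_unique hP ha
      exact h2
    · exact h.elim
    · obtain rfl : u = w := h; exact ha
  have out_label : ∀ {c : Contact (S ⊕ S')} {a}, contactLabel [x] bot c = some a →
      IsV (outKey c) a := by
    rintro (i | ⟨v | w, i⟩) a h
    · obtain ⟨rfl, rfl⟩ : i = 0 ∧ x = a := by simpa [contactLabel, List.getElem?_singleton] using h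
      exact .root
    · exact .child (hf v) (hfr v) h
    · obtain ⟨rfl, rfl⟩ : i = 0 ∧ (g w).1 = a := by
        simpa [contactLabel, bot, List.getElem?_singleton] using h
      exact hg w
  have in_label : ∀ {c : Contact (S ⊕ S')} {a}, contactLabel [x] top c = some a →
      IsV (inKey c) a := by
    rintro (i | ⟨v | w, i⟩) a h
    · obtain ⟨rfl, rfl⟩ : i = 0 ∧ x = a := by simpa [contactLabel, List.getElem?_singleton] using h
      exact .root
    · obtain ⟨rfl, rfl⟩ : i = 0 ∧ (f v).1 = a := by
        simpa [contactLabel, top, List.getElem?_singleton] using h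
      exact hf v
    · exact .child (hg w) (hgr w) h
  have out_of_near : ∀ u, Near P x R u → ∃ c : Contact (S ⊕ S'),
      contactLabel [x] bot c ≠ none ∧ outKey c = Sum.inl u := by
    rintro u ⟨⟨a, ha⟩, rfl | ⟨v, i, rfl, hv⟩⟩
    · exact ⟨Sum.inl 0, by simp [contactLabel], rfl⟩
    · refine ⟨Sum.inr (Sum.inl ⟨v, hv⟩, i), ?_, rfl⟩
      obtain ⟨b, w, h1, h2, h3⟩ := isVertex_concat_iff.1 ha
      have h4 := hf ⟨v, hv⟩
      obtain rfl := h1.label_unique hP h4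
      have h5 := hP.2 _ _ _ h2 (hfr ⟨v, hv⟩)
      subst h5
      simp [contactLabel, bot, h3]
  have in_of_near : ∀ u, Near P x (fun v w => R w v) u → ∃ c : Contact (S ⊕ S'),
      contactLabel [x] top c ≠ none ∧ inKey c = Sum.inr u := by
    rintro u ⟨⟨a, ha⟩, rfl | ⟨v, i, rfl, hv⟩⟩
    · exact ⟨Sum.inl 0, by simp [contactLabel], rfl⟩
    · refine ⟨Sum.inr (Sum.inr ⟨v, hv⟩, i), ?_, rfl⟩
      obtain ⟨b, w, h1, h2, h3⟩ := isVertex_concat_iff.1 ha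
      have h4 := hg ⟨v, hv⟩
      obtain rfl := h1.label_unique hP h4
      have h5 := hP.2 _ _ _ h2 (hgr ⟨v, hv⟩)
      subst h5
      simp [contactLabel, top, h3]
  have out_near : ∀ {c : Contact (S ⊕ S')} {u}, contactLabel [x] bot c ≠ none →
      outKey c = Sum.inl u → Near P x R u := by
    intro c u hc hu
    obtain ⟨a, ha⟩ := Option.ne_none_iff_exists'.1 hc
    have hl := out_label ha
    rw [hu] at hl
    refine ⟨⟨a, hl⟩, ?_⟩
    rcases c with i | ⟨v | w, i⟩
    · exact Or.inl (Sum.inl_injective hu).symm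
    · exact Or.inr ⟨v, i, (Sum.inl_injective hu).symm, v.2⟩
    · simp [outKey] at hu
  have in_near : ∀ {c : Contact (S ⊕ S')} {u}, contactLabel [x] top c ≠ none →
      inKey c = Sum.inr u → Near P x (fun v w => R w v) u := by
    intro c u hc hu
    obtain ⟨a, ha⟩ := Option.ne_none_iff_exists'.1 hc
    have hl := in_label ha
    rw [hu] at hl
    refine ⟨⟨a, hl⟩, ?_⟩
    rcases c with i | ⟨v | w, i⟩
    · exact Or.inl (Sum.inr_injective hu).symm
    · simp [inKey] at hu
    · exact Or.inr ⟨w, i, (Sum.inr_injective hu).symm, w.2⟩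
  have hex : ∀ c : Contact (S ⊕ S'), contactLabel [x] bot c ≠ none →
      ∃ d : Contact (S ⊕ S'), contactLabel [x] top d ≠ none ∧ Link R (outKey c) (inKey d) := by
    intro c hc
    rcases hk : outKey c with u | w
    · have hu := out_near hc hk
      by_cases hbad : u ∈ S
      · exact ⟨Sum.inr (Sum.inl ⟨u, hbad⟩, 0), by simp [contactLabel, top], rfl⟩
      · obtain ⟨w, hw⟩ : ∃ w, R u w := by
          by_contra! h
          exact hbad ⟨hu.1, h⟩
        obtain ⟨d, hd, hdw⟩ := in_of_near w (hR.near_right hP hu hw)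
        exact ⟨d, hd, by rw [hdw]; exact hw⟩
    · rcases c with i | ⟨v | w', i⟩
      · simp [outKey] at hk
      · simp [outKey] at hk
      · obtain rfl : w'.1 = w := Sum.inr_injective hk
        obtain ⟨d, hd, hdw⟩ := in_of_near w' (hR'.near_of_bad w'.2)
        exact ⟨d, hd, by rw [hdw]; rfl⟩
  have hsurj : ∀ d : Contact (S ⊕ S'), contactLabel [x] top d ≠ none →
      ∃ c : Contact (S ⊕ S'), contactLabel [x] bot c ≠ none ∧ Link R (outKey c) (inKey d) := by
    intro d hd
    rcases hk : inKey d with u | w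
    · rcases d with i | ⟨v | w', i⟩
      · simp [inKey] at hk
      · obtain rfl : v.1 = u := Sum.inl_injective hk
        obtain ⟨d, hd, hdw⟩ := out_of_near v (hR.near_of_bad v.2)
        exact ⟨d, hd, by rw [hdw]; rfl⟩
      · simp [inKey] at hk
    · have hu := in_near hd hk
      by_cases hbad : w ∈ S'
      · exact ⟨Sum.inr (Sum.inr ⟨w, hbad⟩, 0), by simp [contactLabel, bot], rfl⟩
      · obtain ⟨u, hw⟩ : ∃ u, R u w := by
          by_contra! h
          exact hbad ⟨hu.1, h⟩
        obtain ⟨c, hc, hcu⟩ := out_of_near u (hR'.near_right hP hu hw)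
        exact ⟨c, hc, by rw [hcu]; exact hw⟩
  have out_inj : ∀ {c d : Contact (S ⊕ S')}, contactLabel [x] bot c ≠ none →
      contactLabel [x] bot d ≠ none → outKey c = outKey d → c = d := by
    rintro (i | ⟨v | w, i⟩) (j | ⟨v' | w', j⟩) hc hd h
    · obtain ⟨rfl, rfl⟩ : i = 0 ∧ j = 0 := by simpa [contactLabel] using And.intro hc hd
      rfl
    · simp [outKey] at h
    · simp [outKey] at h
    · simp [outKey] at h
    · obtain ⟨h1, h2⟩ := List.append_inj' (Sum.inl_injective h) rfl
      obtain rfl := Subtype.ext h1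
      obtain rfl : i = j := by simpa using h2
      rfl
    · simp [outKey] at h
    · simp [outKey] at h
    · simp [outKey] at h
    · obtain rfl := Subtype.ext (Sum.inr_injective h)
      obtain ⟨rfl, rfl⟩ : i = 0 ∧ j = 0 := by simpa [contactLabel, bot] using And.intro hc hd
      rfl
  have in_inj : ∀ {c d : Contact (S ⊕ S')}, contactLabel [x] top c ≠ none →
      contactLabel [x] top d ≠ none → inKey c = inKey d → c = d := by
    rintro (i | ⟨v | w, i⟩) (j | ⟨v' | w', j⟩) hc hd h
    · obtain ⟨rfl, rfl⟩ : i = 0 ∧ j = 0 := by simpa [contactLabel] using And.intro hc hd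
      rfl
    · simp [inKey] at h
    · simp [inKey] at h
    · simp [inKey] at h
    · obtain rfl := Subtype.ext (Sum.inl_injective h)
      obtain ⟨rfl, rfl⟩ : i = 0 ∧ j = 0 := by simpa [contactLabel, top] using And.intro hc hd
      rfl
    · simp [inKey] at h
    · simp [inKey] at h
    · simp [inKey] at h
    · obtain ⟨h1, h2⟩ := List.append_inj' (Sum.inr_injective h) rfl
      obtain rfl := Subtype.ext h1
      obtain rfl : i = j := by simpa using h2
      rfl
  -- `Link` is single-valued on these keys: a key `Sum.inl u` of a bottom contact belongs to an
  -- unmatched `u`, for which `R` offers no second target.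
  have link_right : ∀ {c d d' : Contact (S ⊕ S')}, Link R (outKey c) (inKey d) →
      Link R (outKey c) (inKey d') → inKey d = inKey d' := by
    intro c d d' h h'
    have hbad : ∀ {e : Contact (S ⊕ S')} {u}, inKey e = Sum.inl u → u ∈ S := by
      rintro (i | ⟨v | w, i⟩) u hu
      · simp [inKey] at hu
      · exact (Sum.inl_injective hu) ▸ v.2
      · simp [inKey] at hu
    rcases h1 : outKey c with u | u <;> rcases h2 : inKey d with w | w <;>
      rcases h3 : inKey d' with w' | w' <;> rw [h1, h2] at h <;> rw [h1, h3] at h'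
    · exact congrArg Sum.inl (Eq.trans (Eq.symm h) h')
    · obtain rfl : u = w := h
      exact absurd h' ((hbad h2).2 w')
    · obtain rfl : u = w' := h'
      exact absurd h ((hbad h3).2 w)
    · exact congrArg Sum.inr (hR.right_unique h h')
    · exact h.elim
    · exact h.elim
    · exact h'.elim
    · exact congrArg Sum.inr (Eq.trans (Eq.symm h) h')
  have link_left : ∀ {c c' d : Contact (S ⊕ S')}, Link R (outKey c) (inKey d) →
      Link R (outKey c') (inKey d) → outKey c = outKey c' := by
    intro c c' d h h'
    have hbad : ∀ {e : Contact (S ⊕ S')} {u}, outKey e = Sum.inr u → u ∈ S' := by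
      rintro (i | ⟨v | w, i⟩) u hu
      · simp [outKey] at hu
      · simp [outKey] at hu
      · exact (Sum.inr_injective hu) ▸ w.2
    rcases h1 : inKey d with u | u <;> rcases h2 : outKey c with w | w <;>
      rcases h3 : outKey c' with w' | w' <;> rw [h1, h2] at h <;> rw [h1, h3] at h'
    · exact congrArg Sum.inl (Eq.trans h (Eq.symm h'))
    · exact h'.elim
    · exact h.elim
    · exact h.elim
    · exact congrArg Sum.inl (hR.left_unique h h')
    · obtain rfl : w' = u := h'
      exact absurd h ((hbad h3).2 w)
    · obtain rfl : w = u := h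
      exact absurd h' ((hbad h2).2 w')
    · exact congrArg Sum.inr (Eq.trans h (Eq.symm h'))
  choose! wr hwr hlink using hex
  have hl : ∀ c, contactLabel [x] bot c ≠ none →
      contactLabel [x] top (wr c) = contactLabel [x] bot c := by
    intro c hc
    obtain ⟨a, ha⟩ := Option.ne_none_iff_exists'.1 hc
    obtain ⟨b, hb⟩ := Option.ne_none_iff_exists'.1 (hwr c hc)
    rw [ha, hb, isV_unique (link_label (hlink c hc) (out_label ha)) (in_label hb)]
  -- Wires descend in this order: merges are below splits, deeper splits are lower, and merges
  -- nearer to the root are lower.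
  let rank : S ⊕ S' → ℕ ×ₗ ℤ := Sum.elim (fun v => toLex (1, -(v.1.length : ℤ)))
    (fun w => toLex (0, (w.1.length : ℤ)))
  have hrank : ∀ t₁ t₂ : S ⊕ S', (∃ i j, i < (bot t₂).length ∧
      wr (Sum.inr (t₂, i)) = Sum.inr (t₁, j)) → rank t₁ < rank t₂ := by
    rintro t₁ t₂ ⟨i, j, hi, hw⟩
    have h := hlink (Sum.inr (t₂, i)) (by simpa [contactLabel] using hi)
    rw [hw] at h
    rcases t₁ with v₁ | w₁ <;> rcases t₂ with v₂ | w₂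
    · have h' : v₂.1 ++ [i] = v₁.1 := h
      have := congrArg List.length h'
      simp only [List.length_append, List.length_cons, List.length_nil] at this
      simp only [rank, Sum.elim_inl, Prod.Lex.toLex_lt_toLex]
      right
      exact ⟨trivial, by omega⟩
    · exact h.elim
    · simp [rank, Prod.Lex.toLex_lt_toLex]
    · have h' : w₂.1 = w₁.1 ++ [j] := h
      have := congrArg List.length h'
      simp only [List.length_append, List.length_cons, List.length_nil] at this
      simp only [rank, Sum.elim_inr, Prod.Lex.toLex_lt_toLex]
      right
      exact ⟨trivial, by omega⟩
  let D : BraidedDiagram P [x] [x] :=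
    { T := S ⊕ S'
      finite_T := inferInstance
      top := top
      bot := bot
      rel := by
        rintro (v | w)
        · exact Or.inl (hfr v)
        · exact Or.inr (hgr w)
      wire := wr
      label_wire := hl
      bijOn := by
        refine bijOn_of hl ?_ ?_
        · intro c d hc hd h
          have h1 := hlink d hd
          rw [← h] at h1
          exact out_inj hc hd (link_left (hlink c hc) h1)
        · intro d hd
          obtain ⟨c, hc, h⟩ := hsurj d hd
          exact ⟨c, hc, in_inj (hwr c hc) hd (link_right (hlink c hc) h)⟩
      acyclic := by
        intro t ht
        have : ∀ s t, Relation.TransGen (fun t₁ t₂ : S ⊕ S' => ∃ i j, i < (bot t₂).length ∧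
            wr (Sum.inr (t₂, i)) = Sum.inr (t₁, j)) s t → rank s < rank t := by
          intro s t h
          induction h with
          | single h => exact hrank _ _ h
          | tail _ h ih => exact ih.trans (hrank _ _ h)
        exact lt_irrefl _ (this t t ht) }
  have wire_eq : ∀ {c d : Contact (S ⊕ S')}, contactLabel [x] bot c ≠ none →
      contactLabel [x] top d ≠ none → Link R (outKey c) (inKey d) → D.wire c = d :=
    fun {c d} hc hd h => in_inj (hwr c hc) hd (link_right (hlink c hc) h)
  -- From the key `w` on the right the flow climbs to the root, pushing the directions of `w`, the
  -- last one first.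
  have flow_merge : ∀ w : List ℕ, Near P x (fun v w => R w v) w → ∀ (c : Contact (S ⊕ S')) (s : List ℕ),
      contactLabel [x] bot c ≠ none → Link R (outKey c) (Sum.inr w) → D.Flow c s (w ++ s) := by
    intro w
    induction w using List.reverseRecOn with
    | nil =>
      intro hw c s hc h
      exact .exit (wire_eq (d := Sum.inl 0) hc (by simp [contactLabel]) h)
    | append_singleton w j ih =>
      intro hw c s hc h
      have hbad : w ∈ S' := by
        rcases hw.2 with h | ⟨u, i, h, h'⟩
        · simp at h
        · obtain ⟨rfl, -⟩ := List.append_inj' h rfl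
          exact h'
      obtain ⟨d, hd, hdw⟩ := in_of_near _ hw
      have hd' : d = Sum.inr (Sum.inr ⟨w, hbad⟩, j) := by
        rcases d with i | ⟨v | w', i⟩
        · simp [inKey] at hdw
        · simp [inKey] at hdw
        · obtain ⟨h1, h2⟩ := List.append_inj' (Sum.inr_injective hdw) rfl
          obtain rfl : w' = ⟨w, hbad⟩ := Subtype.ext h1
          obtain rfl : i = j := by simpa using h2
          rfl
      have hw' := wire_eq hc hd (by rw [hdw]; exact h)
      rw [hd'] at hw'
      rw [List.append_assoc]
      exact .merge (t := (Sum.inr ⟨w, hbad⟩ : S ⊕ S')) ⟨_, rfl, hgr ⟨w, hbad⟩⟩ hw'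
        (ih (hR'.near_of_bad hbad) (Sum.inr (Sum.inr ⟨w, hbad⟩, 0)) _
          (by simp [contactLabel, bot]) rfl)
  -- Here `u` is the part of the address already popped and `s` the part still on the stack.
  have flow_split : ∀ (s u w : List ℕ) (c : Contact (S ⊕ S')), contactLabel [x] bot c ≠ none →
      outKey c = Sum.inl u → R (u ++ s) w → D.Flow c s w := by
    intro s
    induction s with
    | nil =>
      intro u w c hc hu h
      rw [List.append_nil] at h
      have := flow_merge w (hR.near_right hP (out_near hc hu) h) c [] hc (by rw [hu]; exact h)
      rwa [List.append_nil] at this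
    | cons i s ih =>
      intro u w c hc hu h
      have hnear := out_near hc hu
      obtain ⟨a, ha, _⟩ := hR.label h
      by_cases hbad : u ∈ S
      · have ha' := ha
        rw [show u ++ i :: s = (u ++ [i]) ++ s by simp] at ha' h
        obtain ⟨b, hb, _⟩ := isVertex_append_iff.1 ha'
        obtain ⟨c', hc', hcu⟩ := out_of_near (u ++ [i]) ⟨⟨b, hb⟩, Or.inr ⟨u, i, rfl, hbad⟩⟩
        obtain rfl : c' = Sum.inr (Sum.inl ⟨u, hbad⟩, i) := by
          rcases c' with k | ⟨v | w', k⟩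
          · simp [outKey] at hcu
          · obtain ⟨h1, h2⟩ := List.append_inj' (Sum.inl_injective hcu) rfl
            obtain rfl : v = ⟨u, hbad⟩ := Subtype.ext h1
            obtain rfl : k = i := by simpa using h2
            rfl
          · simp [outKey] at hcu
        exact .split (D := D) (t := (Sum.inl ⟨u, hbad⟩ : S ⊕ S')) ⟨_, rfl, hfr ⟨u, hbad⟩⟩
          (wire_eq hc (by simp [contactLabel, top]) (by rw [hu]; rfl)) hc' (ih _ _ _ hc' hcu h)
      -- At a matched `u` the splitting stops. The rest of the stack stays beneath the directions of
      -- the partner, which is where `R` sends the descendant of `u`.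
      · obtain ⟨w₀, hw₀⟩ : ∃ w, R u w := by
          by_contra! h
          exact hbad ⟨hnear.1, h⟩
        obtain rfl := hR.right_unique h (hR.append hw₀ ha)
        exact flow_merge w₀ (hR.near_right hP hnear hw₀) c (i :: s) hc (by rw [hu]; exact hw₀)
  exact ⟨D, fun v w h => flow_split v [] w (Sum.inl 0) (by simp [contactLabel]) rfl h⟩

end SemigroupPresentation.Matching

/-- A vertex has at most one relation, hence finitely many children; induction on the level. -/
theorem SemigroupPresentation.finite_vertices {A : Type*} {P : SemigroupPresentation A}
    (hP : P.TreeLike) (x : A) (n : ℕ) :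
    {v | (∃ a, P.IsVertex x v a) ∧ v.length = n}.Finite := by
  induction n with
  | zero => exact (Set.finite_singleton []).subset fun v hv => List.length_eq_zero_iff.1 hv.2
  | succ n ih =>
    have hch : ∀ v : List ℕ, {u | ∃ i b, u = v ++ [i] ∧ P.IsVertex x u b}.Finite := by
      intro v
      by_cases h : ∃ a w, P.IsVertex x v a ∧ ([a], w) ∈ P.rels
      · obtain ⟨a, w, ha, hw⟩ := h
        refine ((Set.finite_lt_nat w.length).image fun i => v ++ [i]).subset ?_
        rintro _ ⟨i, b, rfl, hb⟩
        obtain ⟨a', w', h1, h2, h3⟩ := isVertex_concat_iff.1 hb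
        obtain rfl := h1.label_unique hP ha
        obtain rfl := hP.2 _ _ _ h2 hw
        exact ⟨i, (List.getElem?_eq_some_iff.1 h3).1, rfl⟩
      · refine Set.finite_empty.subset ?_
        rintro _ ⟨i, b, rfl, hb⟩
        obtain ⟨a', w', h1, h2, h3⟩ := isVertex_concat_iff.1 hb
        exact (h ⟨a', w', h1, h2⟩).elim
    refine (ih.biUnion fun v _ => hch v).subset ?_
    rintro u ⟨⟨b, hb⟩, hu⟩
    obtain rfl | ⟨v, i, rfl⟩ := List.eq_nil_or_concat' u
    · simp at hu
    · obtain ⟨a, _, ha, _⟩ := isVertex_concat_iff.1 hb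
      simp only [Set.mem_iUnion]
      exact ⟨v, ⟨⟨a, ha⟩, by simpa using hu⟩, i, b, rfl, hb⟩

/-! ### Trees of balls -/

theorem MetricBall.nonempty {X : Type*} [MetricSpace X] (B : MetricBall X) : B.1.Nonempty := by
  obtain ⟨x, r, hr, h⟩ := B.2
  rw [h]
  exact Metric.nonempty_ball.2 hr

theorem MetricBall.isOpen {X : Type*} [MetricSpace X] (B : MetricBall X) : IsOpen B.1 := by
  obtain ⟨x, r, hr, h⟩ := B.2
  rw [h]
  exact Metric.isOpen_ball

/-- The vertices of the tree of a presentation correspond to the balls of `X`, where the balls of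
the children of a vertex form a partition of the ball of the vertex. -/
structure BallTree {X : Type*} [MetricSpace X] {A : Type*} (P : SemigroupPresentation A) (x : A)
    (β : List ℕ → MetricBall X) : Prop where
  root : (β []).1 = Set.univ
  cover : ∀ {v a w}, P.IsVertex x v a → ([a], w) ∈ P.rels → ∀ p ∈ (β v).1,
    ∃ i b, P.IsVertex x (v ++ [i]) b ∧ p ∈ (β (v ++ [i])).1
  subset : ∀ {v i b}, P.IsVertex x (v ++ [i]) b → (β (v ++ [i])).1 ⊆ (β v).1
  disjoint : ∀ {v i j a b p}, P.IsVertex x (v ++ [i]) a → P.IsVertex x (v ++ [j]) b →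
    p ∈ (β (v ++ [i])).1 → p ∈ (β (v ++ [j])).1 → i = j
  surj : ∀ B, ∃ v a, P.IsVertex x v a ∧ β v = B

/-- A correspondence of vertices and balls for which vertices have the same label if and only if
the balls are similar, and the similarities between balls preserve the numbering of the
children. -/
structure BallCoding {X : Type*} [MetricSpace X] (S : FiniteSimilarityStructure X) {A : Type*}
    (P : SemigroupPresentation A) (x : A) (β : List ℕ → MetricBall X) : Prop
    extends BallTree P x β where
  sim_iff : ∀ {v w a b}, P.IsVertex x v a → P.IsVertex x w b →
    ((S.sim (β v) (β w)).Nonempty ↔ a = b)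
  child : ∀ {v w a i b}, P.IsVertex x v a → P.IsVertex x w a → P.IsVertex x (v ++ [i]) b →
    ∀ g ∈ S.sim (β v) (β w), ∀ y : (β v).1, (y : X) ∈ (β (v ++ [i])).1 →
      (g y : X) ∈ (β (w ++ [i])).1

namespace BallTree

variable {X : Type*} [MetricSpace X] {A : Type*} {P : SemigroupPresentation A} {x : A}
  {β : List ℕ → MetricBall X}

theorem subset_append (hβ : BallTree P x β) {v s : List ℕ} {b : A}
    (h : P.IsVertex x (v ++ s) b) : (β (v ++ s)).1 ⊆ (β v).1 := by
  induction s using List.reverseRecOn generalizing b with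
  | nil => simp
  | append_singleton s i ih =>
    rw [← List.append_assoc] at h ⊢
    obtain ⟨a, _, h1, _⟩ := isVertex_concat_iff.1 h
    exact (hβ.subset h).trans (ih h1)

/-- Balls of siblings are disjoint, so two vertices whose balls share a point cannot branch apart.
-/
theorem comparable (hβ : BallTree P x β) {v v' : List ℕ} {a a' : A} {p : X}
    (hv : P.IsVertex x v a) (hv' : P.IsVertex x v' a') (hp : p ∈ (β v).1) (hp' : p ∈ (β v').1) :
    (∃ s, v' = v ++ s) ∨ ∃ s, v = v' ++ s := by
  induction v using List.reverseRecOn generalizing a with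
  | nil => exact Or.inl ⟨v', rfl⟩
  | append_singleton v i ih =>
    obtain ⟨b, _, hb, _⟩ := isVertex_concat_iff.1 hv
    rcases ih hb (hβ.subset hv hp) with ⟨s, rfl⟩ | ⟨s, rfl⟩
    · rcases s with _ | ⟨j, s⟩
      · exact Or.inr ⟨[i], by simp⟩
      · left
        rw [show v ++ j :: s = (v ++ [j]) ++ s by simp] at hv' hp'
        obtain ⟨c, hc, _⟩ := isVertex_append_iff.1 hv'
        obtain rfl := hβ.disjoint hv hc hp (hβ.subset_append hv' hp')
        exact ⟨s, by simp⟩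
    · exact Or.inr ⟨s ++ [i], by simp⟩

/-- Right sides of length at least two are needed here: a vertex with an only child would have the
same ball as that child. -/
theorem injective (hβ : BallTree P x β) (hP : P.TreeLike) {v v' : List ℕ} {a a' : A}
    (hv : P.IsVertex x v a) (hv' : P.IsVertex x v' a') (h : (β v).1 = (β v').1) : v = v' := by
  have key : ∀ (v s : List ℕ) (a : A), P.IsVertex x (v ++ s) a → (β v).1 = (β (v ++ s)).1 →
      s = [] := by
    rintro v (_ | ⟨i, s⟩) a hv h
    · rfl
    · exfalso
      rw [show v ++ i :: s = (v ++ [i]) ++ s by simp] at hv h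
      obtain ⟨b, hb, _⟩ := isVertex_append_iff.1 hv
      obtain ⟨c, w, hc, hw, hi⟩ := isVertex_concat_iff.1 hb
      have hlen : 1 < w.length := (hP.1 _ hw).2
      obtain ⟨j, hj, hij⟩ : ∃ j < w.length, i ≠ j := by
        by_cases h : i = 0
        · exact ⟨1, hlen, by omega⟩
        · exact ⟨0, by omega, h⟩
      have hvj : P.IsVertex x (v ++ [j]) w[j] := .child hc hw (by simp [hj])
      obtain ⟨p, hp⟩ := (β (v ++ [j])).nonempty
      have hpv := hβ.subset hvj hp
      rw [h] at hpv
      exact hij (hβ.disjoint hb hvj (hβ.subset_append hv hpv) hp)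
  obtain ⟨p, hp⟩ := (β v).nonempty
  rcases hβ.comparable hv hv' hp (h ▸ hp) with ⟨s, rfl⟩ | ⟨s, rfl⟩
  · simp [key _ _ _ hv' h]
  · simp [key _ _ _ hv h.symm]

/-- Every point has balls that belong to deep vertices. -/
theorem exists_deep (hβ : BallTree P x β) (p : X) (n : ℕ) : ∃ v a, P.IsVertex x v a ∧
    p ∈ (β v).1 ∧ (n ≤ v.length ∨ ∀ w, ([a], w) ∉ P.rels) := by
  induction n with
  | zero => exact ⟨[], x, .root, by rw [hβ.root]; trivial, Or.inl (Nat.zero_le _)⟩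
  | succ n ih =>
    obtain ⟨v, a, hv, hp, h⟩ := ih
    by_cases ht : ∀ w, ([a], w) ∉ P.rels
    · exact ⟨v, a, hv, hp, Or.inr ht⟩
    · push Not at ht
      obtain ⟨w, hw⟩ := ht
      obtain ⟨i, b, hb, hpb⟩ := hβ.cover hv hw p hp
      refine ⟨_, b, hb, hpb, Or.inl ?_⟩
      have := h.resolve_right fun h => h _ hw
      simpa using this

theorem subset_iff (hβ : BallTree P x β) (hP : P.TreeLike) {v w : List ℕ} {a b : A}
    (hv : P.IsVertex x v a) (hw : P.IsVertex x w b) : (β w).1 ⊆ (β v).1 ↔ ∃ s, w = v ++ s := by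
  constructor
  · intro h
    obtain ⟨p, hp⟩ := (β w).nonempty
    rcases hβ.comparable hv hw (h hp) hp with h' | ⟨s, rfl⟩
    · exact h'
    · have := hβ.injective hP hv hw ((hβ.subset_append hv).antisymm h)
      exact ⟨[], by rw [List.append_nil]; exact this.symm⟩
  · rintro ⟨s, rfl⟩
    exact hβ.subset_append hw

/-- A ball strictly in between would belong to a vertex strictly between `v` and its child. -/
theorem covBy (hβ : BallTree P x β) (hP : P.TreeLike) {v : List ℕ} {i : ℕ} {b : A}
    (hb : P.IsVertex x (v ++ [i]) b) : β (v ++ [i]) ⋖ β v := by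
  obtain ⟨a, _, ha, _⟩ := isVertex_concat_iff.1 hb
  refine ⟨lt_of_le_of_ne (hβ.subset hb) fun h => ?_, ?_⟩
  · simpa using hβ.injective hP hb ha (congrArg Subtype.val h)
  · intro B h1 h2
    obtain ⟨u, c, hu, rfl⟩ := hβ.surj B
    obtain ⟨s, rfl⟩ := (hβ.subset_iff hP ha hu).1 h2.le
    obtain ⟨s', hs'⟩ := (hβ.subset_iff hP hu hb).1 h1.le
    have hlen := congrArg List.length hs'
    rcases s with _ | ⟨j, s⟩
    · simp at h2
    · rcases s' with _ | ⟨k, s'⟩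
      · rw [hs', List.append_nil] at h1
        exact lt_irrefl _ h1
      · simp at hlen

theorem exists_eq_of_covBy (hβ : BallTree P x β) (hP : P.TreeLike) {v : List ℕ} {a : A}
    (hv : P.IsVertex x v a) {C : MetricBall X} (hC : C ⋖ β v) :
    ∃ i b, P.IsVertex x (v ++ [i]) b ∧ β (v ++ [i]) = C := by
  obtain ⟨u, c, hu, rfl⟩ := hβ.surj C
  obtain ⟨s, rfl⟩ := (hβ.subset_iff hP hv hu).1 hC.le
  rcases s with _ | ⟨i, s⟩
  · simp at hC
  · rw [show v ++ i :: s = (v ++ [i]) ++ s by simp] at hu hC ⊢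
    obtain ⟨b, hb, _⟩ := isVertex_append_iff.1 hu
    refine ⟨i, b, hb, ?_⟩
    rcases (show β ((v ++ [i]) ++ s) ≤ β (v ++ [i]) from hβ.subset_append hu).eq_or_lt with h | h
    · exact h.symm
    · exact absurd (hβ.covBy hP hb).lt (hC.2 h)

/-- The children of a vertex of a ball, numbered as in the tree. -/
noncomputable def childEquiv (hβ : BallTree P x β) (hP : P.TreeLike) (B : MetricBall X) :
    {i // ∃ b, P.IsVertex x ((hβ.surj B).choose ++ [i]) b} ≃ {C : MetricBall X // C ⋖ B} :=
  Equiv.ofBijective (fun i => ⟨β ((hβ.surj B).choose ++ [i.1]), by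
      obtain ⟨a, ha, h⟩ := (hβ.surj B).choose_spec
      obtain ⟨i, b, hb⟩ := i
      have := hβ.covBy hP hb
      rwa [h] at this⟩) (by
    obtain ⟨a, ha, h⟩ := (hβ.surj B).choose_spec
    constructor
    · rintro ⟨i, b, hb⟩ ⟨j, c, hc⟩ hij
      have := hβ.injective hP hb hc (congrArg (fun C => C.1.1) hij)
      apply Subtype.ext
      simpa using this
    · rintro ⟨C, hC⟩
      obtain ⟨i, b, hb, hi⟩ := hβ.exists_eq_of_covBy hP ha (C := C) (by rwa [h])
      exact ⟨⟨i, b, hb⟩, Subtype.ext hi⟩)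

/-- The ball order given by the order of the tree. -/
noncomputable def ballOrder (hβ : BallTree P x β) (hP : P.TreeLike) : BallOrder X where
  lt B C C' := ((hβ.childEquiv hP B).symm C).1 < ((hβ.childEquiv hP B).symm C').1
  isStrictTotalOrder B :=
    { trichotomous := fun C C' h h' => by
        rw [not_lt] at h h'
        exact (hβ.childEquiv hP B).symm.injective (Subtype.ext (le_antisymm h' h))
      irrefl := fun C => lt_irrefl _
      trans := fun _ _ _ => lt_trans }

end BallTree

/-! ### The isomorphism for a space coded by a tree -/

namespace BallCoding

variable {X : Type*} [MetricSpace X] {S : FiniteSimilarityStructure X} {A : Type*}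
  {P : SemigroupPresentation A} {x : A} {β : List ℕ → MetricBall X}

/-- The inclusion for the inverse similarity gives the reverse inclusion. The balls are variables
with equations because `ballOrder` works with chosen vertices of balls. -/
theorem image_child (hβ : BallCoding S P x β) (hP : P.TreeLike) {v w : List ℕ} {a b : A} {i : ℕ}
    (hv : P.IsVertex x v a) (hw : P.IsVertex x w a) (hb : P.IsVertex x (v ++ [i]) b)
    {B B' : MetricBall X} (hB : β v = B) (hB' : β w = B') {g : B.1 ≃ᵈ B'.1} (hg : g ∈ S.sim B B') :
    (β (w ++ [i])).1 = {y | ∃ p : B.1, (p : X) ∈ (β (v ++ [i])).1 ∧ (g p : X) = y} := by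
  subst hB hB'
  have hb' : P.IsVertex x (w ++ [i]) b := by
    obtain ⟨c, u, h1, h2, h3⟩ := isVertex_concat_iff.1 hb
    obtain rfl := h1.label_unique hP hv
    exact .child hw h2 h3
  ext y
  constructor
  · intro hy
    refine ⟨g.symm ⟨y, hβ.subset hb' hy⟩, ?_, by simp⟩
    exact hβ.child hw hv hb' _ (S.symm_mem _ _ _ hg) _ hy
  · rintro ⟨p, hp, rfl⟩
    exact hβ.child hv hw hb g hg p hp

/-- Similar balls have vertices with equal labels, hence children in the same directions, and the
similarity preserves directions. -/
theorem compatible (hβ : BallCoding S P x β) (hP : P.TreeLike) :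
    (hβ.ballOrder hP).Compatible S := by
  intro B B' g hg
  obtain ⟨a, hv, hB⟩ := (hβ.surj B).choose_spec
  obtain ⟨a', hw, hB'⟩ := (hβ.surj B').choose_spec
  obtain rfl : a = a' := (hβ.sim_iff hv hw).1 (by rw [hB, hB']; exact ⟨g, hg⟩)
  have hiff : ∀ i, (∃ b, P.IsVertex x ((hβ.surj B).choose ++ [i]) b) ↔
      ∃ b, P.IsVertex x ((hβ.surj B').choose ++ [i]) b := by
    intro i
    constructor <;> rintro ⟨b, hb⟩ <;> obtain ⟨c, hc, h⟩ := isVertex_append_iff.1 hb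
    · obtain rfl := hc.label_unique hP hv
      exact ⟨b, isVertex_append_iff.2 ⟨_, hw, h⟩⟩
    · obtain rfl := hc.label_unique hP hw
      exact ⟨b, isVertex_append_iff.2 ⟨_, hv, h⟩⟩
  refine ⟨⟨((hβ.childEquiv hP B).symm.trans (Equiv.subtypeEquivRight hiff)).trans
    (hβ.childEquiv hP B'), ?_⟩, ?_⟩
  · intro C C'
    change ((hβ.childEquiv hP B').symm _).1 < ((hβ.childEquiv hP B').symm _).1 ↔ _
    simp only [Equiv.trans_apply, Equiv.symm_apply_apply]
    rfl
  · intro C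
    obtain ⟨i, rfl⟩ := (hβ.childEquiv hP B).surjective C
    change ((hβ.childEquiv hP B' (Equiv.subtypeEquivRight hiff
      ((hβ.childEquiv hP B).symm (hβ.childEquiv hP B i)))).1.1 : Set X) = _
    rw [Equiv.symm_apply_apply]
    obtain ⟨b, hb⟩ := i.2
    exact hβ.image_child hP hv hw hb hB hB' hg

/-- The restriction axiom leaves the target ball open; `child` for `g` and for its inverse
identifies it. -/
theorem sim_child (hβ : BallCoding S P x β) (hP : P.TreeLike) {v w : List ℕ} {a b : A} {i : ℕ}
    (hv : P.IsVertex x v a) (hw : P.IsVertex x w a) (hb : P.IsVertex x (v ++ [i]) b)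
    {g : (β v).1 ≃ᵈ (β w).1} (hg : g ∈ S.sim (β v) (β w)) :
    ∃ k ∈ S.sim (β (v ++ [i])) (β (w ++ [i])), ∀ y : (β (v ++ [i])).1,
      (k y : X) = g ⟨y, hβ.subset hb y.2⟩ := by
  obtain ⟨B, k, hk, hkg⟩ := S.restrict_mem _ _ g hg (β (v ++ [i])) (hβ.subset hb)
  have hb' : P.IsVertex x (w ++ [i]) b := by
    obtain ⟨c, u, h1, h2, h3⟩ := isVertex_concat_iff.1 hb
    obtain rfl := h1.label_unique hP hv
    exact .child hw h2 h3
  have hB : B = β (w ++ [i]) := by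
    apply Subtype.ext
    apply Set.Subset.antisymm
    · intro z hz
      obtain ⟨y, hy⟩ := k.surjective ⟨z, hz⟩
      have h1 := hβ.child hv hw hb g hg ⟨y, hβ.subset hb y.2⟩ y.2
      rw [← hkg y, hy] at h1
      exact h1
    · intro z hz
      have h1 := hβ.child hw hv hb' g.symm (S.symm_mem _ _ _ hg) ⟨z, hβ.subset hb' hz⟩ hz
      have h2 := hkg ⟨_, h1⟩
      rw [Subtype.coe_eta, DilationEquiv.apply_symm_apply] at h2
      have h3 := (k ⟨_, h1⟩).2
      rw [h2] at h3
      exact h3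
  subst hB
  exact ⟨k, hk, hkg⟩

theorem sim_append (hβ : BallCoding S P x β) (hP : P.TreeLike) {v w s : List ℕ} {a b : A}
    (hv : P.IsVertex x v a) (hw : P.IsVertex x w a) (hb : P.IsVertex x (v ++ s) b)
    {g : (β v).1 ≃ᵈ (β w).1} (hg : g ∈ S.sim (β v) (β w)) :
    ∃ k ∈ S.sim (β (v ++ s)) (β (w ++ s)), ∀ y : (β (v ++ s)).1,
      (k y : X) = g ⟨y, hβ.subset_append hb y.2⟩ := by
  induction s using List.reverseRecOn generalizing b with
  | nil =>
    rw! [List.append_nil, List.append_nil]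
    exact ⟨g, hg, fun _ => rfl⟩
  | append_singleton s i ih =>
    have hb' := hb
    rw [← List.append_assoc] at hb'
    obtain ⟨c, _, hc, _⟩ := isVertex_concat_iff.1 hb'
    obtain ⟨c', h1, h2⟩ := isVertex_append_iff.1 hc
    obtain rfl := h1.label_unique hP hv
    obtain ⟨k, hk, hkg⟩ := ih hc
    obtain ⟨k', hk', hkg'⟩ := hβ.sim_child hP hc
      (isVertex_append_iff.2 ⟨c', hw, h2⟩) hb' hk
    rw! [← List.append_assoc, ← List.append_assoc]
    exact ⟨k', hk', fun y => (hkg' y).trans (hkg _)⟩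

/-- By smallness the chosen similarity between descendants is the restriction of the one above.
Hence the action on points does not depend on the depth at which it is read off. -/
theorem sim_append_eq (hβ : BallCoding S P x β) (hS : S.Small) (hP : P.TreeLike) {v w s : List ℕ} {a b : A}
    (hv : P.IsVertex x v a) (hw : P.IsVertex x w a) (hb : P.IsVertex x (v ++ s) b)
    {g : (β v).1 ≃ᵈ (β w).1} (hg : g ∈ S.sim (β v) (β w))
    {k : (β (v ++ s)).1 ≃ᵈ (β (w ++ s)).1} (hk : k ∈ S.sim (β (v ++ s)) (β (w ++ s))) {p : X}
    (hp : p ∈ (β (v ++ s)).1) (hp' : p ∈ (β v).1) : (k ⟨p, hp⟩ : X) = g ⟨p, hp'⟩ := by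
  obtain ⟨k', hk', h⟩ := hβ.sim_append hP hv hw hb hg
  rw [hS _ _ hk hk', h]

/-- The point `p` is moved to `q` by the diagram `D`. -/
def Moves (S : FiniteSimilarityStructure X) (β : List ℕ → MetricBall X)
    (D : BraidedDiagram P [x] [x]) (p q : X) : Prop :=
  ∃ v w, (∃ a, P.IsVertex x v a) ∧ D.Flow (Sum.inl 0) v w ∧ ∃ g ∈ S.sim (β v) (β w),
    ∃ hp : p ∈ (β v).1, (g ⟨p, hp⟩ : X) = q

theorem flow_vertex (hP : P.TreeLike) {D : BraidedDiagram P [x] [x]} {v w : List ℕ} {a : A}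
    (hv : P.IsVertex x v a) (h : D.Flow (Sum.inl 0) v w) : P.IsVertex x w a :=
  h.isVertex hP (stackLabel_inl.2 hv)

/-- Each point lies in the ball of a vertex deep enough for the flow to get through, and equal
labels supply the similarity. -/
theorem exists_moves (hβ : BallCoding S P x β) (hP : P.TreeLike) (D : BraidedDiagram P [x] [x])
    (p : X) : ∃ q, Moves S β D p q := by
  obtain ⟨N, hN⟩ := exists_flow_bound hP D
  obtain ⟨v, a, hv, hp, h⟩ := hβ.exists_deep p N
  obtain ⟨w, hw⟩ := hN v a hv h
  obtain ⟨g, hg⟩ := (hβ.sim_iff hv (flow_vertex hP hv hw)).2 rfl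
  exact ⟨_, v, w, ⟨a, hv⟩, hw, g, hg, hp, rfl⟩

/-- Two vertices whose balls contain `p` are comparable, and the flow treats the longer one as the
shorter one with a tail. -/
theorem moves_unique (hβ : BallCoding S P x β) (hS : S.Small) (hP : P.TreeLike)
    {D : BraidedDiagram P [x] [x]} {p q q' : X} (h : Moves S β D p q) (h' : Moves S β D p q') :
    q = q' := by
  obtain ⟨v, w, ⟨a, hv⟩, hf, g, hg, hp, rfl⟩ := h
  obtain ⟨v', w', ⟨a', hv'⟩, hf', g', hg', hp', rfl⟩ := h'
  rcases hβ.comparable hv hv' hp hp' with ⟨s, rfl⟩ | ⟨s, rfl⟩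
  · obtain rfl := (hf.append s).unique hP hf'
    exact (hβ.sim_append_eq hS hP hv (flow_vertex hP hv hf) hv' hg hg' hp' hp).symm
  · obtain rfl := (hf'.append s).unique hP hf
    exact hβ.sim_append_eq hS hP hv' (flow_vertex hP hv' hf') hv hg' hg hp hp'

theorem Moves.of_step (hP : P.TreeLike) {D D' : BraidedDiagram P [x] [x]} (h : D.Step D') {p q : X}
    (hm : Moves S β D p q) : Moves S β D' p q := by
  obtain ⟨v, w, hv, hf, hg⟩ := hm
  exact ⟨v, w, hv, hf.of_step hP h, hg⟩

theorem moves_one (hβ : BallCoding S P x β) (p : X) : Moves S β (one P [x]) p p :=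
  ⟨[], [], ⟨x, .root⟩, .exit rfl, _, S.refl_mem _, by rw [hβ.root]; trivial, rfl⟩

/-- The vertex where the run through `D` ends and the one where the run through `E` starts are
comparable; the run with the shorter one is prolonged. -/
theorem Moves.concat (hβ : BallCoding S P x β) (hP : P.TreeLike)
    {D E : BraidedDiagram P [x] [x]} {p q r : X} (h : Moves S β D p q) (h' : Moves S β E q r) :
    Moves S β (D.concat E) p r := by
  obtain ⟨v, w, ⟨a, hv⟩, hf, g, hg, hp, rfl⟩ := h
  obtain ⟨v', w', ⟨a', hv'⟩, hf', g', hg', hp', rfl⟩ := h'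
  have hw := flow_vertex hP hv hf
  have hw' := flow_vertex hP hv' hf'
  rcases hβ.comparable hw hv' (g ⟨p, hp⟩).2 hp' with ⟨s, rfl⟩ | ⟨s, rfl⟩
  · obtain ⟨c, hc, hs⟩ := isVertex_append_iff.1 hv'
    obtain rfl := hc.label_unique hP hw
    have hvs := isVertex_append_iff.2 ⟨_, hv, hs⟩
    -- `k` restricts the inverse of `g` to the ball where `E` starts, which shows that `p` lies in
    -- the ball of `v ++ s`.
    obtain ⟨k, hk, hkg⟩ := hβ.sim_append hP hw hv hv' (S.symm_mem _ _ _ hg)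
    have h1 := hkg ⟨_, hp'⟩
    rw [Subtype.coe_eta, DilationEquiv.symm_apply_apply] at h1
    have hps := (k ⟨_, hp'⟩).2
    rw [h1] at hps
    change p ∈ _ at hps
    refine ⟨v ++ s, w', ⟨_, hvs⟩, (hf.append s).concat hf', k.symm.trans g',
      S.trans_mem _ _ _ _ (S.symm_mem _ _ _ hk) _ hg', hps, ?_⟩
    change (g' (k.symm ⟨p, hps⟩) : X) = _
    congr 2
    rw [DilationEquiv.symm_apply_eq]
    exact Subtype.ext h1.symm
  · obtain ⟨k, hk, hkg⟩ := hβ.sim_append hP hv' hw' hw hg'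
    refine ⟨v, w' ++ s, ⟨_, hv⟩, hf.concat (hf'.append s), g.trans k,
      S.trans_mem _ _ _ _ hg _ hk, hp, ?_⟩
    exact hkg _

/-- The action of the braided diagram group on `X`. -/
noncomputable def act (hβ : BallCoding S P x β) (hS : S.Small) (hP : P.TreeLike) :
    BraidedDiagramGroup P [x] → X → X :=
  -- Images of points are unique, so it is enough that a step preserves `Moves` in one direction.
  Quot.lift (fun D p => (hβ.exists_moves hP D p).choose) fun D D' h => funext fun p =>
    hβ.moves_unique hS hP ((hβ.exists_moves hP D p).choose_spec.of_step hP h)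
      (hβ.exists_moves hP D' p).choose_spec

/-- The vertices `v`, `w` for which `h` maps the ball of `v` to the ball of `w` by a chosen
similarity. -/
def Matched (S : FiniteSimilarityStructure X) (P : SemigroupPresentation A) (x : A)
    (β : List ℕ → MetricBall X) (h : X ≃ₜ X) (v w : List ℕ) : Prop :=
  ∃ a, P.IsVertex x v a ∧ P.IsVertex x w a ∧ ∃ g ∈ S.sim (β v) (β w), ∀ y, (g y : X) = h y

theorem Matched.symm {h : X ≃ₜ X} {v w : List ℕ} (hm : Matched S P x β h v w) :
    Matched S P x β h.symm w v := by
  obtain ⟨a, hv, hw, g, hg, hgh⟩ := hm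
  refine ⟨a, hw, hv, g.symm, S.symm_mem _ _ _ hg, fun y => ?_⟩
  rw [Homeomorph.eq_symm_apply, ← hgh, DilationEquiv.apply_symm_apply]


/-- Both balls are the preimage under `h` of the ball of `w`, and balls determine vertices. -/
theorem Matched.left_unique (hβ : BallCoding S P x β) (hP : P.TreeLike) {h : X ≃ₜ X}
    {v v' w : List ℕ} (hm : Matched S P x β h v w) (hm' : Matched S P x β h v' w) : v = v' := by
  have key : ∀ {v v'}, Matched S P x β h v w → Matched S P x β h v' w → (β v).1 ⊆ (β v').1 := by
    rintro v v' ⟨a, hv, hw, g, hg, hgh⟩ ⟨a', hv', hw', g', hg', hgh'⟩ y hy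
    obtain ⟨z, hz⟩ := g'.surjective (g ⟨y, hy⟩)
    have h1 := hgh' z
    rw [hz, hgh] at h1
    have h2 : y = z := h.injective h1
    exact h2 ▸ z.2
  obtain ⟨a, hv, -⟩ := id hm
  obtain ⟨a', hv', -⟩ := id hm'
  exact hβ.injective hP hv hv' (Set.Subset.antisymm (key hm hm') (key hm' hm))

theorem Matched.append (hβ : BallCoding S P x β) (hP : P.TreeLike) {h : X ≃ₜ X}
    {v w s : List ℕ} {b : A} (hm : Matched S P x β h v w) (hb : P.IsVertex x (v ++ s) b) :
    Matched S P x β h (v ++ s) (w ++ s) := by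
  obtain ⟨a, hv, hw, g, hg, hgh⟩ := hm
  obtain ⟨k, hk, hkg⟩ := hβ.sim_append hP hv hw hb hg
  obtain ⟨c, hc, hs⟩ := isVertex_append_iff.1 hb
  obtain rfl := hc.label_unique hP hv
  exact ⟨b, hb, isVertex_append_iff.2 ⟨_, hw, hs⟩, k, hk, fun y => (hkg y).trans (hgh _)⟩

theorem exists_matched (hβ : BallCoding S P x β) {h : X ≃ₜ X} (hh : S.LocallyDetermined h) (p : X) :
    ∃ v w, Matched S P x β h v w ∧ p ∈ (β v).1 := by
  obtain ⟨B, B', hp, g, hg, hgh⟩ := hh p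
  obtain ⟨v, a, hv, rfl⟩ := hβ.surj B
  obtain ⟨w, b, hw, rfl⟩ := hβ.surj B'
  obtain rfl := (hβ.sim_iff hv hw).1 ⟨g, hg⟩
  exact ⟨v, w, ⟨a, hv, hw, g, hg, hgh⟩, hp⟩

/-- Finitely many balls of matched vertices cover `X`. A vertex at least as long as all of these
lies below one of them and is matched; there are only finitely many shorter vertices. -/
theorem finite_unmatched [CompactSpace X] (hβ : BallCoding S P x β)
    (hP : P.TreeLike) {h : X ≃ₜ X} (hh : S.LocallyDetermined h) :
    {v | (∃ a, P.IsVertex x v a) ∧ ∀ w, ¬ Matched S P x β h v w}.Finite := by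
  choose f g hfg hf using hβ.exists_matched hh
  obtain ⟨t, ht⟩ := isCompact_univ.elim_finite_subcover (fun p => (β (f p)).1)
    (fun p => (β (f p)).isOpen) fun p _ => Set.mem_iUnion.2 ⟨p, hf p⟩
  refine ((Set.finite_lt_nat (t.sup fun p => (f p).length)).biUnion
    fun n _ => finite_vertices hP x n).subset ?_
  rintro v ⟨⟨a, hv⟩, hvm⟩
  simp only [Set.mem_iUnion, Set.mem_ofPred_eq, exists_prop]
  refine ⟨_, ?_, ⟨a, hv⟩, rfl⟩
  by_contra! hlen
  obtain ⟨p, hp⟩ := (β v).nonempty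
  obtain ⟨q, hq, hpq⟩ := Set.mem_iUnion₂.1 (ht (Set.mem_univ p))
  have hle : (f q).length ≤ v.length := (Finset.le_sup (f := fun p => (f p).length) hq).trans hlen
  obtain ⟨b, hb, _⟩ := hfg q
  rcases hβ.comparable hv hb hp hpq with ⟨s, hs⟩ | ⟨s, rfl⟩
  · have : s = [] := by
      rw [hs, List.length_append] at hle
      exact List.length_eq_zero_iff.1 (by omega)
    rw [this, List.append_nil] at hs
    exact hvm _ (hs ▸ hfg q)
  · exact hvm _ ((hfg q).append hβ hP hv)

/-- A matched vertex whose ball meets that of a leaf is comparable with the leaf, hence a prefix of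
it, and descendants of matched vertices are matched. -/
theorem matched_leaf (hβ : BallCoding S P x β) (hP : P.TreeLike) {h : X ≃ₜ X}
    (hh : S.LocallyDetermined h) {v : List ℕ} {a : A} (hv : P.IsVertex x v a)
    (ha : ∀ w, ([a], w) ∉ P.rels) : ∃ w, Matched S P x β h v w := by
  obtain ⟨p, hp⟩ := (β v).nonempty
  obtain ⟨v', w, hm, hp'⟩ := hβ.exists_matched hh p
  obtain ⟨b, hv', _⟩ := id hm
  rcases hβ.comparable hv hv' hp hp' with ⟨_ | ⟨i, s⟩, rfl⟩ | ⟨s, rfl⟩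
  · rw [List.append_nil] at hm
    exact ⟨w, hm⟩
  · rw [isVertex_append_iff] at hv'
    obtain ⟨c, hc, hs⟩ := hv'
    obtain ⟨u, _, hu, _⟩ := isVertex_cons_iff.1 hs
    obtain rfl := hc.label_unique hP hv
    exact absurd hu (ha u)
  · exact ⟨_, hm.append hβ hP hv⟩

/-- The conditions on the right are those on the left for the inverse homeomorphism. -/
theorem matching [CompactSpace X] [IsUltrametricDist X] (hβ : BallCoding S P x β)
    (hP : P.TreeLike) (h : S.Γ) : P.Matching x (Matched S P x β h.1) := by
  have hh : S.LocallyDetermined h.1 := h.2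
  have hh' : S.LocallyDetermined h.1.symm := (h⁻¹).2
  have hiff : ∀ v w, Matched S P x β h.1 v w ↔ Matched S P x β h.1.symm w v := fun v w =>
    ⟨Matched.symm, fun hm => by simpa using hm.symm⟩
  constructor
  · rintro v w ⟨a, hv, hw, _⟩
    exact ⟨a, hv, hw⟩
  · exact Matched.left_unique hβ hP
  · intro v w w' h1 h2
    exact h1.symm.left_unique hβ hP h2.symm
  · intro v w i b hm hb
    exact hm.append hβ hP hb
  · exact hβ.finite_unmatched hP hh
  · simp only [hiff]
    exact hβ.finite_unmatched hP hh'
  · exact hβ.matched_leaf hP hh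
  · simp only [hiff]
    exact hβ.matched_leaf hP hh'

section act

variable (hβ : BallCoding S P x β) (hS : S.Small) (hP : P.TreeLike)

theorem moves_act (D : BraidedDiagram P [x] [x]) (p : X) :
    Moves S β D p (hβ.act hS hP (.mk D) p) := (hβ.exists_moves hP D p).choose_spec

theorem act_eq {D : BraidedDiagram P [x] [x]} {p q : X} (h : Moves S β D p q) :
    hβ.act hS hP (.mk D) p = q := hβ.moves_unique hS hP (hβ.moves_act hS hP D p) h

theorem act_one (p : X) : hβ.act hS hP 1 p = p := hβ.act_eq hS hP (hβ.moves_one p)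

/-- Stacked diagrams are read downwards, so this is a right action; for this reason `homeo` inverts
its argument. -/
theorem act_mul (a b : BraidedDiagramGroup P [x]) (p : X) :
    hβ.act hS hP (a * b) p = hβ.act hS hP b (hβ.act hS hP a p) := by
  obtain ⟨D, rfl⟩ := Quot.exists_rep a
  obtain ⟨E, rfl⟩ := Quot.exists_rep b
  exact hβ.act_eq hS hP ((hβ.moves_act hS hP D p).concat hβ hP (hβ.moves_act hS hP E _))

theorem act_locally (a : BraidedDiagramGroup P [x]) (p : X) : ∃ B B' : MetricBall X, p ∈ B.1 ∧
    ∃ g ∈ S.sim B B', ∀ y : B.1, (g y : X) = hβ.act hS hP a y := by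
  obtain ⟨D, rfl⟩ := Quot.exists_rep a
  obtain ⟨v, w, hv, hf, g, hg, hp, -⟩ := hβ.moves_act hS hP D p
  refine ⟨β v, β w, hp, g, hg, fun y => ?_⟩
  exact (hβ.act_eq hS hP ⟨v, w, hv, hf, g, hg, y.2, rfl⟩).symm

theorem continuous_act (a : BraidedDiagramGroup P [x]) : Continuous (hβ.act hS hP a) := by
  rw [continuous_iff_continuousAt]
  intro p
  obtain ⟨B, B', hp, g, hg, h⟩ := hβ.act_locally hS hP a p
  refine ContinuousOn.continuousAt (s := B.1) ?_ (B.isOpen.mem_nhds hp)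
  rw [continuousOn_iff_continuous_domRestrict]
  have : B.1.domRestrict (hβ.act hS hP a) = fun y => (g y : X) := funext fun y => (h y).symm
  rw [this]
  exact continuous_subtype_val.comp (Dilation.toContinuous g)

/-- The homeomorphism given by an element of the braided diagram group. -/
noncomputable def homeo (a : BraidedDiagramGroup P [x]) : X ≃ₜ X where
  toFun := hβ.act hS hP a⁻¹
  invFun := hβ.act hS hP a
  left_inv p := by rw [← act_mul, inv_mul_cancel, act_one]
  right_inv p := by rw [← act_mul, mul_inv_cancel, act_one]
  continuous_toFun := hβ.continuous_act hS hP _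
  continuous_invFun := hβ.continuous_act hS hP _

variable [IsUltrametricDist X]

/-- The homomorphism from the braided diagram group to the group of the similarity structure. -/
noncomputable def hom : BraidedDiagramGroup P [x] →* S.Γ where
  toFun a := ⟨hβ.homeo hS hP a, hβ.act_locally hS hP a⁻¹⟩
  map_one' := by
    apply Subtype.ext
    ext p
    change hβ.act hS hP 1⁻¹ p = p
    rw [inv_one, act_one]
  map_mul' a b := by
    apply Subtype.ext
    ext p
    change hβ.act hS hP (a * b)⁻¹ p = hβ.act hS hP a⁻¹ (hβ.act hS hP b⁻¹ p)
    rw [mul_inv_rev, act_mul]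

/-- If every point is fixed, the chosen similarity from the ball of `v` to that of `w` moves
nothing, so the balls coincide and `v = w`. Then the flow is trivial, and so is the class of the
diagram. -/
theorem hom_injective : Function.Injective (hβ.hom hS hP) := by
  rw [injective_iff_map_eq_one]
  intro a ha
  have h1 : ∀ p, hβ.act hS hP a p = p := by
    intro p
    have : (hβ.homeo hS hP a).symm p = p := by
      rw [Homeomorph.symm_apply_eq]
      exact (congrArg (fun h : S.Γ => h.1 p) ha).symm
    exact this
  obtain ⟨D, rfl⟩ := Quot.exists_rep a
  refine mk_eq_one_of_flow_trivial hP D fun v b w hv hf => ?_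
  have hw := flow_vertex hP hv hf
  obtain ⟨g, hg⟩ := (hβ.sim_iff hv hw).2 rfl
  have h2 : ∀ y : (β v).1, (g y : X) = y := fun y =>
    (hβ.act_eq hS hP ⟨v, w, ⟨b, hv⟩, hf, g, hg, y.2, rfl⟩).symm.trans (h1 y)
  refine hβ.injective hP hv hw (Set.Subset.antisymm ?_ ?_)
  · intro y hy
    have := (g ⟨y, hy⟩).2
    rw [h2] at this
    exact this
  · intro z hz
    obtain ⟨y, hy⟩ := g.surjective ⟨z, hz⟩
    have := h2 y
    rw [hy] at this
    change z = y at this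
    rw [this]
    exact y.2

/-- A diagram realizing the matching of `h` moves each point as `h` does. -/
theorem hom_surjective [CompactSpace X] : Function.Surjective (hβ.hom hS hP) := by
  intro h
  obtain ⟨D, hD⟩ := (hβ.matching hP h).exists_diagram hP
  refine ⟨(BraidedDiagramGroup.mk D)⁻¹, Subtype.ext (Homeomorph.ext fun p => ?_)⟩
  change hβ.act hS hP (BraidedDiagramGroup.mk D)⁻¹⁻¹ p = h.1 p
  rw [inv_inv]
  obtain ⟨v, w, hm, hp⟩ := hβ.exists_matched h.2 p
  have hf := hD v w hm
  obtain ⟨a, hv, -, g, hg, hgh⟩ := hm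
  exact hβ.act_eq hS hP ⟨v, w, ⟨a, hv⟩, hf, g, hg, hp, hgh _⟩

end act

/-- If the balls of `X` are coded by the tree of a presentation, then the group of the similarity
structure is the braided diagram group. -/
theorem nonempty_mulEquiv [CompactSpace X] [IsUltrametricDist X] (hβ : BallCoding S P x β)
    (hS : S.Small) (hP : P.TreeLike) : Nonempty (BraidedDiagramGroup P [x] ≃* S.Γ) :=
  ⟨MulEquiv.ofBijective (hβ.hom hS hP) ⟨hβ.hom_injective hS hP, hβ.hom_surjective hS hP⟩⟩

end BallCoding

/-! ### The space of ends: cones, balls and compactness -/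

namespace SemigroupPresentation

variable {A : Type*} {P : SemigroupPresentation A} {x : A}

theorem pathVertex_succ (p : ℕ → Option ℕ) (n : ℕ) :
    pathVertex p (n + 1) = pathVertex p n ++ (p n).toList := by
  simp only [pathVertex, List.range_succ, List.filterMap_append]
  congr 1

theorem pathVertex_congr {p q : ℕ → Option ℕ} {n : ℕ} (h : ∀ i < n, p i = q i) :
    pathVertex p n = pathVertex q n := by
  induction n with
  | zero => rfl
  | succ n ih =>
    rw [pathVertex_succ, pathVertex_succ, ih fun i hi => h i (by omega), h n (by omega)]

theorem length_pathVertex_le (p : ℕ → Option ℕ) (n : ℕ) : (pathVertex p n).length ≤ n := by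
  simpa [pathVertex] using List.length_filterMap_le p (List.range n)

theorem pathVertex_eq_take {p : ℕ → Option ℕ} {v : List ℕ} (h : ∀ i < v.length, p i = v[i]?)
    {n : ℕ} (hn : n ≤ v.length) : pathVertex p n = v.take n := by
  induction n with
  | zero => simp [pathVertex]
  | succ n ih =>
    rw [pathVertex_succ, ih (by omega), h n (by omega), List.take_add_one]

/-- A path passes through `v` if it does so after as many steps as `v` is long. -/
theorem pathVertex_eq_iff {p : ℕ → Option ℕ} {v : List ℕ} :
    pathVertex p v.length = v ↔ ∀ i < v.length, p i = v[i]? := by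
  constructor
  · induction v using List.reverseRecOn with
    | nil => simp
    | append_singleton v j ih =>
      intro h
      rw [List.length_append, List.length_singleton, pathVertex_succ] at h
      have hle := length_pathVertex_le p v.length
      have hlen := congrArg List.length h
      rcases hp : p v.length with _ | k
      · simp [hp] at hlen
        omega
      · rw [hp] at h
        obtain ⟨h1, h2⟩ := List.append_inj' h rfl
        obtain rfl : k = j := by simpa using h2
        intro i hi
        rw [List.length_append, List.length_singleton] at hi
        rcases Nat.lt_succ_iff_lt_or_eq.1 hi with hi | rfl
        · rw [ih h1 i hi, List.getElem?_append_left hi]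
        · simp [hp]
  · intro h
    rw [pathVertex_eq_take h le_rfl, List.take_length]

namespace Ends

theorem apply_none {p : P.Ends x} {m n : ℕ} (h : p.1 m = none) (hmn : m ≤ n) : p.1 n = none := by
  induction n, hmn using Nat.le_induction with
  | base => exact h
  | succ n _ ih => exact (p.2 n).1 ih

theorem length_pathVertex (p : P.Ends x) {n : ℕ} (h : p.1 n ≠ none) :
    (pathVertex p.1 n).length = n := by
  have : pathVertex p.1 n = (List.range n).map fun i => (p.1 i).getD 0 := by
    rw [pathVertex, ← List.filterMap_eq_map]
    apply List.filterMap_congr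
    intro j hj
    rcases hj' : p.1 j with _ | k
    · exact absurd (apply_none hj' (List.mem_range.1 hj).le) h
    · simp [hj']
  simp [this]

/-- The ends that pass through the vertex `v`. -/
def cone (P : SemigroupPresentation A) (x : A) (v : List ℕ) : Set (P.Ends x) :=
  {p | ∀ i < v.length, p.1 i = v[i]?}

theorem mem_cone_iff {v : List ℕ} {p : P.Ends x} :
    p ∈ cone P x v ↔ pathVertex p.1 v.length = v := pathVertex_eq_iff.symm

theorem mem_cone_concat {v : List ℕ} {i : ℕ} {p : P.Ends x} :
    p ∈ cone P x (v ++ [i]) ↔ p ∈ cone P x v ∧ p.1 v.length = some i := by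
  constructor
  · intro h
    refine ⟨fun j hj => ?_, ?_⟩
    · rw [h j (by simp; omega), List.getElem?_append_left hj]
    · rw [h v.length (by simp)]; simp
  · rintro ⟨h, h'⟩ j hj
    rw [List.length_append, List.length_singleton] at hj
    rcases Nat.lt_succ_iff_lt_or_eq.1 hj with hj | rfl
    · rw [h j hj, List.getElem?_append_left hj]
    · simp [h']

theorem exists_isVertex (p : P.Ends x) (n : ℕ) : ∃ a, P.IsVertex x (pathVertex p.1 n) a :=
  (p.2 n).2.imp fun _ h => h.1

/-- A path may stop only at a leaf, by definition, and must stop there, since a further step needs a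
child. -/
theorem apply_eq_none_iff (hP : P.TreeLike) (p : P.Ends x) {n : ℕ} {a : A}
    (ha : P.IsVertex x (pathVertex p.1 n) a) : p.1 n = none ↔ ∀ w, ([a], w) ∉ P.rels := by
  constructor
  · intro h
    obtain ⟨b, hb, h'⟩ := (p.2 n).2
    obtain rfl := hb.label_unique hP ha
    exact h' h
  · intro h
    rcases hp : p.1 n with _ | i
    · rfl
    · obtain ⟨b, hb⟩ := p.exists_isVertex (n + 1)
      rw [pathVertex_succ, hp] at hb
      obtain ⟨c, w, h1, h2, h3⟩ := isVertex_concat_iff.1 hb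
      obtain rfl := h1.label_unique hP ha
      exact absurd h2 (h w)

/-- The ends through a vertex of a path are those that agree with the path for as long as it takes
to get to the vertex. -/
theorem mem_cone_pathVertex (hP : P.TreeLike) (p q : P.Ends x) (n : ℕ) :
    q ∈ cone P x (pathVertex p.1 n) ↔ ∀ i < n, q.1 i = p.1 i := by
  induction n with
  | zero => simp [cone, pathVertex]
  | succ n ih =>
    have hsucc : (∀ i < n + 1, q.1 i = p.1 i) ↔ (∀ i < n, q.1 i = p.1 i) ∧ q.1 n = p.1 n := by
      simp only [Nat.lt_succ_iff_lt_or_eq, or_imp, forall_and, forall_eq]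
    rw [hsucc, ← ih, pathVertex_succ]
    rcases hp : p.1 n with _ | i
    · simp only [Option.toList_none, List.append_nil, iff_self_and]
      intro h
      obtain ⟨a, ha⟩ := p.exists_isVertex n
      have h1 := (p.apply_eq_none_iff hP ha).1 hp
      rw [← pathVertex_congr (ih.1 h)] at ha
      exact (q.apply_eq_none_iff hP ha).2 h1
    · rw [Option.toList_some, mem_cone_concat, p.length_pathVertex (by simp [hp])]

/-- Nonzero distances are of the form `e ^ (-c)`, so a radius matters only through the threshold `m`
for `c`. -/
theorem dist_lt_iff {p q : P.Ends x} {r : ℝ} {m : ℕ} (hr : 0 < r)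
    (hm : ∀ c : ℕ, Real.exp (-(c : ℝ)) < r ↔ m ≤ c) : dist q p < r ↔ ∀ i < m, q.1 i = p.1 i := by
  by_cases h : q = p
  · simp [h, hr]
  · rw [dist_of_ne h, hm, common, ← PiNat.mem_cylinder_iff_le_firstDiff fun h' => h (Subtype.ext h')]
    rfl

/-- With `m` least such that `e ^ (-m) < r`, the ball consists of the ends that agree with `p` for
`m` steps. The vertex is where `p` is by then, possibly a leaf reached earlier. -/
theorem exists_cone_eq_ball (hP : P.TreeLike) (p : P.Ends x) {r : ℝ} (hr : 0 < r) :
    ∃ v a, P.IsVertex x v a ∧ Metric.ball p r = cone P x v := by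
  have hex : ∃ m : ℕ, Real.exp (-(m : ℝ)) < r := by
    obtain ⟨m, hm⟩ := exists_nat_gt (-Real.log r)
    exact ⟨m, by rw [← Real.lt_log_iff_exp_lt hr]; linarith⟩
  classical
  obtain ⟨a, ha⟩ := p.exists_isVertex (Nat.find hex)
  refine ⟨_, a, ha, ?_⟩
  ext q
  rw [Metric.mem_ball, mem_cone_pathVertex hP, dist_lt_iff hr]
  intro c
  constructor
  · exact Nat.find_min' hex
  · intro h
    refine lt_of_le_of_lt (Real.exp_le_exp.2 ?_) (Nat.find_spec hex)
    exact neg_le_neg (by exact_mod_cast h)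

/-- Every vertex lies on some path. -/
theorem nonempty_cone {v : List ℕ} {a : A} (hv : P.IsVertex x v a) :
    (cone P x v).Nonempty := by
  classical
  -- A greedy path: towards `v` while possible, then to any child until there is none.
  let f : List ℕ → Option ℕ := fun u =>
    if h : ∃ i, (∃ b, P.IsVertex x (u ++ [i]) b) ∧ u ++ [i] <+: v then some h.choose
    else if h : ∃ i b, P.IsVertex x (u ++ [i]) b then some h.choose else none
  have hf : ∀ u i, f u = some i → ∃ b, P.IsVertex x (u ++ [i]) b := by
    intro u i hi
    simp only [f] at hi
    split_ifs at hi with h h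
    · exact (Option.some.inj hi) ▸ h.choose_spec.1
    · exact (Option.some.inj hi) ▸ h.choose_spec
  have hf' : ∀ u, f u = none → ∀ b, P.IsVertex x u b → ∀ w, ([b], w) ∉ P.rels := by
    intro u hu b hb w hw
    simp only [f] at hu
    split_ifs at hu with h h'
    have := List.length_pos_iff.2 (P.right_ne_nil _ hw)
    exact h' ⟨0, w[0], .child hb hw (by simp [this])⟩
  let U : ℕ → List ℕ := fun n => Nat.rec [] (fun _ u => u ++ (f u).toList) n
  have hU : ∀ n, U (n + 1) = U n ++ (f (U n)).toList := fun n => rfl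
  have hUv : ∀ n, ∃ b, P.IsVertex x (U n) b := by
    intro n
    induction n with
    | zero => exact ⟨x, .root⟩
    | succ n ih =>
      rw [hU]
      rcases h : f (U n) with _ | i
      · simpa using ih
      · exact hf _ _ h
  have hpU : ∀ n, pathVertex (fun n => f (U n)) n = U n := by
    intro n
    induction n with
    | zero => rfl
    | succ n ih => rw [pathVertex_succ, ih, hU]
  have hUt : ∀ n ≤ v.length, U n = v.take n := by
    intro n hn
    induction n with
    | zero => simp [U]
    | succ n ih =>
      have ih := ih (by omega)
      have hex : ∃ i, (∃ b, P.IsVertex x (U n ++ [i]) b) ∧ U n ++ [i] <+: v := by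
        have heq : U n ++ [v[n]] = v.take (n + 1) := by rw [ih]; simp
        refine ⟨v[n], ?_, ?_⟩
        · rw [heq]
          rw [← List.take_append_drop (n + 1) v, isVertex_append_iff] at hv
          exact hv.imp fun _ h => h.1
        · rw [heq]
          exact List.take_prefix _ _
      -- The choice is forced here, as only one extension of `U n` by one step is a prefix of `v`.
      have : f (U n) = some hex.choose := dif_pos hex
      rw [hU, this]
      have h2 := List.prefix_iff_eq_take.1 hex.choose_spec.2
      rw [Option.toList_some, h2, List.length_append, List.length_singleton, ih,
        List.length_take, min_eq_left (by omega)]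
  refine ⟨⟨fun n => f (U n), fun n => ⟨fun h => ?_, ?_⟩⟩, ?_⟩
  · change f (U (n + 1)) = none
    have h : f (U n) = none := h
    rw [hU, h]
    simpa using h
  · obtain ⟨b, hb⟩ := hUv n
    exact ⟨b, by rw [hpU]; exact hb, fun h => hf' _ h b hb⟩
  · refine mem_cone_iff.2 ?_
    change pathVertex (fun n => f (U n)) v.length = v
    rw [hpU, hUt _ le_rfl, List.take_length]

instance : Nonempty (P.Ends x) := ⟨(nonempty_cone (.root : P.IsVertex x [] x)).some⟩

theorem exists_ball_eq_cone (hP : P.TreeLike) {v : List ℕ} {a : A} (hv : P.IsVertex x v a) :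
    ∃ (p : P.Ends x) (r : ℝ), 0 < r ∧ cone P x v = Metric.ball p r := by
  obtain ⟨p, hp⟩ := nonempty_cone hv
  -- A radius strictly between `e ^ (-m)` and `e ^ (-(m - 1))` for `m = v.length`, so that nearness
  -- means at least `m` common edges.
  refine ⟨p, Real.exp (-(v.length : ℝ) + 1 / 2), Real.exp_pos _, ?_⟩
  ext q
  rw [Metric.mem_ball, dist_lt_iff (Real.exp_pos _) (m := v.length),
    ← mem_cone_pathVertex hP, mem_cone_iff.1 hp]
  intro c
  rw [Real.exp_lt_exp]
  constructor
  · intro h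
    have : (v.length : ℝ) < c + 1 := by linarith
    have : v.length < c + 1 := by exact_mod_cast this
    omega
  · intro h
    have : (v.length : ℝ) ≤ c := by exact_mod_cast h
    linarith

open Classical in
/-- The ball of all ends that pass through the vertex `v`. -/
noncomputable def coneBall (P : SemigroupPresentation A) (x : A) (v : List ℕ) :
    MetricBall (P.Ends x) :=
  if h : ∃ (p : P.Ends x) (r : ℝ), 0 < r ∧ cone P x v = Metric.ball p r then ⟨cone P x v, h⟩
  -- A default for lists whose cone is not a ball; over a tree-like presentation no vertex needs it.
  else ⟨Metric.ball (Classical.arbitrary _) 1, _, 1, one_pos, rfl⟩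

theorem coe_coneBall (hP : P.TreeLike) {v : List ℕ} {a : A} (hv : P.IsVertex x v a) :
    (coneBall P x v).1 = cone P x v := by
  rw [coneBall, dif_pos (exists_ball_eq_cone hP hv)]

theorem ballTree (hP : P.TreeLike) (x : A) : BallTree P x (coneBall P x) where
  root := by
    rw [coe_coneBall hP .root]
    simp [cone]
  cover := by
    intro v a w hv hw p hp
    rw [coe_coneBall hP hv, mem_cone_iff] at hp
    rcases h : p.1 v.length with _ | i
    · rw [p.apply_eq_none_iff hP (hp.symm ▸ hv)] at h
      exact absurd hw (h w)
    · obtain ⟨b, hb⟩ := p.exists_isVertex (v.length + 1)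
      rw [pathVertex_succ, hp, h, Option.toList_some] at hb
      refine ⟨i, b, hb, ?_⟩
      rw [coe_coneBall hP hb]
      exact mem_cone_concat.2 ⟨mem_cone_iff.2 hp, h⟩
  subset := by
    intro v i b hb p hp
    obtain ⟨a, _, ha, _⟩ := isVertex_concat_iff.1 hb
    rw [coe_coneBall hP hb] at hp
    rw [coe_coneBall hP ha]
    exact (mem_cone_concat.1 hp).1
  disjoint := by
    intro v i j a b p ha hb hpa hpb
    rw [coe_coneBall hP ha, mem_cone_concat] at hpa
    rw [coe_coneBall hP hb, mem_cone_concat] at hpb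
    exact Option.some.inj (hpa.2.symm.trans hpb.2)
  surj := by
    rintro ⟨_, p, r, hr, rfl⟩
    obtain ⟨v, a, hv, h⟩ := exists_cone_eq_ball hP p hr
    exact ⟨v, a, hv, Subtype.ext ((coe_coneBall hP hv).trans h.symm)⟩

/-- The space of ends of the tree of a tree-like presentation is compact. -/
theorem compactSpace (hP : P.TreeLike) : CompactSpace (P.Ends x) := by
  -- Each coordinate takes finitely many values, so an ultrafilter makes it eventually constant;
  -- these constants form the limit.
  have hfin : ∀ n, (Set.range fun p : P.Ends x => p.1 n).Finite := by
    intro n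
    refine (((Set.finite_le_nat (n + 1)).biUnion fun k _ => finite_vertices hP x k).image
      fun v : List ℕ => v[n]?).subset ?_
    rintro _ ⟨p, rfl⟩
    refine ⟨pathVertex p.1 (n + 1), ?_, ?_⟩
    · simp only [Set.mem_iUnion]
      exact ⟨_, length_pathVertex_le _ _, p.exists_isVertex _, rfl⟩
    · change (pathVertex p.1 (n + 1))[n]? = p.1 n
      rcases hp : p.1 n with _ | i
      · rw [pathVertex_succ, hp]
        simpa using length_pathVertex_le p.1 n
      · have hlen := p.length_pathVertex (n := n) (by simp [hp])
        rw [pathVertex_succ, hp, Option.toList_some, List.getElem?_append_right hlen.le, hlen]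
        simp
  refine ⟨isCompact_iff_ultrafilter_le_nhds.2 fun f _ => ?_⟩
  have hval : ∀ n, ∃ a, ∀ᶠ p in (f : Filter (P.Ends x)), p.1 n = a := by
    intro n
    obtain ⟨a, -, ha⟩ := Ultrafilter.eq_pure_of_finite_mem (f := f.map fun p => p.1 n) (hfin n)
      (by rw [Ultrafilter.mem_map]; exact Filter.univ_mem' fun p => ⟨p, rfl⟩)
    refine ⟨a, ?_⟩
    have : {a} ∈ f.map fun p => p.1 n := by rw [ha]; exact Set.mem_singleton a
    exact this
  choose q hq using hval
  have hq' : ∀ n, ∀ᶠ p in (f : Filter (P.Ends x)), ∀ i < n, p.1 i = q i := fun n =>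
    (Filter.eventually_all_finite (Set.finite_lt_nat n)).2 fun i _ => hq i
  have hqE : ∀ n, (q n = none → q (n + 1) = none) ∧
      ∃ a, P.IsVertex x (pathVertex q n) a ∧ (q n = none → ∀ w, ([a], w) ∉ P.rels) := by
    intro n
    -- The condition at `n` involves the coordinates up to `n + 1`, so agreement in `n + 2`
    -- coordinates transfers it from `p` to `q`.
    obtain ⟨p, hp⟩ := (hq' (n + 2)).exists
    have := p.2 n
    rwa [hp n (by omega), hp (n + 1) (by omega),
      pathVertex_congr fun i hi => hp i (by omega)] at this
  obtain ⟨e, he⟩ : ∃ e : P.Ends x, e.1 = q := ⟨⟨q, hqE⟩, rfl⟩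
  refine ⟨e, trivial, ?_⟩
  subst he
  rw [Metric.nhds_basis_ball.ge_iff]
  intro r hr
  obtain ⟨m, hm⟩ := exists_nat_gt (-Real.log r)
  filter_upwards [hq' m] with p hp
  rw [Metric.mem_ball]
  by_cases h : p = e
  · rw [h, _root_.dist_self]; exact hr
  · rw [dist_of_ne h, ← Real.lt_log_iff_exp_lt hr]
    have : m ≤ common p e := by
      rw [common, ← PiNat.mem_cylinder_iff_le_firstDiff fun h' => h (Subtype.ext h')]
      exact hp
    have : (m : ℝ) ≤ common p e := by exact_mod_cast this
    linarith

end Ends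
end SemigroupPresentation

/-! ### The similarity structure on the space of ends -/

namespace SemigroupPresentation.Ends

variable {A : Type*} {P : SemigroupPresentation A} {x : A}

/-- Replacing the initial segment `v` of a path by `w`. -/
def replace (v w : List ℕ) (p : ℕ → Option ℕ) (n : ℕ) : Option ℕ :=
  if n < w.length then w[n]? else p (v.length + (n - w.length))

theorem replace_add (v w : List ℕ) (p : ℕ → Option ℕ) (n : ℕ) :
    replace v w p (w.length + n) = p (v.length + n) := by
  simp [replace]

theorem replace_of_lt (v : List ℕ) {w : List ℕ} (p : ℕ → Option ℕ) {n : ℕ} (h : n < w.length) :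
    replace v w p n = w[n]? := if_pos h

theorem exists_pathVertex_replace (v w : List ℕ) {p : ℕ → Option ℕ} (h : pathVertex p v.length = v)
    (n : ℕ) : ∃ s, pathVertex p (v.length + n) = v ++ s ∧
      pathVertex (replace v w p) (w.length + n) = w ++ s := by
  induction n with
  | zero => exact ⟨[], by simpa using h, by
      simpa using pathVertex_eq_iff.2 fun i hi => replace_of_lt v p hi⟩
  | succ n ih =>
    obtain ⟨s, h1, h2⟩ := ih
    refine ⟨s ++ (p (v.length + n)).toList, ?_, ?_⟩
    · rw [← add_assoc, pathVertex_succ, h1, List.append_assoc]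
    · rw [← add_assoc, pathVertex_succ, h2, replace_add, List.append_assoc]

/-- The new path runs along `w` and then through a subtree labelled like the one it comes from, so
the conditions for stopping carry over. -/
theorem isEnd_replace (hP : P.TreeLike) {v w : List ℕ} {a : A} (hv : P.IsVertex x v a)
    (hw : P.IsVertex x w a) {p : P.Ends x} (hp : p ∈ cone P x v) (n : ℕ) :
    (replace v w p.1 n = none → replace v w p.1 (n + 1) = none) ∧
    ∃ a, P.IsVertex x (pathVertex (replace v w p.1) n) a ∧
      (replace v w p.1 n = none → ∀ u, ([a], u) ∉ P.rels) := by
  rcases lt_or_ge n w.length with hn | hn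
  · have hne : replace v w p.1 n ≠ none := by
      rw [replace_of_lt _ _ hn]
      simp [hn]
    refine ⟨fun h => absurd h hne, ?_⟩
    rw [pathVertex_eq_take (fun i hi => replace_of_lt v p.1 hi) hn.le]
    rw [← List.take_append_drop n w, isVertex_append_iff] at hw
    obtain ⟨b, hb, _⟩ := hw
    exact ⟨b, hb, fun h => absurd h hne⟩
  · obtain ⟨k, rfl⟩ := Nat.exists_eq_add_of_le hn
    obtain ⟨s, h1, h2⟩ := exists_pathVertex_replace v w (mem_cone_iff.1 hp) k
    rw [add_assoc, replace_add, replace_add, h2]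
    obtain ⟨h3, b, h4, h5⟩ := p.2 (v.length + k)
    refine ⟨h3, b, ?_, h5⟩
    rw [h1, isVertex_append_iff] at h4
    obtain ⟨c, hc, h6⟩ := h4
    obtain rfl := hc.label_unique hP hv
    exact isVertex_append_iff.2 ⟨_, hw, h6⟩

/-- `g` maps each end by replacing the initial segment `v` by `w`. -/
def Shifts (v w : List ℕ) {B B' : Set (P.Ends x)} (g : B → B') : Prop :=
  ∀ y n, (g y).1.1 (w.length + n) = y.1.1 (v.length + n)

theorem eq_of_shift {v : List ℕ} {p q : P.Ends x} (hp : p ∈ cone P x v) (hq : q ∈ cone P x v)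
    (h : ∀ n, p.1 (v.length + n) = q.1 (v.length + n)) : p = q := by
  apply Subtype.ext
  funext n
  rcases lt_or_ge n v.length with hn | hn
  · rw [hp n hn, hq n hn]
  · obtain ⟨k, rfl⟩ := Nat.exists_eq_add_of_le hn
    exact h k

theorem common_eq {p q : P.Ends x} {n : ℕ} (h : ∀ i < n, p.1 i = q.1 i) (hn : p.1 n ≠ q.1 n) :
    common p q = n := by
  have hne : p.1 ≠ q.1 := fun h' => hn (congrFun h' n)
  refine le_antisymm ?_ ?_
  · by_contra! hlt
    exact hn (PiNat.apply_eq_of_lt_firstDiff (E := fun _ => Option ℕ) hlt)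
  · exact (PiNat.mem_cylinder_iff_le_firstDiff (E := fun _ => Option ℕ) hne n).1 h

/-- The first difference moves from `v.length + k` to `w.length + k`, which explains the factor. -/
theorem dist_shift {v w : List ℕ} {p q p' q' : P.Ends x} (hp : p ∈ cone P x v)
    (hq : q ∈ cone P x v) (hp' : p' ∈ cone P x w) (hq' : q' ∈ cone P x w)
    (h : ∀ n, p'.1 (w.length + n) = p.1 (v.length + n))
    (h' : ∀ n, q'.1 (w.length + n) = q.1 (v.length + n)) :
    dist p' q' = Real.exp ((v.length : ℝ) - w.length) * dist p q := by
  by_cases hpq : p = q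
  · subst hpq
    obtain rfl := eq_of_shift hp' hq' fun n => (h n).trans (h' n).symm
    simp
  have hne : p.1 ≠ q.1 := fun h => hpq (Subtype.ext h)
  have h1 : v.length ≤ common p q :=
    (PiNat.mem_cylinder_iff_le_firstDiff (E := fun _ => Option ℕ) hne _).1
      fun i hi => (hp i hi).trans (hq i hi).symm
  obtain ⟨k, hk⟩ := Nat.exists_eq_add_of_le h1
  have hdiff : p.1 (v.length + k) ≠ q.1 (v.length + k) := by
    rw [← hk]
    exact PiNat.apply_firstDiff_ne (E := fun _ => Option ℕ) hne
  have hdiff' : p'.1 (w.length + k) ≠ q'.1 (w.length + k) := by rwa [h, h']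
  have hk' : common p' q' = w.length + k := by
    refine common_eq (fun i hi => ?_) hdiff'
    rcases lt_or_ge i w.length with hn | hn
    · rw [hp' i hn, hq' i hn]
    · obtain ⟨j, rfl⟩ := Nat.exists_eq_add_of_le hn
      rw [h, h']
      exact PiNat.apply_eq_of_lt_firstDiff (E := fun _ => Option ℕ)
        (show v.length + j < common p q by omega)
  have hne' : p' ≠ q' := fun e => hdiff' (by rw [e])
  rw [dist_of_ne hpq, dist_of_ne hne', hk, hk', ← Real.exp_add]
  congr 1
  push_cast
  ring

theorem mem_cone_of_mem_coneBall (hP : P.TreeLike) {v : List ℕ} {a : A} (hv : P.IsVertex x v a)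
    {p : P.Ends x} (hp : p ∈ (coneBall P x v).1) : p ∈ cone P x v := by
  rwa [coe_coneBall hP hv] at hp

/-- The similarities of balls that replace initial segments are unique. -/
theorem subsingleton_shifts (hP : P.TreeLike) (B B' : MetricBall (P.Ends x)) :
    {g : B.1 ≃ᵈ B'.1 | ∃ v w a, P.IsVertex x v a ∧ P.IsVertex x w a ∧ coneBall P x v = B ∧
      coneBall P x w = B' ∧ Shifts v w g}.Subsingleton := by
  rintro g ⟨v, w, a, hv, hw, rfl, rfl, hg⟩ g' ⟨v', w', a', hv', hw', h1, h2, hg'⟩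
  obtain rfl := (ballTree hP x).injective hP hv' hv (congrArg Subtype.val h1)
  obtain rfl := (ballTree hP x).injective hP hw' hw (congrArg Subtype.val h2)
  refine DilationEquiv.ext fun y => Subtype.ext ?_
  exact eq_of_shift (mem_cone_of_mem_coneBall hP hw (g y).2)
    (mem_cone_of_mem_coneBall hP hw (g' y).2) fun n => (hg y n).trans (hg' y n).symm

/-- The subtrees of vertices with the same label have similar spaces of ends. -/
theorem exists_shifts (hP : P.TreeLike) {v w : List ℕ} {a : A} (hv : P.IsVertex x v a)
    (hw : P.IsVertex x w a) : ∃ g : cone P x v ≃ᵈ cone P x w, Shifts v w g := by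
  let f : ∀ {v w : List ℕ}, P.IsVertex x v a → P.IsVertex x w a → cone P x v → cone P x w :=
    fun {v w} hv hw p => ⟨⟨replace v w p.1.1, isEnd_replace hP hv hw p.2⟩,
      fun i hi => replace_of_lt v p.1.1 hi⟩
  have hf : ∀ {v w : List ℕ} (hv : P.IsVertex x v a) (hw : P.IsVertex x w a) (y : cone P x v) n,
      (f hv hw y).1.1 (w.length + n) = y.1.1 (v.length + n) :=
    fun {v w} hv hw y n => replace_add v w y.1.1 n
  have hinv : ∀ {v w : List ℕ} (hv : P.IsVertex x v a) (hw : P.IsVertex x w a) (y : cone P x v),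
      f hw hv (f hv hw y) = y := fun {v w} hv hw y => Subtype.ext <|
    eq_of_shift (f hw hv (f hv hw y)).2 y.2 fun n =>
      (hf hw hv _ n).trans (hf hv hw y n)
  refine ⟨{ toFun := f hv hw
            invFun := f hw hv
            left_inv := hinv hv hw
            right_inv := hinv hw hv
            edist_eq' := ?_ }, hf hv hw⟩
  exact (Dilation.mkOfDistEq (f hv hw) ⟨⟨Real.exp ((v.length : ℝ) - w.length), (Real.exp_pos _).le⟩,
    (NNReal.coe_ne_zero.1 (Real.exp_pos _).ne'), fun y z => dist_shift y.2 z.2 (f hv hw y).2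
      (f hv hw z).2 (hf hv hw y) (hf hv hw z)⟩).edist_eq'

/-- The similarity structure on the space of ends: the similarities are those that replace the
initial segment of a path by another one that leads to a vertex with the same label. -/
noncomputable def similarityStructure (hP : P.TreeLike) (x : A) :
    FiniteSimilarityStructure (P.Ends x) where
  sim B B' := {g | ∃ v w a, P.IsVertex x v a ∧ P.IsVertex x w a ∧ coneBall P x v = B ∧
    coneBall P x w = B' ∧ Shifts v w g}
  finite B B' := (subsingleton_shifts hP B B').finite
  refl_mem B := by
    obtain ⟨v, a, hv, rfl⟩ := (ballTree hP x).surj B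
    exact ⟨v, v, a, hv, hv, rfl, rfl, fun _ _ => rfl⟩
  symm_mem := by
    rintro B B' g ⟨v, w, a, hv, hw, h1, h2, hg⟩
    refine ⟨w, v, a, hw, hv, h2, h1, fun y n => ?_⟩
    have := hg (g.symm y) n
    rw [DilationEquiv.apply_symm_apply] at this
    exact this.symm
  trans_mem := by
    rintro B B' B'' g ⟨v, w, a, hv, hw, h1, h2, hg⟩ g' ⟨v', w', a', hv', hw', h1', h2', hg'⟩
    obtain rfl := (ballTree hP x).injective hP hv' hw (congrArg Subtype.val (h1'.trans h2.symm))
    obtain rfl := hw.label_unique hP hv'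
    exact ⟨v, w', a, hv, hw', h1, h2', fun y n => (hg' (g y) n).trans (hg y n)⟩
  restrict_mem := by
    rintro B B' g ⟨v, w, a, hv, hw, rfl, rfl, hg⟩ B₃ hB
    obtain ⟨u, b, hu, rfl⟩ := (ballTree hP x).surj B₃
    obtain ⟨s, rfl⟩ := ((ballTree hP x).subset_iff hP hv hu).1 hB
    obtain ⟨c, hc, hs⟩ := isVertex_append_iff.1 hu
    obtain rfl := hc.label_unique hP hv
    have hws := isVertex_append_iff.2 ⟨_, hw, hs⟩
    obtain ⟨k, hk⟩ : ∃ k : (coneBall P x (v ++ s)).1 ≃ᵈ (coneBall P x (w ++ s)).1,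
        Shifts (v ++ s) (w ++ s) k := by
      rw [coe_coneBall hP hu, coe_coneBall hP hws]
      exact exists_shifts hP hu hws
    refine ⟨coneBall P x (w ++ s), k, ⟨_, _, b, hu, hws, rfl, rfl, hk⟩, fun y => ?_⟩
    have h1 := mem_cone_of_mem_coneBall hP hws (k y).2
    have h2 := mem_cone_of_mem_coneBall hP hw (g ⟨y, hB y.2⟩).2
    have h3 := mem_cone_of_mem_coneBall hP hu y.2
    have h4 := mem_cone_of_mem_coneBall hP hw ((ballTree hP x).subset_append hws (k y).2)
    refine eq_of_shift h4 h2 fun n => ?_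
    rw [hg ⟨y, hB y.2⟩ n]
    -- Along `s` both ends follow `s`; beyond it both continue as `y` does.
    rcases lt_or_ge n s.length with hn | hn
    · rw [h1 _ (by simpa using hn), h3 _ (by simpa using hn)]
      simp [List.getElem?_append_right]
    · obtain ⟨j, rfl⟩ := Nat.exists_eq_add_of_le hn
      have := hk y j
      rw [List.length_append, List.length_append, add_assoc, add_assoc] at this
      exact this

theorem small_similarityStructure (hP : P.TreeLike) : (similarityStructure hP x).Small :=
  subsingleton_shifts hP

/-- Vertices with equal labels are linked by a shift; `child` is the shift condition for the first
step after the initial segments. -/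
theorem ballCoding (hP : P.TreeLike) (x : A) :
    BallCoding (similarityStructure hP x) P x (coneBall P x) where
  toBallTree := ballTree hP x
  sim_iff := by
    intro v w a b hv hw
    constructor
    · rintro ⟨g, v', w', c, hv', hw', h1, h2, -⟩
      obtain rfl := (ballTree hP x).injective hP hv' hv (congrArg Subtype.val h1)
      obtain rfl := (ballTree hP x).injective hP hw' hw (congrArg Subtype.val h2)
      rw [hv.label_unique hP hv', hw.label_unique hP hw']
    · rintro rfl
      obtain ⟨k, hk⟩ : ∃ k : (coneBall P x v).1 ≃ᵈ (coneBall P x w).1, Shifts v w k := by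
        rw [coe_coneBall hP hv, coe_coneBall hP hw]
        exact exists_shifts hP hv hw
      exact ⟨k, v, w, a, hv, hw, rfl, rfl, hk⟩
  child := by
    rintro v w a i b hv hw hb g ⟨v', w', c, hv', hw', h1, h2, hg⟩ y hy
    obtain rfl := (ballTree hP x).injective hP hv' hv (congrArg Subtype.val h1)
    obtain rfl := (ballTree hP x).injective hP hw' hw (congrArg Subtype.val h2)
    have hb' : P.IsVertex x (w' ++ [i]) b := by
      obtain ⟨d, hd, h⟩ := isVertex_append_iff.1 hb
      obtain rfl := hd.label_unique hP hv
      exact isVertex_append_iff.2 ⟨_, hw, h⟩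
    have hgy := mem_cone_of_mem_coneBall hP hw (g y).2
    rw [coe_coneBall hP hb, mem_cone_concat] at hy
    rw [coe_coneBall hP hb', mem_cone_concat]
    exact ⟨hgy, (hg y 0).trans hy.2⟩

end SemigroupPresentation.Ends

/-! ### Balls of a compact ultrametric space -/

namespace MetricBall

variable {X : Type*} [MetricSpace X]

theorem nontrivial_of_lt {B C : MetricBall X} (h : C < B) : B.1.Nontrivial := by
  obtain ⟨p, hp⟩ := C.nonempty
  obtain ⟨q, hq, hqC⟩ := Set.exists_of_ssubset (show C.1 ⊂ B.1 from h)
  exact ⟨p, h.le hp, q, hq, fun e => hqC (e ▸ hp)⟩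

variable [IsUltrametricDist X]

theorem eq_ball_of_mem (B : MetricBall X) {p : X} (hp : p ∈ B.1) :
    ∃ r, 0 < r ∧ B.1 = Metric.ball p r := by
  obtain ⟨y, r, hr, hB⟩ := B.2
  rw [hB] at hp
  exact ⟨r, hr, hB.trans (IsUltrametricDist.ball_eq_of_mem hp)⟩

theorem le_or_le {B C : MetricBall X} {p : X} (hB : p ∈ B.1) (hC : p ∈ C.1) : B ≤ C ∨ C ≤ B := by
  obtain ⟨r, _, hr⟩ := B.eq_ball_of_mem hB
  obtain ⟨s, _, hs⟩ := C.eq_ball_of_mem hC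
  change B.1 ⊆ C.1 ∨ C.1 ⊆ B.1
  rw [hr, hs]
  exact (le_total r s).imp Metric.ball_subset_ball Metric.ball_subset_ball

/-- Different maximal proper subballs are disjoint. -/
theorem eq_of_covBy {B C D : MetricBall X} (hC : C ⋖ B) (hD : D ⋖ B) {p : X} (hpC : p ∈ C.1)
    (hpD : p ∈ D.1) : C = D := by
  rcases le_or_le hpC hpD with h | h
  · exact h.eq_of_not_lt fun h => hC.2 h hD.lt
  · exact (h.eq_of_not_lt fun h => hD.2 h hC.lt).symm

variable [CompactSpace X]

theorem isCompact (B : MetricBall X) : IsCompact B.1 := by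
  obtain ⟨x, r, _, h⟩ := B.2
  rw [h]
  exact (IsUltrametricDist.isClosed_ball x r).isCompact

/-- The maximal proper subballs of a ball with at least two points cover it. -/
theorem exists_covBy {B : MetricBall X} (hB : B.1.Nontrivial) {p : X} (hp : p ∈ B.1) :
    ∃ C, C ⋖ B ∧ p ∈ C.1 := by
  -- `z` is a point of `B` farthest from `p`. The open ball about `p` of radius `dist p z` misses
  -- `z`, and every ball of larger radius contains `B`.
  obtain ⟨z, hz, hmax⟩ := B.isCompact.exists_isMaxOn ⟨p, hp⟩
    (continuous_const.dist continuous_id : Continuous fun y => dist p y).continuousOn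
  have hmax : ∀ y ∈ B.1, dist p y ≤ dist p z := fun y hy => hmax hy
  obtain ⟨q, hq, hqp⟩ := hB.exists_ne p
  have hpos : 0 < dist p z := (dist_pos.2 hqp.symm).trans_le (hmax q hq)
  obtain ⟨r, hr, hBr⟩ := B.eq_ball_of_mem hp
  have hzr : dist p z < r := by
    rw [hBr, Metric.mem_ball, dist_comm] at hz
    exact hz
  refine ⟨⟨Metric.ball p (dist p z), p, _, hpos, rfl⟩, ⟨?_, ?_⟩, Metric.mem_ball_self hpos⟩
  · refine lt_of_le_of_ne ?_ ?_
    · change Metric.ball p (dist p z) ⊆ B.1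
      rw [hBr]
      exact Metric.ball_subset_ball hzr.le
    · intro h
      rw [← h] at hz
      simp [dist_comm] at hz
  · intro D h1 h2
    have hpD : p ∈ D.1 := h1.le (Metric.mem_ball_self hpos)
    obtain ⟨s, hs, hDs⟩ := D.eq_ball_of_mem hpD
    obtain ⟨y, hy, hyD⟩ := Set.exists_of_ssubset (show D.1 ⊂ B.1 from h2)
    rw [hDs, Metric.mem_ball, not_lt, dist_comm] at hyD
    refine h1.not_ge ?_
    change D.1 ⊆ Metric.ball p (dist p z)
    rw [hDs]
    exact Metric.ball_subset_ball (hyD.trans (hmax y hy))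

instance (B : MetricBall X) : Finite {C : MetricBall X // C ⋖ B} := by
  rcases isEmpty_or_nonempty {C : MetricBall X // C ⋖ B} with h | ⟨⟨C₀, hC₀⟩⟩
  · infer_instance
  · obtain ⟨t, ht⟩ := B.isCompact.elim_finite_subcover
      (fun C : {C : MetricBall X // C ⋖ B} => C.1.1) (fun C => C.1.isOpen) fun p hp => by
        obtain ⟨C, hC, hpC⟩ := exists_covBy (nontrivial_of_lt hC₀.lt) hp
        exact Set.mem_iUnion.2 ⟨⟨C, hC⟩, hpC⟩
    refine Set.finite_univ_iff.1 (t.finite_toSet.subset fun C _ => ?_)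
    obtain ⟨p, hp⟩ := C.1.nonempty
    obtain ⟨D, hD, hpD⟩ := Set.mem_iUnion₂.1 (ht (C.2.le hp))
    rwa [Subtype.ext (eq_of_covBy C.2 D.2 hp hpD)]

/-- Every ball is contained in only finitely many balls. -/
theorem finite_ge (B : MetricBall X) : {C : MetricBall X | B ≤ C}.Finite := by
  classical
  obtain ⟨p, hp⟩ := B.nonempty
  obtain ⟨r, hr, hB⟩ := B.eq_ball_of_mem hp
  obtain ⟨t, ht⟩ := isCompact_univ.elim_finite_subcover (fun q : X => Metric.ball q r)
    (fun q => Metric.isOpen_ball) fun q _ => Set.mem_iUnion.2 ⟨q, Metric.mem_ball_self hr⟩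
  -- A ball containing `B` is a union of balls of the radius `r` of `B`, so it is determined by the
  -- points of the finite net `t` in it.
  have key : ∀ C : MetricBall X, B ≤ C → ∀ y z, dist y z < r → z ∈ C.1 → y ∈ C.1 := by
    intro C hC y z hyz hz
    obtain ⟨s, hs, hCs⟩ := C.eq_ball_of_mem (hC hp)
    rw [hCs, Metric.mem_ball] at hz
    rcases le_total r s with h | h
    · rw [hCs, Metric.mem_ball]
      exact (dist_triangle_max y z p).trans_lt (max_lt (hyz.trans_le h) hz)
    · apply hC
      rw [hB, Metric.mem_ball]
      exact (dist_triangle_max y z p).trans_lt (max_lt hyz (hz.trans_le h))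
  refine Set.Finite.of_finite_image (f := fun C : MetricBall X => t.filter (· ∈ C.1))
    (t.powerset.finite_toSet.subset ?_) ?_
  · rintro _ ⟨C, _, rfl⟩
    exact Finset.mem_coe.2 (Finset.mem_powerset.2 (Finset.filter_subset _ _))
  · have hle : ∀ C D : MetricBall X, B ≤ C → B ≤ D → t.filter (· ∈ C.1) = t.filter (· ∈ D.1) →
        C ≤ D := by
      intro C D hC hD h y hy
      obtain ⟨q, hq, hyq⟩ := Set.mem_iUnion₂.1 (ht (Set.mem_univ y))
      have hqC : q ∈ t.filter (· ∈ C.1) :=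
        Finset.mem_filter.2 ⟨hq, key C hC q y (by rw [dist_comm]; exact hyq) hy⟩
      rw [h] at hqC
      exact key D hD y q hyq (Finset.mem_filter.1 hqC).2
    exact fun C hC D hD h => le_antisymm (hle C D hC hD h) (hle D C hD hC h.symm)

end MetricBall

theorem exists_list_pairwise {α : Type*} [Finite α] (r : α → α → Prop) [IsStrictTotalOrder α r] :
    ∃ l : List α, l.Pairwise r ∧ ∀ a, a ∈ l := by
  classical
  let := linearOrderOfSTO r
  have := Fintype.ofFinite α
  exact ⟨Finset.univ.sort, (Finset.sortedLT_sort _).pairwise, by simp⟩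

/-! ### The presentation of a similarity structure and its ball coding -/

namespace BallOrder

variable {X : Type*} [MetricSpace X] (O : BallOrder X)

theorem eq_of_pairwise {B : MetricBall X} {l l' : List {C : MetricBall X // C ⋖ B}}
    (h : l.Pairwise (O.lt B)) (h' : l'.Pairwise (O.lt B)) (hl : ∀ C, C ∈ l) (hl' : ∀ C, C ∈ l') :
    l = l' := by
  have := O.isStrictTotalOrder B
  refine List.Perm.eq_of_pairwise' h h' ?_
  rw [List.perm_ext_iff_of_nodup h.nodup h'.nodup]
  exact fun C => ⟨fun _ => hl' C, fun _ => hl C⟩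

variable [IsUltrametricDist X] [CompactSpace X]

theorem exists_children (B : MetricBall X) : ∃ l : List {C : MetricBall X // C ⋖ B},
    l.Pairwise (O.lt B) ∧ ∀ C, C ∈ l := by
  have := O.isStrictTotalOrder B
  exact exists_list_pairwise _

/-- The maximal proper subballs of a ball, listed in order. -/
noncomputable def children (B : MetricBall X) : List {C : MetricBall X // C ⋖ B} :=
  (O.exists_children B).choose

theorem pairwise_children (B : MetricBall X) : (O.children B).Pairwise (O.lt B) :=
  (O.exists_children B).choose_spec.1

theorem mem_children {B : MetricBall X} (C : {C : MetricBall X // C ⋖ B}) : C ∈ O.children B :=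
  (O.exists_children B).choose_spec.2 C

theorem nodup_children (B : MetricBall X) : (O.children B).Nodup :=
  have := O.isStrictTotalOrder B
  (O.pairwise_children B).nodup

theorem nontrivial_of_children_ne_nil {B : MetricBall X} (h : O.children B ≠ []) :
    B.1.Nontrivial := by
  obtain ⟨C, hC⟩ := List.exists_mem_of_ne_nil _ h
  exact MetricBall.nontrivial_of_lt C.2.lt

/-- The maximal proper subballs cover the ball, which a single proper subball cannot do. -/
theorem one_lt_length_children {B : MetricBall X} (h : O.children B ≠ []) :
    1 < (O.children B).length := by
  by_contra! hle
  obtain ⟨C, hC⟩ := List.exists_mem_of_ne_nil _ h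
  obtain ⟨q, hq, hqC⟩ := Set.exists_of_ssubset (show C.1.1 ⊂ B.1 from C.2.lt)
  obtain ⟨D, hD, hqD⟩ := MetricBall.exists_covBy (O.nontrivial_of_children_ne_nil h) hq
  have hD' := O.mem_children ⟨D, hD⟩
  obtain ⟨E, hE⟩ := List.length_eq_one_iff.1 (le_antisymm hle (List.length_pos_iff.2 h))
  rw [hE, List.mem_singleton] at hC hD'
  rw [hC, ← hD'] at hqC
  exact hqC hqD

variable {O} {S : FiniteSimilarityStructure X}

/-- A chosen similarity matches the lists of maximal proper subballs. -/
theorem Compatible.exists_children_map (h : O.Compatible S) {B B' : MetricBall X}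
    {g : B.1 ≃ᵈ B'.1} (hg : g ∈ S.sim B B') :
    ∃ e : {C : MetricBall X // C ⋖ B} → {C : MetricBall X // C ⋖ B'},
      O.children B' = (O.children B).map e ∧ ∀ C, S.ballClass (e C).1 = S.ballClass C.1 ∧
        ∀ y : B.1, (y : X) ∈ C.1.1 → (g y : X) ∈ (e C).1.1 := by
  obtain ⟨e, he⟩ := h B B' g hg
  refine ⟨e, ?_, fun C => ⟨?_, ?_⟩⟩
  · refine O.eq_of_pairwise (O.pairwise_children B') ?_ O.mem_children fun C => ?_
    · rw [List.pairwise_map]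
      exact (O.pairwise_children B).imp fun h => e.map_rel_iff.2 h
    · exact List.mem_map.2 ⟨e.symm C, O.mem_children _, by simp⟩
  · obtain ⟨B₄, k, hk, hkg⟩ := S.restrict_mem B B' g hg C.1 C.2.le
    have : B₄ = (e C).1 := by
      apply Subtype.ext
      rw [he]
      ext y
      constructor
      · intro hy
        obtain ⟨z, hz⟩ := k.surjective ⟨y, hy⟩
        refine ⟨⟨z, C.2.le z.2⟩, z.2, ?_⟩
        rw [← hkg, hz]
      · rintro ⟨z, hz, rfl⟩
        have h1 := hkg ⟨z, hz⟩
        have h2 := (k ⟨z, hz⟩).2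
        rw [h1] at h2
        exact h2
    subst this
    symm
    exact Quotient.sound ⟨k, hk⟩
  · intro y hy
    rw [he]
    exact ⟨y, hy, rfl⟩

end BallOrder

namespace FiniteSimilarityStructure

variable {X : Type*} [MetricSpace X] [IsUltrametricDist X] [CompactSpace X]
  {S : FiniteSimilarityStructure X} {O : BallOrder X}

/-- Relations may be read off any representative: by compatibility a chosen similarity carries the
ordered subballs of one representative to those of another, class by class. Hence a letter has only
one right side. -/
theorem mem_rels_iff (h : O.Compatible S) {B : MetricBall X} {w : List S.BallClass} :
    ([S.ballClass B], w) ∈ (S.presentation O).rels ↔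
      O.children B ≠ [] ∧ w = (O.children B).map fun C => S.ballClass C.1 := by
  constructor
  · rintro ⟨B', l, hl, hl', hne, heq⟩
    obtain rfl := O.eq_of_pairwise hl (O.pairwise_children B') hl' O.mem_children
    simp only [Prod.mk.injEq, List.cons.injEq, and_true] at heq
    obtain ⟨heq, rfl⟩ := heq
    obtain ⟨g, hg⟩ : (S.sim B' B).Nonempty := Quotient.exact heq.symm
    obtain ⟨e, he, he'⟩ := h.exists_children_map hg
    rw [he]
    refine ⟨by simpa using hne, ?_⟩
    rw [List.map_map]
    exact List.map_congr_left fun C _ => (he' C).1.symm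
  · rintro ⟨h1, rfl⟩
    exact ⟨B, O.children B, O.pairwise_children B, O.mem_children, h1, rfl⟩

theorem treeLike_presentation (h : O.Compatible S) : (S.presentation O).TreeLike := by
  constructor
  · rintro _ ⟨B, l, hl, hl', hne, rfl⟩
    obtain rfl := O.eq_of_pairwise hl (O.pairwise_children B) hl' O.mem_children
    refine ⟨rfl, ?_⟩
    rw [List.length_map]
    exact O.one_lt_length_children hne
  · intro a w₁ w₂ h₁ h₂
    obtain ⟨B, rfl⟩ := Quotient.exists_rep a
    rw [((mem_rels_iff h (B := B)).1 h₁).2, ((mem_rels_iff h (B := B)).1 h₂).2]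

variable [Nonempty X]

/-- The ball reached from the whole space by the given directions. -/
noncomputable def vertexBall (O : BallOrder X) (v : List ℕ) : MetricBall X :=
  -- A direction without a subball leaves the ball unchanged; this does not occur along vertices.
  v.foldl (fun B i => (((O.children B)[i]?).map Subtype.val).getD B) (MetricBall.whole X)

theorem vertexBall_concat {v : List ℕ} {i : ℕ} {C : {C : MetricBall X // C ⋖ vertexBall O v}}
    (h : (O.children (vertexBall O v))[i]? = some C) : vertexBall O (v ++ [i]) = C.1 := by
  rw [vertexBall, List.foldl_append]
  change (((O.children (vertexBall O v))[i]?).map Subtype.val).getD _ = _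
  rw [h]
  rfl

/-- The relation at a vertex may be read off `vertexBall O v` itself, so labels and balls descend
together. -/
theorem eq_ballClass (h : O.Compatible S) {v : List ℕ} {a : S.BallClass}
    (hv : (S.presentation O).IsVertex (S.ballClass (MetricBall.whole X)) v a) :
    a = S.ballClass (vertexBall O v) := by
  induction v using List.reverseRecOn generalizing a with
  | nil => exact isVertex_nil_iff.1 hv
  | append_singleton v i ih =>
    obtain ⟨b, w, h1, h2, h3⟩ := isVertex_concat_iff.1 hv
    obtain rfl := ih h1
    obtain ⟨-, rfl⟩ := (mem_rels_iff h).1 h2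
    rw [List.getElem?_map, Option.map_eq_some_iff] at h3
    obtain ⟨C, hC, rfl⟩ := h3
    rw [vertexBall_concat hC]

theorem exists_child_of_isVertex (h : O.Compatible S) {v : List ℕ} {i : ℕ} {b : S.BallClass}
    (hb : (S.presentation O).IsVertex (S.ballClass (MetricBall.whole X)) (v ++ [i]) b) :
    ∃ C : {C : MetricBall X // C ⋖ vertexBall O v}, (O.children (vertexBall O v))[i]? = some C := by
  obtain ⟨a, w, h1, h2, h3⟩ := isVertex_concat_iff.1 hb
  obtain rfl := eq_ballClass h h1
  obtain ⟨-, rfl⟩ := (mem_rels_iff h).1 h2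
  rw [List.getElem?_map, Option.map_eq_some_iff] at h3
  exact h3.imp fun _ h => h.1

theorem isVertex_concat (h : O.Compatible S) {v : List ℕ} {a : S.BallClass}
    (hv : (S.presentation O).IsVertex (S.ballClass (MetricBall.whole X)) v a)
    (C : {C : MetricBall X // C ⋖ vertexBall O v}) :
    ∃ i b, (S.presentation O).IsVertex (S.ballClass (MetricBall.whole X)) (v ++ [i]) b ∧
      vertexBall O (v ++ [i]) = C.1 := by
  obtain ⟨i, hi⟩ := List.mem_iff_getElem?.1 (O.mem_children C)
  obtain rfl := eq_ballClass h hv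
  refine ⟨i, S.ballClass C.1, .child hv ((mem_rels_iff h).2 ⟨?_, rfl⟩) ?_, vertexBall_concat hi⟩
  · exact List.ne_nil_of_mem (O.mem_children C)
  · rw [List.getElem?_map, hi]
    rfl

theorem ballTree (h : O.Compatible S) :
    BallTree (S.presentation O) (S.ballClass (MetricBall.whole X)) (vertexBall O) where
  root := rfl
  cover := by
    intro v a w hv hw p hp
    obtain rfl := eq_ballClass h hv
    have hne := ((mem_rels_iff h).1 hw).1
    obtain ⟨C, hC, hpC⟩ := MetricBall.exists_covBy (O.nontrivial_of_children_ne_nil hne) hp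
    obtain ⟨i, b, hb, hi⟩ := isVertex_concat h hv ⟨C, hC⟩
    exact ⟨i, b, hb, by rw [hi]; exact hpC⟩
  subset := by
    intro v i b hb
    obtain ⟨C, hC⟩ := exists_child_of_isVertex h hb
    rw [vertexBall_concat hC]
    exact C.2.le
  disjoint := by
    intro v i j a b p ha hb hpa hpb
    obtain ⟨C, hC⟩ := exists_child_of_isVertex h ha
    obtain ⟨D, hD⟩ := exists_child_of_isVertex h hb
    rw [vertexBall_concat hC] at hpa
    rw [vertexBall_concat hD] at hpb
    obtain rfl : C = D := Subtype.ext (MetricBall.eq_of_covBy C.2 D.2 hpa hpb)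
    obtain ⟨hi, hi'⟩ := List.getElem?_eq_some_iff.1 hC
    obtain ⟨hj, hj'⟩ := List.getElem?_eq_some_iff.1 hD
    exact ((O.nodup_children _).getElem_inj_iff).1 (hi'.trans hj'.symm)
  surj := by
    intro B
    -- Finitely many balls contain `B`, so some vertex ball containing `B` is minimal. If it were
    -- larger than `B`, its child through a point of `B` would still contain `B`.
    let F : Set (MetricBall X) := {C | B ≤ C ∧ ∃ v a,
      (S.presentation O).IsVertex (S.ballClass (MetricBall.whole X)) v a ∧ vertexBall O v = C}
    have hF : F.Finite := B.finite_ge.subset fun C hC => hC.1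
    obtain ⟨C, hC⟩ := hF.exists_minimal
      ⟨MetricBall.whole X, fun _ _ => trivial, [], _, .root, rfl⟩
    obtain ⟨hBC, v, a, hv, rfl⟩ := hC.prop
    refine ⟨v, a, hv, ?_⟩
    by_contra hne
    have hlt : B < vertexBall O v := lt_of_le_of_ne hBC fun e => hne e.symm
    obtain ⟨p, hp⟩ := B.nonempty
    obtain ⟨D, hD, hpD⟩ := MetricBall.exists_covBy (MetricBall.nontrivial_of_lt hlt) (hBC hp)
    obtain ⟨i, b, hb, hi⟩ := isVertex_concat h hv ⟨D, hD⟩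
    have hBD : B ≤ D := by
      rcases MetricBall.le_or_le hp hpD with h | h
      · exact h
      · exact (h.eq_of_not_lt fun h => hD.2 h hlt).ge
    exact hD.lt.not_ge (hC.le_of_le ⟨hBD, _, b, hb, hi⟩ hD.le)

/-- Labels are classes of balls, so equal labels mean similar balls; compatibility of the order
preserves the numbering of children. -/
theorem ballCoding (h : O.Compatible S) :
    BallCoding S (S.presentation O) (S.ballClass (MetricBall.whole X)) (vertexBall O) where
  toBallTree := ballTree h
  sim_iff := by
    intro v w a b hv hw
    rw [eq_ballClass h hv, eq_ballClass h hw]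
    exact ⟨fun h => Quotient.sound h, fun h => Quotient.exact h⟩
  child := by
    intro v w a i b hv hw hb g hg y hy
    obtain ⟨C, hC⟩ := exists_child_of_isVertex h hb
    rw [vertexBall_concat hC] at hy
    obtain ⟨e, he, he'⟩ := h.exists_children_map hg
    have : (O.children (vertexBall O w))[i]? = some (e C) := by
      rw [he, List.getElem?_map, hC]
      rfl
    rw [vertexBall_concat this]
    exact (he' C).2 y hy

end FiniteSimilarityStructure

/-! ### The theorem, from the two codings -/

theorem theorem4p6 :
    (∀ (X : Type*) [MetricSpace X] [IsUltrametricDist X] [CompactSpace X] [Nonempty X]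
      (S : FiniteSimilarityStructure X) (O : BallOrder X), S.Small → O.Compatible S →
      (S.presentation O).TreeLike ∧
        Nonempty (S.Γ ≃*
          BraidedDiagramGroup (S.presentation O) [S.ballClass (MetricBall.whole X)])) ∧
    (∀ {A : Type*} (P : SemigroupPresentation A) (x : A), P.TreeLike →
      Nonempty (P.Ends x) ∧ CompactSpace (P.Ends x) ∧
        ∃ (S : FiniteSimilarityStructure (P.Ends x)) (O : BallOrder (P.Ends x)),
          S.Small ∧ O.Compatible S ∧ Nonempty (BraidedDiagramGroup P [x] ≃* S.Γ)) := by
  refine ⟨?_, ?_⟩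
  · intro X _ _ _ _ S O hS hO
    have hP := FiniteSimilarityStructure.treeLike_presentation hO
    obtain ⟨e⟩ := (FiniteSimilarityStructure.ballCoding hO).nonempty_mulEquiv hS hP
    exact ⟨hP, ⟨e.symm⟩⟩
  · intro A P x hP
    have := Ends.compactSpace hP (x := x)
    have hβ := Ends.ballCoding hP x
    exact ⟨inferInstance, this, Ends.similarityStructure hP x, hβ.ballOrder hP,
      Ends.small_similarityStructure hP, hβ.compatible hP,
      hβ.nonempty_mulEquiv (Ends.small_similarityStructure hP) hP⟩
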